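/- Let $n\ge 1$, $s\ge 1$, and let $(M^{2n+s},g)$ be a smooth Riemannian manifold with Levi-Civita connection $\nabla$, curvature tensor $R_{X,Y}=[\nabla_X,\nabla_Y]-\nabla_{[X,Y]}$, Ricci tensor $\mathrm{Ric}(X,Y)=\mathrm{trace}(Z\mapsto R_{Z,X}Y)$ and scalar curvature $r=\mathrm{trace}_g\,\mathrm{Ric}$. Let $(f,Q,\xi_i,\eta^i,g)$, $1\le i\le s$, be a weak metric $f$-structure on $M$: $f$ is a $g$-skew-symmetric $(1,1)$-tensor field of rank $2n$, $Q$ is a $g$-self-adjoint nonsingular $(1,1)$-tensor field, $\xi_i$ are orthonormal vector fields and $\eta^i$ are dual 1-forms such that $$f^2=-Q+\sum_i\eta^i\otimes\xi_i,\quad \eta^i(\xi_j)=\delta^i_j,\quad Q\xi_i=\xi_i,\quad g(fX,fY)=g(X,QY)-\sum_i\eta^i(X)\,\eta^i(Y),$$ and the distribution $\mathcal D=\bigcap_i\ker\eta^i$ is $f$-invariant. Put $\bar\xi=\sum_i\xi_i$ and $\bar\eta=\sum_i\eta^i$. Suppose that $M$ is a weak $\beta f$-Kenmotsu manifold with a constant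 $\beta\ne0$: $$(\nabla_Xf)Y=\beta\{g(fX,Y)\,\bar\xi-\bar\eta(Y)\,fX\},$$ and that, if $s>1$, the structure is normal: $[f,f](X,Y)+2\sum_i d\eta^i(X,Y)\,\xi_i=0$, where $[f,f](X,Y)=f^2[X,Y]+[fX,fY]-f[fX,Y]-f[X,fY]$ and $2\,d\eta^i(X,Y)=X(\eta^i(Y))-Y(\eta^i(X))-\eta^i([X,Y])$ (here $X,Y$ are arbitrary smooth vector fields). Suppose that $M$ is $\eta$-Einstein, that is, for some smooth functions $a,b$ on $M$, $$\mathrm{Ric}=a\,g-a\sum_i\eta^i\otimes\eta^i+(a+b)\,\bar\eta\otimes\bar\eta,$$ and that a smooth vector field $V$ and constants $\lambda,\mu\in\mathbb R$ define a $*$-$\eta$-Ricci soliton, $$\tfrac12\mathcal L_Vg+\mathrm{Ric}^*=\lambda\Big\{g-\sum_i\eta^i\otimes\eta^i\Big\}+(\lambda+\mu)\,\bar\eta\otimes\bar\eta,\qquad \mathrm{Ric}^*(X,Y)=\tfrac12\,\mathrm{trace}\{Z\mapsto fR_{X,fY}Z\}.$$ If $s>1$, assume moreover that $V\in\mathcal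 D$ everywhere. Then $a=-2sn\beta^2$, $b=2(s-1)n\beta^2$ and $r=-2sn(2n+1)\beta^2$ on $M$. If $s=1$, then $(M,g)$ is an Einstein manifold. -/

import Mathlib

open Bundle VectorField FiberBundle
open scoped Manifold ContDiff RealInnerProductSpace

set_option linter.unusedSectionVars false

namespace FKenmotsu

noncomputable section

variable {E : Type*} [NormedAddCommGroup E] [NormedSpace ℝ E] [FiniteDimensional ℝ E]
  [CompleteSpace E] {H : Type*} [TopologicalSpace H] {I : ModelWithCorners ℝ E H}
  {M : Type*} [TopologicalSpace M] [ChartedSpace H M] [IsManifold I ∞ M]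
  [RiemannianBundle (fun x : M ↦ TangentSpace I x)]
  [IsContMDiffRiemannianBundle I ∞ E (fun x : M ↦ TangentSpace I x)]

/-! ### The Levi-Civita connection -/

/-- The right-hand side of the Koszul formula for `g(∇_X Y, Z)`. -/
def koszul (X Y Z : Π x : M, TangentSpace I x) (x : M) : ℝ :=
  (1 / 2 : ℝ) * (mvfderiv I (fun y ↦ ⟪Y y, Z y⟫) x (X x)
    + mvfderiv I (fun y ↦ ⟪Z y, X y⟫) x (Y x)
    - mvfderiv I (fun y ↦ ⟪X y, Y y⟫) x (Z x)
    + ⟪mlieBracket I X Y x, Z x⟫ - ⟪mlieBracket I X Z x, Y x⟫ - ⟪mlieBracket I Y Z x, X x⟫)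

theorem mdifferentiableAt_inner {X Y : Π x : M, TangentSpace I x} {x : M}
    (hX : MDiffAt (T% X) x) (hY : MDiffAt (T% Y) x) : MDiffAt (fun y ↦ ⟪X y, Y y⟫) x :=
  MDifferentiableAt.inner_bundle (IB := I) (F := E) (E := fun x : M ↦ TangentSpace I x)
    (b := fun y ↦ y) hX hY

theorem koszul_tensorial_left {Y Z : Π x : M, TangentSpace I x} {x : M}
    (hY : MDiffAt (T% Y) x) (hZ : MDiffAt (T% Z) x) :
    TensorialAt I E (fun X ↦ koszul X Y Z x) x where
  smul {f X} hf hX := by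
    have h1 : mvfderiv I (fun y ↦ ⟪Z y, (f • X) y⟫) x
        = f x • mvfderiv I (fun y ↦ ⟪Z y, X y⟫) x + ⟪Z x, X x⟫ • mvfderiv I f x := by
      rw [← mvfderiv_fun_mul hf (mdifferentiableAt_inner hZ hX)]
      simp [inner_smul_right]
    have h2 : mvfderiv I (fun y ↦ ⟪(f • X) y, Y y⟫) x
        = f x • mvfderiv I (fun y ↦ ⟪X y, Y y⟫) x + ⟪X x, Y x⟫ • mvfderiv I f x := by
      rw [← mvfderiv_fun_mul hf (mdifferentiableAt_inner hX hY)]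
      simp [inner_smul_left]
    simp only [koszul, h1, h2, mlieBracket_smul_left hf hX]
    simp [inner_add_left, inner_smul_left, inner_smul_right, real_inner_comm]
    ring
  add {X X'} hX hX' := by
    have h1 : mvfderiv I (fun y ↦ ⟪Z y, (X + X') y⟫) x
        = mvfderiv I (fun y ↦ ⟪Z y, X y⟫) x + mvfderiv I (fun y ↦ ⟪Z y, X' y⟫) x := by
      rw [← mvfderiv_fun_add (mdifferentiableAt_inner hZ hX) (mdifferentiableAt_inner hZ hX')]
      simp [inner_add_right]
    have h2 : mvfderiv I (fun y ↦ ⟪(X + X') y, Y y⟫) x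
        = mvfderiv I (fun y ↦ ⟪X y, Y y⟫) x + mvfderiv I (fun y ↦ ⟪X' y, Y y⟫) x := by
      rw [← mvfderiv_fun_add (mdifferentiableAt_inner hX hY) (mdifferentiableAt_inner hX' hY)]
      simp [inner_add_left]
    simp only [koszul, h1, h2, mlieBracket_add_left hX hX']
    simp [inner_add_left, inner_add_right]
    ring

theorem koszul_tensorial_right {X Y : Π x : M, TangentSpace I x} {x : M}
    (hX : MDiffAt (T% X) x) (hY : MDiffAt (T% Y) x) :
    TensorialAt I E (fun Z ↦ koszul X Y Z x) x where
  smul {f Z} hf hZ := by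
    have h1 : mvfderiv I (fun y ↦ ⟪Y y, (f • Z) y⟫) x
        = f x • mvfderiv I (fun y ↦ ⟪Y y, Z y⟫) x + ⟪Y x, Z x⟫ • mvfderiv I f x := by
      rw [← mvfderiv_fun_mul hf (mdifferentiableAt_inner hY hZ)]
      simp [inner_smul_right]
    have h2 : mvfderiv I (fun y ↦ ⟪(f • Z) y, X y⟫) x
        = f x • mvfderiv I (fun y ↦ ⟪Z y, X y⟫) x + ⟪Z x, X x⟫ • mvfderiv I f x := by
      rw [← mvfderiv_fun_mul hf (mdifferentiableAt_inner hZ hX)]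
      simp [inner_smul_left]
    simp only [koszul, h1, h2, mlieBracket_smul_right hf hZ]
    simp [inner_add_left, inner_smul_left, inner_smul_right, real_inner_comm]
    ring
  add {Z Z'} hZ hZ' := by
    have h1 : mvfderiv I (fun y ↦ ⟪Y y, (Z + Z') y⟫) x
        = mvfderiv I (fun y ↦ ⟪Y y, Z y⟫) x + mvfderiv I (fun y ↦ ⟪Y y, Z' y⟫) x := by
      rw [← mvfderiv_fun_add (mdifferentiableAt_inner hY hZ) (mdifferentiableAt_inner hY hZ')]
      simp [inner_add_right]
    have h2 : mvfderiv I (fun y ↦ ⟪(Z + Z') y, X y⟫) x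
        = mvfderiv I (fun y ↦ ⟪Z y, X y⟫) x + mvfderiv I (fun y ↦ ⟪Z' y, X y⟫) x := by
      rw [← mvfderiv_fun_add (mdifferentiableAt_inner hZ hX) (mdifferentiableAt_inner hZ' hX)]
      simp [inner_add_left]
    simp only [koszul, h1, h2, mlieBracket_add_right hZ hZ']
    simp [inner_add_left, inner_add_right]
    ring

instance (x : M) : FiniteDimensional ℝ (TangentSpace I x) :=
  inferInstanceAs (FiniteDimensional ℝ E)

open scoped Classical in
/-- For a vector field `Y`, the bilinear form `(u, w) ↦ g(∇_u Y, w)` on `T_x M` given by the Koszul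
formula (with value `0` at the points where `Y` is not differentiable). -/
def koszulForm (Y : Π x : M, TangentSpace I x) (x : M) :
    TangentSpace I x →L[ℝ] TangentSpace I x →L[ℝ] ℝ :=
  if hY : MDiffAt (T% Y) x then
    TensorialAt.mkHom₂ (I := I) (F := E) (F' := E) (fun X Z ↦ koszul X Y Z x) x
      (fun _ hZ ↦ koszul_tensorial_left hY hZ) (fun _ hX ↦ koszul_tensorial_right hX hY)
  else 0

/-- The vector `∇_u Y` at `x`, i.e. the vector dual to the linear form
`w ↦ koszulForm Y x u w`. -/
def leviCivitaFun (Y : Π x : M, TangentSpace I x) (x : M) :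
    TangentSpace I x →L[ℝ] TangentSpace I x :=
  ∑ i, ((koszulForm Y x).flip (stdOrthonormalBasis ℝ (TangentSpace I x) i)).smulRight
    (stdOrthonormalBasis ℝ (TangentSpace I x) i)

theorem koszulForm_apply {X Y Z : Π x : M, TangentSpace I x} {x : M}
    (hX : MDiffAt (T% X) x) (hY : MDiffAt (T% Y) x) (hZ : MDiffAt (T% Z) x) :
    koszulForm Y x (X x) (Z x) = koszul X Y Z x := by
  rw [koszulForm, dif_pos hY]
  exact TensorialAt.mkHom₂_apply _ _ hX hZ

theorem inner_leviCivitaFun (Y : Π x : M, TangentSpace I x) (x : M) (u w : TangentSpace I x) :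
    ⟪leviCivitaFun Y x u, w⟫ = koszulForm Y x u w := by
  conv_rhs => rw [← (stdOrthonormalBasis ℝ (TangentSpace I x)).sum_repr w]
  simp [leviCivitaFun, sum_inner, inner_smul_left, OrthonormalBasis.repr_apply_apply, mul_comm]

theorem inner_leviCivitaFun_field {X Y Z : Π x : M, TangentSpace I x} {x : M}
    (hX : MDiffAt (T% X) x) (hY : MDiffAt (T% Y) x) (hZ : MDiffAt (T% Z) x) :
    ⟪leviCivitaFun Y x (X x), Z x⟫ = koszul X Y Z x := by
  rw [inner_leviCivitaFun, koszulForm_apply hX hY hZ]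

theorem eq_of_inner_leviCivita {Y : Π x : M, TangentSpace I x} {x : M}
    (hY : MDiffAt (T% Y) x) {A : TangentSpace I x →L[ℝ] TangentSpace I x}
    (h : ∀ X Z : Π x : M, TangentSpace I x, MDiffAt (T% X) x → MDiffAt (T% Z) x →
      koszul X Y Z x = ⟪A (X x), Z x⟫) : leviCivitaFun Y x = A := by
  ext1 u
  refine ext_inner_right ℝ fun w ↦ ?_
  have hu := mdifferentiableAt_extend I E u
  have hw := mdifferentiableAt_extend I E w
  have := h _ _ hu hw
  rw [← inner_leviCivitaFun_field hu hY hw] at this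
  simpa using this

theorem isCovariantDerivativeOn_leviCivitaFun :
    IsCovariantDerivativeOn E (leviCivitaFun (I := I) (M := M)) where
  add {Y Y' x} hY hY' _ := by
    refine eq_of_inner_leviCivita (mdifferentiableAt_add_section hY hY') fun X Z hX hZ ↦ ?_
    have h1 : mvfderiv I (fun y ↦ ⟪(Y + Y') y, Z y⟫) x
        = mvfderiv I (fun y ↦ ⟪Y y, Z y⟫) x + mvfderiv I (fun y ↦ ⟪Y' y, Z y⟫) x := by
      rw [← mvfderiv_fun_add (mdifferentiableAt_inner hY hZ) (mdifferentiableAt_inner hY' hZ)]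
      simp [inner_add_left]
    have h2 : mvfderiv I (fun y ↦ ⟪X y, (Y + Y') y⟫) x
        = mvfderiv I (fun y ↦ ⟪X y, Y y⟫) x + mvfderiv I (fun y ↦ ⟪X y, Y' y⟫) x := by
      rw [← mvfderiv_fun_add (mdifferentiableAt_inner hX hY) (mdifferentiableAt_inner hX hY')]
      simp [inner_add_right]
    rw [add_apply, inner_add_left, inner_leviCivitaFun_field hX hY hZ,
      inner_leviCivitaFun_field hX hY' hZ]
    simp only [koszul, h1, h2, mlieBracket_add_right hY hY', mlieBracket_add_left hY hY']
    simp [inner_add_left, inner_add_right]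
    ring
  leibniz {Y f x} hY hf _ := by
    refine eq_of_inner_leviCivita (hf.smul_section hY) fun X Z hX hZ ↦ ?_
    have h1 : mvfderiv I (fun y ↦ ⟪(f • Y) y, Z y⟫) x
        = f x • mvfderiv I (fun y ↦ ⟪Y y, Z y⟫) x + ⟪Y x, Z x⟫ • mvfderiv I f x := by
      rw [← mvfderiv_fun_mul hf (mdifferentiableAt_inner hY hZ)]
      simp [inner_smul_left]
    have h2 : mvfderiv I (fun y ↦ ⟪X y, (f • Y) y⟫) x
        = f x • mvfderiv I (fun y ↦ ⟪X y, Y y⟫) x + ⟪X x, Y x⟫ • mvfderiv I f x := by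
      rw [← mvfderiv_fun_mul hf (mdifferentiableAt_inner hX hY)]
      simp [inner_smul_right]
    rw [add_apply, inner_add_left, smul_apply, inner_smul_left,
      inner_leviCivitaFun_field hX hY hZ]
    simp only [koszul, h1, h2, mlieBracket_smul_right hf hY, mlieBracket_smul_left hf hY]
    simp [inner_add_left, inner_smul_left, inner_smul_right, real_inner_comm]
    ring

variable (I M) in
/-- The Levi-Civita connection of the Riemannian metric; `leviCivita I M Y x u` is `∇_u Y`. -/
def leviCivita : CovariantDerivative I E (fun x : M ↦ TangentSpace I x) :=
  ⟨leviCivitaFun, isCovariantDerivativeOn_leviCivitaFun⟩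

theorem inner_leviCivita {X Y Z : Π x : M, TangentSpace I x} {x : M}
    (hX : MDiffAt (T% X) x) (hY : MDiffAt (T% Y) x) (hZ : MDiffAt (T% Z) x) :
    ⟪leviCivita I M Y x (X x), Z x⟫ = koszul X Y Z x :=
  inner_leviCivitaFun_field hX hY hZ

/-- The Levi-Civita connection is torsion-free. -/
theorem leviCivita_torsion : (leviCivita I M).torsion = 0 := by
  rw [CovariantDerivative.torsion_eq_zero_iff]
  intro X Y x hX hY
  refine ext_inner_right ℝ fun w ↦ ?_
  have hw := mdifferentiableAt_extend I E w
  have h1 := inner_leviCivita hX hY hw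
  have h2 := inner_leviCivita hY hX hw
  rw [extend_apply_self] at h1 h2
  rw [inner_sub_left, h1, h2]
  simp only [koszul, mlieBracket_swap_apply (V := Y) (W := X), real_inner_comm, extend_apply_self]
  simp
  ring

/-- The Levi-Civita connection is metric. -/
theorem leviCivita_metric {X Y Z : Π x : M, TangentSpace I x} {x : M}
    (hX : MDiffAt (T% X) x) (hY : MDiffAt (T% Y) x) (hZ : MDiffAt (T% Z) x) :
    mvfderiv I (fun y ↦ ⟪Y y, Z y⟫) x (X x)
      = ⟪leviCivita I M Y x (X x), Z x⟫ + ⟪Y x, leviCivita I M Z x (X x)⟫ := by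
  rw [real_inner_comm (leviCivita I M Z x (X x)), inner_leviCivita hX hY hZ,
    inner_leviCivita hX hZ hY]
  simp only [koszul, mlieBracket_swap_apply (V := Z) (W := Y), real_inner_comm]
  simp
  ring

/-! ### Curvature -/

/-- `R_{X,Y} Z = ∇_X ∇_Y Z - ∇_Y ∇_X Z - ∇_{[X,Y]} Z` for vector fields. -/
def curvatureField (X Y Z : Π x : M, TangentSpace I x) (x : M) : TangentSpace I x :=
  leviCivita I M (fun y ↦ leviCivita I M Z y (Y y)) x (X x)
    - leviCivita I M (fun y ↦ leviCivita I M Z y (X y)) x (Y x)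
    - leviCivita I M Z x (mlieBracket I X Y x)

/-- The curvature tensor `R_{u,v} w` at `x`, computed by extending the tangent vectors to vector
fields that are smooth near `x`. -/
def curvature (x : M) (u v w : TangentSpace I x) : TangentSpace I x :=
  curvatureField (extend E u) (extend E v) (extend E w) x

/-- The Ricci tensor `Ric(u, v) = trace (z ↦ R_{z,u} v)`. -/
def ricci (x : M) (u v : TangentSpace I x) : ℝ :=
  ∑ i, ⟪curvature x (stdOrthonormalBasis ℝ (TangentSpace I x) i) u v,
    stdOrthonormalBasis ℝ (TangentSpace I x) i⟫

variable (I) in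
/-- The scalar curvature, the trace of the Ricci tensor. -/
def scalarCurvature (x : M) : ℝ :=
  ∑ i, ricci x (stdOrthonormalBasis ℝ (TangentSpace I x) i)
    (stdOrthonormalBasis ℝ (TangentSpace I x) i)

variable (I M) in
/-- Einstein manifolds: the Ricci tensor is a constant multiple of the metric. -/
def IsEinstein : Prop :=
  ∃ c : ℝ, ∀ (x : M) (u v : TangentSpace I x), ricci x u v = c * ⟪u, v⟫

/-- The Lie derivative of the metric,
`(𝓛_V g)(X, Y) = V(g(X, Y)) - g([V, X], Y) - g(X, [V, Y])`. -/
def lieDerivMetric (V X Y : Π x : M, TangentSpace I x) (x : M) : ℝ :=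
  mvfderiv I (fun y ↦ ⟪X y, Y y⟫) x (V x)
    - ⟪mlieBracket I V X x, Y x⟫ - ⟪X x, mlieBracket I V Y x⟫

/-- `dθ(X, Y) = (1/2) {X(θ(Y)) - Y(θ(X)) - θ([X, Y])}` for a 1-form `θ`. -/
def extDeriv₁ (θ : Π x : M, TangentSpace I x →L[ℝ] ℝ) (X Y : Π x : M, TangentSpace I x)
    (x : M) : ℝ :=
  (1 / 2 : ℝ) * (mvfderiv I (fun y ↦ θ y (Y y)) x (X x) - mvfderiv I (fun y ↦ θ y (X y)) x (Y x)
    - θ x (mlieBracket I X Y x))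

/-- The Nijenhuis torsion `[S, S](X, Y) = S²[X, Y] + [SX, SY] - S[SX, Y] - S[X, SY]`. -/
def nijenhuis (S : Π x : M, TangentSpace I x →L[ℝ] TangentSpace I x)
    (X Y : Π x : M, TangentSpace I x) (x : M) : TangentSpace I x :=
  S x (S x (mlieBracket I X Y x)) + mlieBracket I (fun y ↦ S y (X y)) (fun y ↦ S y (Y y)) x
    - S x (mlieBracket I (fun y ↦ S y (X y)) Y x) - S x (mlieBracket I X (fun y ↦ S y (Y y)) x)

/-! ### Weak metric `f`-structures -/

variable (I M) in
/-- A weak metric `f`-structure `(f, Q, ξ_i, η^i, g)` with `rank f = 2n` and `1 ≤ i ≤ s`, where `g`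
is the Riemannian metric of `M` and the distribution `D = ⋂ ker η^i` is `f`-invariant. -/
structure WeakMetricFStructure (n s : ℕ) where
  f : Π x : M, TangentSpace I x →L[ℝ] TangentSpace I x
  Q : Π x : M, TangentSpace I x →L[ℝ] TangentSpace I x
  ξ : Fin s → Π x : M, TangentSpace I x
  η : Fin s → Π x : M, TangentSpace I x →L[ℝ] ℝ
  smooth_f : ContMDiff I (I.prod 𝓘(ℝ, E →L[ℝ] E)) ∞
    (fun x ↦ TotalSpace.mk' (E →L[ℝ] E)
      (E := fun x : M ↦ TangentSpace I x →L[ℝ] TangentSpace I x) x (f x))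
  smooth_Q : ContMDiff I (I.prod 𝓘(ℝ, E →L[ℝ] E)) ∞
    (fun x ↦ TotalSpace.mk' (E →L[ℝ] E)
      (E := fun x : M ↦ TangentSpace I x →L[ℝ] TangentSpace I x) x (Q x))
  smooth_ξ : ∀ i, ContMDiff I I.tangent ∞ (T% (ξ i))
  smooth_η : ∀ i, ContMDiff I (I.prod 𝓘(ℝ, E →L[ℝ] ℝ)) ∞
    (fun x ↦ TotalSpace.mk' (E →L[ℝ] ℝ)
      (E := fun x : M ↦ TangentSpace I x →L[ℝ] Trivial M ℝ x) x (η i x))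
  f_skew : ∀ x (u v : TangentSpace I x), ⟪f x u, v⟫ = -⟪u, f x v⟫
  f_rank : ∀ x, Module.finrank ℝ (LinearMap.range (f x).toLinearMap) = 2 * n
  Q_selfAdjoint : ∀ x (u v : TangentSpace I x), ⟪Q x u, v⟫ = ⟪u, Q x v⟫
  Q_nonsingular : ∀ x, Function.Bijective (Q x)
  ξ_orthonormal : ∀ x, Orthonormal ℝ (fun i ↦ ξ i x)
  f_sq : ∀ x (u : TangentSpace I x), f x (f x u) = -Q x u + ∑ i, η i x u • ξ i x
  η_ξ : ∀ x i j, η i x (ξ j x) = if i = j then 1 else 0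
  Q_ξ : ∀ x i, Q x (ξ i x) = ξ i x
  inner_f_f : ∀ x (u v : TangentSpace I x),
    ⟪f x u, f x v⟫ = ⟪u, Q x v⟫ - ∑ i, η i x u * η i x v
  f_invariant : ∀ x (u : TangentSpace I x), (∀ i, η i x u = 0) → ∀ i, η i x (f x u) = 0

namespace WeakMetricFStructure

variable {n s : ℕ} (S : WeakMetricFStructure I M n s)

/-- `ξ̄ = ∑ ξ_i`. -/
def ξbar (x : M) : TangentSpace I x := ∑ i, S.ξ i x

/-- `η̄ = ∑ η^i`. -/
def ηbar (x : M) (u : TangentSpace I x) : ℝ := ∑ i, S.η i x u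

/-- Normality: `[f, f](X, Y) + 2 ∑ dη^i(X, Y) ξ_i = 0` for all smooth vector fields. -/
def IsNormal : Prop :=
  ∀ (x : M) (X Y : Π x : M, TangentSpace I x),
    ContMDiffAt I I.tangent ∞ (T% X) x → ContMDiffAt I I.tangent ∞ (T% Y) x →
    nijenhuis S.f X Y x + ∑ i, (2 * extDeriv₁ (S.η i) X Y x) • S.ξ i x = 0

/-- Weak `βf`-Kenmotsu manifolds:
`(∇_X f) Y = β {g(fX, Y) ξ̄ - η̄(Y) fX}` with `(∇_X f) Y = ∇_X (fY) - f (∇_X Y)`. -/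
def IsWeakKenmotsu (β : M → ℝ) : Prop :=
  ContMDiff I 𝓘(ℝ, ℝ) ∞ β ∧
  ∀ (x : M) (u : TangentSpace I x) (Y : Π x : M, TangentSpace I x),
    ContMDiffAt I I.tangent ∞ (T% Y) x →
    leviCivita I M (fun y ↦ S.f y (Y y)) x u - S.f x (leviCivita I M Y x u)
      = β x • (⟪S.f x u, Y x⟫ • S.ξbar x - S.ηbar x (Y x) • S.f x u)

/-- `η`-Einstein: `Ric = a g - a ∑ η^i ⊗ η^i + (a + b) η̄ ⊗ η̄` with smooth functions `a`, `b`. -/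
def IsEtaEinstein (a b : M → ℝ) : Prop :=
  ContMDiff I 𝓘(ℝ, ℝ) ∞ a ∧ ContMDiff I 𝓘(ℝ, ℝ) ∞ b ∧
  ∀ (x : M) (u v : TangentSpace I x),
    ricci x u v = a x * ⟪u, v⟫ - a x * ∑ i, S.η i x u * S.η i x v
      + (a x + b x) * (S.ηbar x u * S.ηbar x v)

/-- The `*`-Ricci tensor `Ric^*(u, v) = (1/2) trace (z ↦ f R_{u,fv} z)`. -/
def starRicci (x : M) (u v : TangentSpace I x) : ℝ :=
  (1 / 2 : ℝ) * ∑ i, ⟪S.f x (curvature x u (S.f x v) (stdOrthonormalBasis ℝ (TangentSpace I x) i)),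
    stdOrthonormalBasis ℝ (TangentSpace I x) i⟫

/-- `(g, V)` represents a `*`-`η`-Ricci soliton with constants `lam`, `mu`:
`(1/2) 𝓛_V g + Ric^* = lam {g - ∑ η^i ⊗ η^i} + (lam + mu) η̄ ⊗ η̄`. -/
def IsStarEtaRicciSoliton (V : Π x : M, TangentSpace I x) (lam mu : ℝ) : Prop :=
  ContMDiff I I.tangent ∞ (T% V) ∧
  ∀ (x : M) (X Y : Π x : M, TangentSpace I x),
    ContMDiffAt I I.tangent ∞ (T% X) x → ContMDiffAt I I.tangent ∞ (T% Y) x →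
    (1 / 2 : ℝ) * lieDerivMetric V X Y x + S.starRicci x (X x) (Y x)
      = lam * (⟪X x, Y x⟫ - ∑ i, S.η i x (X x) * S.η i x (Y x))
        + (lam + mu) * (S.ηbar x (X x) * S.ηbar x (Y x))

end WeakMetricFStructure

end

end FKenmotsu

/-! Write P for the orthogonal projection onto 𝒟, A = a + 2nsβ² and κ = λ + μ. Applying ∇f to ξ_i,
together with normality when s > 1, gives ∇_X ξ_i = β PX (`nabla_ξ`). Hence R_{X,Y} ξ_i is explicit
and Ric(ξ_i, ξ_i) = -2nβ², that is, a + b = -2nβ². Everything now reduces to A = 0: the values of a,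
b, r and the Einstein property for s = 1 are then arithmetic.

The η-Einstein condition has two consequences. Tracing the commutator of R with f gives Ric* = (A -
sβ²) g(f·, f·), so the soliton equation prescribes 𝓛_V g. The contracted Bianchi identity gives
ξ_i(A) = -2βA and, for n ≥ 2, shows that A is constant along 𝒟. Since 𝓛_V g determines ∇²V up to
curvature, its ξ_i-component yields, for X, Y in 𝒟, Hess g(V, ξ_i)(X, Y) = 2β (sκ g(X, Y) - A g(fX,
fY)) (`hess_soliton`).

If V is in 𝒟, the left side is zero and κ = 0, so A |f|² = 0 and A = 0.

If s = 1, let w be the horizontal gradient of v = g(V, ξ). The Hessian formula determines ∇w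
(`nabla_hgrad`), hence R(·,·)w, and comparing the trace with Ric (`mul_g_hgrad`) gives κ = 0 and a
relation between A w and dA. For n ≥ 2 this relation says A w = 0; where A ≠ 0 we get w = 0, and the
formula for ∇w then forces A f² = 0, a contradiction. For n = 1 one has f² = -p P with p locally
constant. Where A and w do not vanish, w and fw commute, and the derivatives of A, |w|², v, g(V, w),
g(V, fw) along them form a system that is inconsistent (`false_of_commuting_derivations`).

All these identities are proved for modules over a commutative ring that imitate vector fields on an
open set with an orthonormal frame; the second half of the file realises such modules on M. -/

namespace FKenmotsu

/-! ### Algebraic Riemannian geometry over a ring of functions. -/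

/-- The algebraic data of Riemannian geometry on a domain with a global orthonormal frame: `R` is
the ring of smooth functions and `𝔛` the module of smooth vector fields. -/
structure RiemannianModule (R 𝔛 ι : Type*) [CommRing R] [AddCommGroup 𝔛] [Module R 𝔛]
    [Fintype ι] [DecidableEq ι] where
  /-- The metric. -/
  g : 𝔛 →ₗ[R] 𝔛 →ₗ[R] R
  /-- The orthonormal frame. -/
  e : ι → 𝔛
  /-- The directional derivative of functions. -/
  D : 𝔛 →ₗ[R] Derivation ℤ R R
  /-- The covariant derivative. -/
  nabla : 𝔛 →ₗ[R] 𝔛 →+ 𝔛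
  g_comm : ∀ X Y, g X Y = g Y X
  g_frame : ∀ i j, g (e i) (e j) = if i = j then 1 else 0
  sum_frame : ∀ X, ∑ i, g X (e i) • e i = X
  nabla_smul : ∀ X (a : R) Y, nabla X (a • Y) = a • nabla X Y + D X a • Y
  nabla_metric : ∀ X Y Z, D X (g Y Z) = g (nabla X Y) Z + g Y (nabla X Z)
  -- The bracket is not a separate datum: `nabla X Y - nabla Y X` takes its place, so
  -- torsion-freeness is built in.
  D_bracket : ∀ X Y (a : R), D (nabla X Y - nabla Y X) a = D X (D Y a) - D Y (D X a)
  jacobi : ∀ X Y Z,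
    nabla X (nabla Y Z - nabla Z Y) - nabla (nabla Y Z - nabla Z Y) X
      = nabla (nabla X Y - nabla Y X) Z - nabla Z (nabla X Y - nabla Y X)
        + (nabla Y (nabla X Z - nabla Z X) - nabla (nabla X Z - nabla Z X) Y)

namespace RiemannianModule

variable {R 𝔛 ι : Type*} [CommRing R] [AddCommGroup 𝔛] [Module R 𝔛] [Fintype ι] [DecidableEq ι]
  (C : RiemannianModule R 𝔛 ι)

theorem ext_g {X Y : 𝔛} (h : ∀ Z, C.g X Z = C.g Y Z) : X = Y := by
  rw [← C.sum_frame X, ← C.sum_frame Y]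
  simp only [h]

theorem sum_apply_frame (L : 𝔛 →ₗ[R] R) (X : 𝔛) : ∑ i, C.g X (C.e i) * L (C.e i) = L X := by
  conv_rhs => rw [← C.sum_frame X]
  simp

theorem sum_g_frame_mul (X Y : 𝔛) : ∑ i, C.g X (C.e i) * C.g Y (C.e i) = C.g X Y := by
  rw [C.sum_apply_frame (C.g Y) X, C.g_comm]

theorem sum_g_frame_mul' (X Y : 𝔛) : ∑ i, C.g (C.e i) X * C.g (C.e i) Y = C.g X Y := by
  simp only [C.g_comm (C.e _), C.sum_g_frame_mul]

theorem sum_g_frame_self : ∑ i, C.g (C.e i) (C.e i) = (Fintype.card ι : R) := by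
  simp [C.g_frame]

/-- The trace of a bilinear form is parallel. -/
theorem sum_nabla_frame (B : 𝔛 →ₗ[R] 𝔛 →ₗ[R] R) (W : 𝔛) :
    ∑ i, (B (C.nabla W (C.e i)) (C.e i) + B (C.e i) (C.nabla W (C.e i))) = 0 := by
  have hc : ∀ i j, C.g (C.nabla W (C.e i)) (C.e j) + C.g (C.nabla W (C.e j)) (C.e i) = 0 := by
    intro i j
    have h := C.nabla_metric W (C.e i) (C.e j)
    rw [C.g_frame, C.g_comm (C.e i)] at h
    rw [← h]
    split_ifs <;> simp
  have h1 : ∑ i, B (C.nabla W (C.e i)) (C.e i)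
      = ∑ i, ∑ j, C.g (C.nabla W (C.e i)) (C.e j) * B (C.e j) (C.e i) := by
    refine Finset.sum_congr rfl fun i _ ↦ ?_
    exact (C.sum_apply_frame (B.flip (C.e i)) _).symm
  have h2 : ∑ i, B (C.e i) (C.nabla W (C.e i))
      = ∑ i, ∑ j, C.g (C.nabla W (C.e j)) (C.e i) * B (C.e j) (C.e i) := by
    rw [Finset.sum_comm]
    refine Finset.sum_congr rfl fun i _ ↦ ?_
    exact (C.sum_apply_frame (B (C.e i)) _).symm
  rw [Finset.sum_add_distrib, h1, h2, ← Finset.sum_add_distrib]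
  refine Finset.sum_eq_zero fun i _ ↦ ?_
  rw [← Finset.sum_add_distrib]
  refine Finset.sum_eq_zero fun j _ ↦ ?_
  rw [← add_mul, hc, zero_mul]

/-! ### Curvature -/

/-- The curvature tensor `R_{X,Y} Z`. -/
def curv : 𝔛 →ₗ[R] 𝔛 →ₗ[R] 𝔛 →ₗ[R] 𝔛 :=
  LinearMap.mk₂ R
    (fun X Y ↦
      { toFun Z := C.nabla X (C.nabla Y Z) - C.nabla Y (C.nabla X Z)
          - C.nabla (C.nabla X Y - C.nabla Y X) Z
        map_add' Z Z' := by simp only [map_add]; abel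
        map_smul' a Z := by
          have h := C.D_bracket X Y a
          simp only [C.nabla_smul, map_add, RingHom.id_apply, h]
          module })
    (fun X X' Y ↦ by
      ext Z
      simp only [map_add, map_sub, LinearMap.coe_mk, AddHom.coe_mk, LinearMap.add_apply,
        AddMonoidHom.add_apply, AddMonoidHom.sub_apply]
      abel)
    (fun a X Y ↦ by
      ext Z
      simp only [map_smul, map_sub, C.nabla_smul, LinearMap.coe_mk, AddHom.coe_mk, map_add,
        LinearMap.smul_apply, AddMonoidHom.add_apply, AddMonoidHom.sub_apply,
        AddMonoidHom.smul_apply]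
      module)
    (fun X Y Y' ↦ by
      ext Z
      simp only [map_add, map_sub, LinearMap.coe_mk, AddHom.coe_mk, LinearMap.add_apply,
        AddMonoidHom.add_apply, AddMonoidHom.sub_apply]
      abel)
    (fun a X Y ↦ by
      ext Z
      simp only [map_smul, map_sub, C.nabla_smul, LinearMap.coe_mk, AddHom.coe_mk, map_add,
        LinearMap.smul_apply, AddMonoidHom.add_apply, AddMonoidHom.sub_apply,
        AddMonoidHom.smul_apply]
      module)

theorem curv_apply (X Y Z : 𝔛) : C.curv X Y Z = C.nabla X (C.nabla Y Z)
    - C.nabla Y (C.nabla X Z) - C.nabla (C.nabla X Y - C.nabla Y X) Z := rfl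

theorem curv_swap (X Y Z : 𝔛) : C.curv X Y Z = -C.curv Y X Z := by
  simp only [curv_apply, map_sub, AddMonoidHom.sub_apply]
  abel

/-- `D_bracket` applied to the function `g Z W`, with every derivative expanded by metricity. -/
theorem g_curv_swap (X Y Z W : 𝔛) : C.g (C.curv X Y Z) W = -C.g (C.curv X Y W) Z := by
  have h := C.D_bracket X Y (C.g Z W)
  have h1 := C.nabla_metric (C.nabla X Y - C.nabla Y X) Z W
  have h2 := C.nabla_metric X (C.nabla Y Z) W
  have h3 := C.nabla_metric X Z (C.nabla Y W)
  have h4 := C.nabla_metric Y (C.nabla X Z) W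
  have h5 := C.nabla_metric Y Z (C.nabla X W)
  rw [h1, C.nabla_metric Y Z W, C.nabla_metric X Z W, map_add, map_add, h2, h3, h4, h5] at h
  rw [C.g_comm (C.curv X Y W) Z]
  simp only [curv_apply, map_sub, LinearMap.sub_apply, AddMonoidHom.sub_apply] at h ⊢
  linear_combination -h

theorem first_bianchi (X Y Z : 𝔛) : C.curv X Y Z + C.curv Y Z X + C.curv Z X Y = 0 := by
  have h := C.jacobi X Y Z
  rw [← sub_eq_zero] at h
  rw [← h]
  simp only [curv_apply, map_sub, AddMonoidHom.sub_apply]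
  abel

/-- The covariant derivative `(∇_W R)_{X,Y} Z`. -/
def nablaCurv (W X Y Z : 𝔛) : 𝔛 :=
  C.nabla W (C.curv X Y Z) - C.curv (C.nabla W X) Y Z - C.curv X (C.nabla W Y) Z
    - C.curv X Y (C.nabla W Z)

/-- After expansion everything cancels except, up to sign, `nabla T W` with `T` the Jacobi sum, and
`T = 0`. -/
theorem second_bianchi (X Y Z W : 𝔛) :
    C.nablaCurv X Y Z W + C.nablaCurv Y Z X W + C.nablaCurv Z X Y W = 0 := by
  have h := congrArg (fun T ↦ C.nabla T W) (sub_eq_zero.2 (C.jacobi X Y Z))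
  simp only [map_sub, map_add, AddMonoidHom.sub_apply, AddMonoidHom.add_apply, map_zero,
    AddMonoidHom.zero_apply] at h
  rw [← neg_eq_zero, ← h]
  simp only [nablaCurv, curv_apply, map_sub, AddMonoidHom.sub_apply]
  abel

theorem nablaCurv_swap (W X Y Z : 𝔛) : C.nablaCurv W X Y Z = -C.nablaCurv W Y X Z := by
  rw [nablaCurv, nablaCurv, C.curv_swap X Y Z, C.curv_swap (C.nabla W X) Y,
    C.curv_swap X (C.nabla W Y), C.curv_swap X Y (C.nabla W Z), map_neg]
  abel

theorem g_nablaCurv_swap (W X Y Z U : 𝔛) :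
    C.g (C.nablaCurv W X Y Z) U = -C.g (C.nablaCurv W X Y U) Z := by
  have h := congrArg (C.D W) (C.g_curv_swap X Y Z U)
  rw [map_neg, C.nabla_metric, C.nabla_metric] at h
  simp only [nablaCurv, map_sub, LinearMap.sub_apply]
  linear_combination h - C.g_curv_swap (C.nabla W X) Y Z U - C.g_curv_swap X (C.nabla W Y) Z U
    - C.g_curv_swap X Y (C.nabla W Z) U - C.g_curv_swap X Y Z (C.nabla W U)

/-- The Ricci tensor. -/
def ric : 𝔛 →ₗ[R] 𝔛 →ₗ[R] R :=
  LinearMap.mk₂ R (fun X Y ↦ ∑ i, C.g (C.curv (C.e i) X Y) (C.e i))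
    (by simp [Finset.sum_add_distrib]) (by simp [Finset.mul_sum])
    (by simp [Finset.sum_add_distrib]) (by simp [Finset.mul_sum])

theorem ric_apply (X Y : 𝔛) : C.ric X Y = ∑ i, C.g (C.curv (C.e i) X Y) (C.e i) := rfl

/-- The scalar curvature. -/
def scal : R := ∑ i, C.ric (C.e i) (C.e i)

theorem sum_g_nablaCurv_frame (W X Y : 𝔛) :
    ∑ i, C.g (C.nablaCurv W (C.e i) X Y) (C.e i)
      = C.D W (C.ric X Y) - C.ric (C.nabla W X) Y - C.ric X (C.nabla W Y) := by
  have h := C.sum_nabla_frame (LinearMap.mk₂ R (fun U U' ↦ C.g (C.curv U X Y) U')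
    (by simp) (by simp) (by simp) (by simp)) W
  simp only [LinearMap.mk₂_apply, Finset.sum_add_distrib] at h
  simp only [ric_apply, map_sum, C.nabla_metric, nablaCurv, map_sub, LinearMap.sub_apply,
    Finset.sum_sub_distrib, Finset.sum_add_distrib]
  linear_combination -h

/-- The contracted second Bianchi identity. -/
theorem D_scal (X : 𝔛) : C.D X C.scal
    = 2 * ∑ i, (C.D (C.e i) (C.ric X (C.e i)) - C.ric (C.nabla (C.e i) X) (C.e i)
      - C.ric X (C.nabla (C.e i) (C.e i))) := by
  -- The second Bianchi identity traced over both frame indices: the first term is the derivative of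
  -- `scal`, and each of the other two is minus the divergence of `ric`.
  have h : ∑ i, ∑ j, C.g (C.nablaCurv X (C.e i) (C.e j) (C.e j)
      + C.nablaCurv (C.e i) (C.e j) X (C.e j) + C.nablaCurv (C.e j) X (C.e i) (C.e j)) (C.e i)
      = 0 := by
    simp [C.second_bianchi]
  simp only [map_add, LinearMap.add_apply, Finset.sum_add_distrib] at h
  have h1 : ∑ i, ∑ j, C.g (C.nablaCurv X (C.e i) (C.e j) (C.e j)) (C.e i) = C.D X C.scal := by
    rw [Finset.sum_comm]
    simp only [C.sum_g_nablaCurv_frame, scal, map_sum]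
    have := C.sum_nabla_frame C.ric X
    simp only [Finset.sum_add_distrib, Finset.sum_sub_distrib] at this ⊢
    linear_combination -this
  have h2 : ∑ i, ∑ j, C.g (C.nablaCurv (C.e i) (C.e j) X (C.e j)) (C.e i)
      = -∑ i, (C.D (C.e i) (C.ric X (C.e i)) - C.ric (C.nabla (C.e i) X) (C.e i)
      - C.ric X (C.nabla (C.e i) (C.e i))) := by
    rw [← Finset.sum_neg_distrib]
    refine Finset.sum_congr rfl fun i _ ↦ ?_
    rw [← C.sum_g_nablaCurv_frame, ← Finset.sum_neg_distrib]
    exact Finset.sum_congr rfl fun j _ ↦ C.g_nablaCurv_swap _ _ _ _ _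
  have h3 : ∑ i, ∑ j, C.g (C.nablaCurv (C.e j) X (C.e i) (C.e j)) (C.e i)
      = -∑ i, (C.D (C.e i) (C.ric X (C.e i)) - C.ric (C.nabla (C.e i) X) (C.e i)
      - C.ric X (C.nabla (C.e i) (C.e i))) := by
    rw [Finset.sum_comm, ← Finset.sum_neg_distrib]
    refine Finset.sum_congr rfl fun i _ ↦ ?_
    rw [← C.sum_g_nablaCurv_frame, ← Finset.sum_neg_distrib]
    refine Finset.sum_congr rfl fun j _ ↦ ?_
    rw [C.nablaCurv_swap]
    simp
  rw [h1, h2, h3] at h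
  linear_combination h

theorem sum_g_mul_D_frame (X : 𝔛) (a : R) :
    ∑ i, C.g X (C.e i) * C.D (C.e i) a = C.D X a := by
  exact C.sum_apply_frame
    { toFun := fun X ↦ C.D X a, map_add' := by simp, map_smul' := by simp } X

/-- Four instances of the first Bianchi identity give only twice the claim, whence the assumption on
2-torsion. -/
theorem pair_symm (h2 : ∀ a : R, 2 * a = 0 → a = 0) (X Y Z W : 𝔛) :
    C.g (C.curv X Y Z) W = C.g (C.curv Z W X) Y := by
  have b (X Y Z W : 𝔛) := congrArg (fun T ↦ C.g T W) (C.first_bianchi X Y Z)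
  simp only [map_add, LinearMap.add_apply, map_zero, LinearMap.zero_apply] at b
  have s (X Y Z W : 𝔛) : C.g (C.curv X Y Z) W = -C.g (C.curv Y X Z) W := by
    rw [C.curv_swap X Y Z]
    simp
  have k := C.g_curv_swap
  refine sub_eq_zero.1 (h2 _ ?_)
  have b1 := b X Y Z W
  have b2 := b Y Z W X
  have b3 := b Z W X Y
  have b4 := b W X Y Z
  rw [k Y Z W X, k Z W Y X, s W Y Z X] at b2
  rw [s W X Z Y, k X W Z Y, s X Z W Y, k Z X W Y] at b3
  rw [s W X Y Z, k X Y W Z, k Y W X Z] at b4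
  linear_combination b1 + b2 - b3 - b4

theorem ric_comm (h2 : ∀ a : R, 2 * a = 0 → a = 0) (X Y : 𝔛) : C.ric X Y = C.ric Y X := by
  simp only [ric_apply]
  refine Finset.sum_congr rfl fun i _ ↦ ?_
  rw [C.pair_symm h2, C.curv_swap, map_neg, LinearMap.neg_apply, C.g_curv_swap, neg_neg]

/-- Twice the second covariant derivative of a vector field in terms of the Lie derivative `h` of
the metric and the curvature. -/
theorem two_mul_g_nabla_nabla (V X Y Z : 𝔛) (h : 𝔛 → 𝔛 → R)
    (hh : ∀ X Y, C.g (C.nabla X V) Y + C.g X (C.nabla Y V) = h X Y) :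
    2 * C.g (C.nabla X (C.nabla Y V) - C.nabla (C.nabla X Y) V) Z
      = (C.D X (h Y Z) - h (C.nabla X Y) Z - h Y (C.nabla X Z))
        + (C.D Y (h X Z) - h (C.nabla Y X) Z - h X (C.nabla Y Z))
        - (C.D Z (h X Y) - h (C.nabla Z X) Y - h X (C.nabla Z Y))
        + C.g (C.curv X Y V) Z - C.g (C.curv X Z V) Y - C.g (C.curv Y Z V) X := by
  -- As in the Koszul formula, the cyclic combination of derivatives of `h` isolates one second
  -- derivative of `V`; each exchange of the two derivatives costs a curvature term.
  simp only [← hh, map_add, C.nabla_metric, C.curv_apply, map_sub, LinearMap.sub_apply,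
    AddMonoidHom.sub_apply, C.g_comm X, C.g_comm Y]
  linear_combination C.g_comm (C.nabla Y V) (C.nabla Z X) - C.g_comm (C.nabla Z V) (C.nabla X Y)
    - C.g_comm (C.nabla Z V) (C.nabla Y X)

end RiemannianModule

/-! ### Weak βf-Kenmotsu structures: characteristic fields, curvature, solitons. -/

/-- The algebraic data of a weak `βf`-Kenmotsu structure of dimension `2n + s` with constant `β`. -/
structure KenmotsuModule (R 𝔛 ι : Type*) [CommRing R] [AddCommGroup 𝔛] [Module R 𝔛]
    [Fintype ι] [DecidableEq ι] (n s : ℕ) extends RiemannianModule R 𝔛 ι where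
  isUnit_natCast : ∀ k : ℕ, k ≠ 0 → IsUnit (k : R)
  card_eq : Fintype.card ι = 2 * n + s
  f : 𝔛 →ₗ[R] 𝔛
  ξ : Fin s → 𝔛
  β : R
  D_β : ∀ X, D X β = 0
  isUnit_β : IsUnit β
  f_skew : ∀ X Y, g (f X) Y = -g X (f Y)
  g_ξ : ∀ i j, g (ξ i) (ξ j) = if i = j then 1 else 0
  f_ξ : ∀ i, f (ξ i) = 0
  eq_of_f_eq_zero : ∀ X, f X = 0 → X = ∑ i, g X (ξ i) • ξ i
  nabla_f : ∀ X Y, nabla X (f Y)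
    = f (nabla X Y) + β • (g (f X) Y • ∑ i, ξ i - g Y (∑ i, ξ i) • f X)
  -- Normality enters only in this form: the Lie derivative of η^j along ξ_k vanishes.
  normal : 1 < s → ∀ j k Y,
    D (ξ k) (g Y (ξ j)) - g (nabla (ξ k) Y - nabla Y (ξ k)) (ξ j) = 0

namespace KenmotsuModule

variable {R 𝔛 ι : Type*} [CommRing R] [AddCommGroup 𝔛] [Module R 𝔛] [Fintype ι] [DecidableEq ι]
  {n s : ℕ} (C : KenmotsuModule R 𝔛 ι n s)

theorem natCast_mul_cancel (C : KenmotsuModule R 𝔛 ι n s) {k : ℕ} (hk : k ≠ 0) {a : R}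
    (h : (k : R) * a = 0) : a = 0 :=
  (C.isUnit_natCast k hk).mul_right_eq_zero.1 h

theorem two_mul_cancel (C : KenmotsuModule R 𝔛 ι n s) {a : R} (h : 2 * a = 0) : a = 0 :=
  C.natCast_mul_cancel (k := 2) two_ne_zero (by exact_mod_cast h)

theorem D_two (X : 𝔛) : C.D X 2 = 0 := by exact_mod_cast (C.D X).map_natCast 2

theorem D_four (X : 𝔛) : C.D X 4 = 0 := by exact_mod_cast (C.D X).map_natCast 4

/-- The field `ξ̄ = ∑ ξ_i`. -/
def ξs : 𝔛 := ∑ i, C.ξ i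

/-- The projection to the distribution `D`. -/
def proj : 𝔛 →ₗ[R] 𝔛 := LinearMap.id - ∑ i, (C.g.flip (C.ξ i)).smulRight (C.ξ i)

theorem proj_apply (X : 𝔛) : C.proj X = X - ∑ i, C.g X (C.ξ i) • C.ξ i := by
  simp [proj]

theorem g_proj (X Y : 𝔛) :
    C.g (C.proj X) Y = C.g X Y - ∑ i, C.g X (C.ξ i) * C.g Y (C.ξ i) := by
  simp [proj_apply, C.g_comm Y]

theorem g_proj_right (X Y : 𝔛) : C.g X (C.proj Y) = C.g (C.proj X) Y := by
  rw [C.g_comm, g_proj, g_proj, C.g_comm X Y]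
  simp only [mul_comm]

theorem g_proj_comm (X Y : 𝔛) : C.g (C.proj X) Y = C.g (C.proj Y) X := by
  rw [C.g_comm, g_proj_right]

theorem proj_ξ (i : Fin s) : C.proj (C.ξ i) = 0 := by
  simp [proj_apply, C.g_ξ]

theorem g_proj_ξ (X : 𝔛) (i : Fin s) : C.g (C.proj X) (C.ξ i) = 0 := by
  rw [← g_proj_right, proj_ξ, map_zero]

theorem proj_ξs : C.proj C.ξs = 0 := by simp [ξs, proj_ξ]

theorem g_proj_ξs (X : 𝔛) : C.g (C.proj X) C.ξs = 0 := by
  rw [← g_proj_right, proj_ξs, map_zero]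

theorem proj_proj (X : 𝔛) : C.proj (C.proj X) = C.proj X := by
  conv_lhs => rw [proj_apply]
  simp [g_proj_ξ]

theorem f_proj (X : 𝔛) : C.f (C.proj X) = C.f X := by simp [proj_apply, C.f_ξ]

theorem g_f_ξ (X : 𝔛) (i : Fin s) : C.g (C.f X) (C.ξ i) = 0 := by simp [C.f_skew, C.f_ξ]

theorem f_ξs : C.f C.ξs = 0 := by simp [ξs, C.f_ξ]

theorem g_f_ξs (X : 𝔛) : C.g (C.f X) C.ξs = 0 := by simp [C.f_skew, C.f_ξs]

theorem proj_f (X : 𝔛) : C.proj (C.f X) = C.f X := by simp [proj_apply, C.g_f_ξ]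

theorem g_ξ_ξs (i : Fin s) : C.g (C.ξ i) C.ξs = 1 := by simp [ξs, C.g_ξ]

theorem g_ξs_ξs : C.g C.ξs C.ξs = s := by
  conv_lhs => enter [1]; rw [ξs]
  simp [g_ξ_ξs]

theorem g_f_self (X : 𝔛) : C.g (C.f X) X = 0 := by
  refine C.two_mul_cancel ?_
  linear_combination C.f_skew X X - C.g_comm X (C.f X)

theorem sum_g_proj_frame : ∑ i, C.g (C.proj (C.e i)) (C.e i) = 2 * n := by
  simp only [g_proj, Finset.sum_sub_distrib]
  rw [Finset.sum_comm, C.sum_g_frame_self, C.card_eq]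
  simp [C.sum_g_frame_mul', C.g_ξ]

theorem sum_g_f_frame : ∑ i, C.g (C.f (C.e i)) (C.e i) = 0 := by simp [g_f_self]

theorem nabla_f' (X Y : 𝔛) : C.nabla X (C.f Y)
    = C.f (C.nabla X Y) + C.β • (C.g (C.f X) Y • C.ξs - C.g Y C.ξs • C.f X) := C.nabla_f X Y

/-- Since `f (ξ i) = 0`, the formula for ∇f gives `f (∇_X ξ_i - β X) = 0`, and the kernel of `f` is
spanned by the characteristic fields. -/
theorem nabla_ξ_eq_add (X : 𝔛) (i : Fin s) :
    C.nabla X (C.ξ i) = C.β • C.proj X + ∑ j, C.g (C.nabla X (C.ξ i)) (C.ξ j) • C.ξ j := by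
  have h := C.nabla_f' X (C.ξ i)
  rw [C.f_ξ, map_zero, C.g_f_ξ, C.g_ξ_ξs] at h
  have h2 := C.eq_of_f_eq_zero (C.nabla X (C.ξ i) - C.β • X) (by
    rw [map_sub, map_smul, eq_comm, h]
    module)
  rw [sub_eq_iff_eq_add] at h2
  conv_lhs => rw [h2]
  rw [proj_apply]
  simp only [map_sub, map_smul, LinearMap.sub_apply, LinearMap.smul_apply, sub_smul, smul_assoc,
    Finset.sum_sub_distrib, ← Finset.smul_sum]
  module

theorem g_nabla_ξ_swap (X : 𝔛) (i j : Fin s) :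
    C.g (C.nabla X (C.ξ i)) (C.ξ j) + C.g (C.nabla X (C.ξ j)) (C.ξ i) = 0 := by
  have h := C.nabla_metric X (C.ξ i) (C.ξ j)
  rw [C.g_ξ, C.g_comm (C.ξ i)] at h
  rw [← h]
  split_ifs <;> simp

/-- For s = 1 this is skewness in `i, j`. For s > 1 normality allows one to trade `∇_X ξ_i` for
`∇_{ξ_i} ξ_j`, so that only triples of characteristic fields remain. -/
theorem g_nabla_ξ_ξ (X : 𝔛) (i j : Fin s) : C.g (C.nabla X (C.ξ i)) (C.ξ j) = 0 := by
  rcases le_or_gt s 1 with hs | hs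
  · have : i = j := by
      apply Fin.ext
      omega
    subst this
    have := C.g_nabla_ξ_swap X i i
    exact C.two_mul_cancel (by linear_combination this)
  have h : ∀ Y j k, C.g Y (C.nabla (C.ξ k) (C.ξ j)) + C.g (C.nabla Y (C.ξ k)) (C.ξ j) = 0 := by
    intro Y j k
    have := C.normal hs j k Y
    rw [C.nabla_metric, map_sub, LinearMap.sub_apply] at this
    linear_combination this
  -- The array g(∇_{ξ_k} ξ_j, ξ_l) is symmetric in `k, l` and skew in `j, l`, hence zero.
  have h2 : ∀ j k l, C.g (C.nabla (C.ξ k) (C.ξ j)) (C.ξ l) = 0 := by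
    intro j k l
    refine C.two_mul_cancel ?_
    have a : ∀ j k l, C.g (C.nabla (C.ξ k) (C.ξ j)) (C.ξ l)
        = C.g (C.nabla (C.ξ l) (C.ξ j)) (C.ξ k) := by
      intro j k l
      have := h (C.ξ l) j k
      rw [C.g_comm] at this
      linear_combination this - C.g_nabla_ξ_swap (C.ξ l) k j
    linear_combination C.g_nabla_ξ_swap (C.ξ k) j l - a l k j
      - C.g_nabla_ξ_swap (C.ξ j) l k + a k j l + C.g_nabla_ξ_swap (C.ξ l) k j + a j k l
  have h3 := h X j i
  rw [C.nabla_ξ_eq_add (C.ξ i) j] at h3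
  simpa [h2, proj_ξ] using h3

theorem nabla_ξ (X : 𝔛) (i : Fin s) : C.nabla X (C.ξ i) = C.β • C.proj X := by
  rw [nabla_ξ_eq_add]
  simp [g_nabla_ξ_ξ]

theorem nabla_ξs (X : 𝔛) : C.nabla X C.ξs = (s * C.β) • C.proj X := by
  simp [ξs, nabla_ξ, mul_smul, Nat.cast_smul_eq_nsmul]

theorem nabla_proj (X Y : 𝔛) : C.nabla X (C.proj Y)
    = C.proj (C.nabla X Y) - C.β • (C.g (C.proj X) Y • C.ξs + C.g Y C.ξs • C.proj X) := by
  simp only [proj_apply C Y, proj_apply C (C.nabla X Y), map_sub, map_sum, C.nabla_smul,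
    C.nabla_metric, nabla_ξ, map_smul, smul_eq_mul, add_smul, Finset.sum_add_distrib,
    C.g_comm Y (C.proj X), mul_smul, ← Finset.smul_sum, ← Finset.sum_smul]
  simp only [ξs, map_sum, smul_comm _ C.β (C.proj X)]
  module

theorem D_g_ξ (X Y : 𝔛) (i : Fin s) : C.D X (C.g Y (C.ξ i))
    = C.g (C.nabla X Y) (C.ξ i) + C.β * C.g (C.proj X) Y := by
  rw [C.nabla_metric, nabla_ξ, map_smul, smul_eq_mul, C.g_comm Y]

theorem D_g_ξs (X Y : 𝔛) : C.D X (C.g Y C.ξs)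
    = C.g (C.nabla X Y) C.ξs + s * C.β * C.g (C.proj X) Y := by
  rw [C.nabla_metric, nabla_ξs, map_smul, smul_eq_mul, C.g_comm Y]

/-! ### Curvature -/

theorem curv_ξ (X Y : 𝔛) (i : Fin s) : C.curv X Y (C.ξ i)
    = C.β ^ 2 • (C.g X C.ξs • C.proj Y - C.g Y C.ξs • C.proj X) := by
  simp only [C.curv_apply, nabla_ξ, C.nabla_smul, nabla_proj, C.D_β, map_sub,
    C.g_proj_comm Y X, AddMonoidHom.sub_apply]
  module

/-- At `Y = ξ i` this is what fixes a + b. -/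
theorem ric_ξ (Y : 𝔛) (i : Fin s) : C.ric Y (C.ξ i) = -(2 * n * C.β ^ 2 * C.g Y C.ξs) := by
  simp only [C.ric_apply, curv_ξ, map_smul, map_sub, LinearMap.smul_apply, LinearMap.sub_apply,
    smul_eq_mul, ← Finset.mul_sum, Finset.sum_sub_distrib, sum_g_proj_frame]
  have h : ∑ j, C.g (C.e j) C.ξs * C.g (C.proj Y) (C.e j) = 0 := by
    rw [← C.g_proj_ξs Y, ← C.sum_g_frame_mul]
    exact Finset.sum_congr rfl fun j _ ↦ by rw [C.g_comm (C.e j), mul_comm]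
  rw [h]
  ring

/-- The Ricci identity for `f`: the commutator of `R_{X,Y}` with `f` is the skew part of ∇²f, which
is algebraic because ∇f and ∇ξ are. -/
theorem curv_f (X Y Z : 𝔛) : C.curv X Y (C.f Z) = C.f (C.curv X Y Z)
    + C.β ^ 2 • ((s * C.g (C.f Y) Z) • C.proj X - (C.g Y C.ξs * C.g (C.f X) Z) • C.ξs
      - (s * C.g (C.proj X) Z) • C.f Y + (C.g Z C.ξs * C.g Y C.ξs) • C.f X
      - (s * C.g (C.f X) Z) • C.proj Y + (C.g X C.ξs * C.g (C.f Y) Z) • C.ξs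
      + (s * C.g (C.proj Y) Z) • C.f X - (C.g Z C.ξs * C.g X C.ξs) • C.f Y) := by
  simp only [C.curv_apply, nabla_f', C.nabla_smul, nabla_ξs, C.D_β, map_sub, map_add, map_smul,
    D_g_ξs, C.nabla_metric _ (C.f _), C.f_skew Y X, LinearMap.sub_apply,
    LinearMap.add_apply, LinearMap.smul_apply, smul_eq_mul, AddMonoidHom.sub_apply,
    C.g_comm C.ξs]
  module

variable {R 𝔛 ι : Type*} [CommRing R] [AddCommGroup 𝔛] [Module R 𝔛] [Fintype ι] [DecidableEq ι]
  {n s : ℕ} (C : KenmotsuModule R 𝔛 ι n s)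

/-! ### The `*`-Ricci tensor -/

/-- Skewness moves `f` onto the curvature, and `curv_f` moves it on to `W`; what remains is a Ricci
trace and traces of the correction terms. -/
theorem sum_g_curv_f (X W : 𝔛) : ∑ i, C.g (C.curv (C.e i) X W) (C.f (C.e i))
    = -C.ric X (C.f W) + (2 * n - 1) * s * C.β ^ 2 * C.g (C.f X) W := by
  have h (i : ι) : C.g (C.curv (C.e i) X W) (C.f (C.e i))
      = -C.g (C.curv (C.e i) X (C.f W)) (C.e i)
        + C.β ^ 2 * (s * C.g (C.f X) W * C.g (C.proj (C.e i)) (C.e i)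
          + C.g X C.ξs * (C.g (C.f W) (C.e i) * C.g C.ξs (C.e i))
          - s * (C.g (C.proj W) (C.e i) * C.g (C.f X) (C.e i))
          + C.g W C.ξs * C.g X C.ξs * C.g (C.f (C.e i)) (C.e i)
          + s * (C.g (C.f W) (C.e i) * C.g (C.proj X) (C.e i))
          + C.g (C.f X) W * (C.g C.ξs (C.e i) * C.g C.ξs (C.e i))
          + s * C.g (C.proj X) W * C.g (C.f (C.e i)) (C.e i)
          - C.g W C.ξs * (C.g C.ξs (C.e i) * C.g (C.f X) (C.e i))) := by
    have h1 := C.f_skew (C.curv (C.e i) X W) (C.e i)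
    have h2 := congrArg (fun T ↦ C.g T (C.e i)) (C.curv_f (C.e i) X W)
    simp only [map_add, map_sub, map_smul, LinearMap.add_apply, LinearMap.sub_apply,
      LinearMap.smul_apply, smul_eq_mul, C.f_skew (C.e i) W, C.g_comm (C.e i) (C.f W),
      C.g_comm (C.e i) C.ξs, C.g_proj_comm (C.e i) W] at h2
    linear_combination h1 + h2
  simp only [h, Finset.sum_add_distrib, Finset.sum_neg_distrib, ← Finset.mul_sum,
    Finset.sum_sub_distrib, C.sum_g_frame_mul, sum_g_f_frame, sum_g_proj_frame, g_f_ξs, g_ξs_ξs,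
    C.ric_apply, C.g_comm C.ξs (C.f _), C.g_proj_right, C.g_proj_comm W (C.f X), C.proj_f]
  linear_combination s * C.β ^ 2 * (C.f_skew W X - C.g_comm W (C.f X))

/-- The left side is twice the `*`-Ricci tensor. The first Bianchi identity splits it into two
traces of the kind computed in `sum_g_curv_f`. -/
theorem sum_g_f_curv (X Y : 𝔛) : ∑ i, C.g (C.f (C.curv X (C.f Y) (C.e i))) (C.e i)
    = C.ric (C.f X) (C.f Y) - C.ric X (C.f (C.f Y))
      + 2 * ((2 * n - 1) * s * C.β ^ 2 * C.g (C.f X) (C.f Y)) := by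
  have h (i : ι) : C.g (C.f (C.curv X (C.f Y) (C.e i))) (C.e i)
      = C.g (C.curv (C.e i) X (C.f Y)) (C.f (C.e i))
        - C.g (C.curv (C.e i) (C.f Y) X) (C.f (C.e i)) := by
    have h1 := congrArg (fun T ↦ C.g T (C.f (C.e i))) (C.first_bianchi X (C.f Y) (C.e i))
    rw [C.curv_swap (C.f Y) (C.e i) X] at h1
    simp only [map_add, map_neg, map_zero, LinearMap.add_apply, LinearMap.neg_apply,
      LinearMap.zero_apply] at h1
    linear_combination C.f_skew (C.curv X (C.f Y) (C.e i)) (C.e i) - h1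
  simp only [h, Finset.sum_sub_distrib, sum_g_curv_f]
  have h2 := C.f_skew (C.f Y) X
  have h3 := C.g_comm (C.f Y) (C.f X)
  have h4 : C.ric (C.f Y) (C.f X) = C.ric (C.f X) (C.f Y) :=
    C.ric_comm (fun _ ↦ C.two_mul_cancel) _ _
  linear_combination h4 - (2 * n - 1) * s * C.β ^ 2 * (h2 - h3)

theorem D_g_proj (Z X Y : 𝔛) : C.D Z (C.g (C.proj X) Y) = C.g (C.proj (C.nabla Z X)) Y
    + C.g (C.proj X) (C.nabla Z Y)
    - C.β * (C.g (C.proj Z) X * C.g Y C.ξs + C.g X C.ξs * C.g (C.proj Z) Y) := by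
  rw [C.nabla_metric, nabla_proj, C.g_comm Y]
  simp only [map_add, map_sub, map_smul, LinearMap.add_apply, LinearMap.sub_apply,
      LinearMap.smul_apply, smul_eq_mul]
  ring

theorem D_g_f_f (Z X Y : 𝔛) : C.D Z (C.g (C.f X) (C.f Y)) = C.g (C.f (C.nabla Z X)) (C.f Y)
    + C.g (C.f X) (C.f (C.nabla Z Y))
    - C.β * (C.g X C.ξs * C.g (C.f Z) (C.f Y) + C.g Y C.ξs * C.g (C.f Z) (C.f X)) := by
  rw [C.nabla_metric, nabla_f', nabla_f']
  simp only [map_add, map_sub, map_smul, LinearMap.add_apply, LinearMap.sub_apply,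
      LinearMap.smul_apply, smul_eq_mul, C.g_comm C.ξs, g_f_ξs, C.g_comm (C.f Z) (C.f X)]
  ring

/-- The trace of `-f²` is constant. -/
theorem D_sum_g_f_f_frame (X : 𝔛) : C.D X (∑ i, C.g (C.f (C.e i)) (C.f (C.e i))) = 0 := by
  have h := C.sum_nabla_frame (C.g.compl₁₂ C.f C.f) X
  have h2 : ∑ i, C.g (C.e i) C.ξs * C.g (C.f X) (C.f (C.e i)) = 0 := by
    have : ∀ i, C.g (C.f X) (C.f (C.e i)) = -C.g (C.e i) (C.f (C.f X)) := fun i ↦ by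
      rw [C.g_comm, C.f_skew]
    simp only [this, mul_neg, Finset.sum_neg_distrib, C.sum_g_frame_mul', C.g_comm C.ξs, g_f_ξs,
      neg_zero]
  simp only [LinearMap.compl₁₂_apply, Finset.sum_add_distrib] at h
  simp only [map_sum, D_g_f_f, Finset.sum_sub_distrib, Finset.sum_add_distrib, ← Finset.mul_sum,
    h, h2]
  ring

/-! ### `η`-Einstein structures -/

section EtaEinstein

-- `A` stands for a + 2nsβ², and `hA` is the η-Einstein equation after a + b = -2nβ² has been
-- inserted.
variable {A : R} (hA : ∀ X Y, C.ric X Y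
  = A * C.g (C.proj X) Y - 2 * n * C.β ^ 2 * (s * C.g (C.proj X) Y + C.g X C.ξs * C.g Y C.ξs))

include hA

/-- Thus Ric* = (A - sβ²) g(f·, f·), which turns the soliton equation into a formula for 𝓛_V g. -/
theorem sum_g_f_curv_of_etaEinstein (X Y : 𝔛) :
    ∑ i, C.g (C.f (C.curv X (C.f Y) (C.e i))) (C.e i)
      = 2 * ((A - s * C.β ^ 2) * C.g (C.f X) (C.f Y)) := by
  simp only [sum_g_f_curv, hA, proj_f, g_f_ξs, ← g_proj_right]
  linear_combination -(A - 2 * n * C.β ^ 2 * s) * C.f_skew X (C.f Y)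

theorem scal_eq_of_etaEinstein :
    C.scal = 2 * n * A - 4 * n ^ 2 * s * C.β ^ 2 - 2 * n * s * C.β ^ 2 := by
  simp only [RiemannianModule.scal, hA, Finset.sum_sub_distrib, ← Finset.mul_sum,
    Finset.sum_add_distrib, sum_g_proj_frame, C.sum_g_frame_mul', g_ξs_ξs]
  ring

/-- The contracted Bianchi identity: `scal` is 2nA plus a constant, while the divergence of `ric`
sees the derivative of `A` only along `proj X`. -/
theorem two_n_mul_D_of_etaEinstein (X : 𝔛) :
    2 * (n * C.D X A) = 2 * (C.D (C.proj X) A - 2 * n * C.β * A * C.g X C.ξs) := by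
  have h := C.D_scal X
  have e (i : ι) : C.D (C.e i) (C.ric X (C.e i)) - C.ric (C.nabla (C.e i) X) (C.e i)
      - C.ric X (C.nabla (C.e i) (C.e i)) = C.g (C.proj X) (C.e i) * C.D (C.e i) A
      - (A - 2 * n * C.β ^ 2 * s) * C.β * (C.g (C.proj X) (C.e i) * C.g C.ξs (C.e i)
        + C.g X C.ξs * C.g (C.proj (C.e i)) (C.e i))
      - 2 * n * C.β ^ 2 * s * C.β * (C.g (C.proj X) (C.e i) * C.g C.ξs (C.e i)
        + C.g X C.ξs * C.g (C.proj (C.e i)) (C.e i)) := by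
    simp only [hA, map_sub, map_add, Derivation.leibniz, D_g_proj, D_g_ξs, smul_eq_mul, C.D_β,
      Derivation.map_natCast, C.g_proj_comm (C.e i) X, C.g_comm C.ξs, Derivation.leibniz_pow,
      C.D_two]
    simp
    ring
  have h1 : ∑ i, C.g (C.proj X) (C.e i) * C.g C.ξs (C.e i) = 0 := by
    rw [C.sum_g_frame_mul, g_proj_ξs]
  simp only [e, Finset.sum_sub_distrib, Finset.sum_add_distrib, ← Finset.mul_sum, h1,
    sum_g_proj_frame, C.sum_g_mul_D_frame, C.scal_eq_of_etaEinstein hA] at h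
  simp [Derivation.leibniz, Derivation.leibniz_pow, C.D_β, C.D_two, C.D_four] at h
  linear_combination h

theorem D_ξ_of_etaEinstein (hn : n ≠ 0) (i : Fin s) : C.D (C.ξ i) A = -(2 * C.β * A) := by
  have h := C.two_n_mul_D_of_etaEinstein hA (C.ξ i)
  rw [proj_ξ, g_ξ_ξs, map_zero, Derivation.zero_apply] at h
  have h2 := C.natCast_mul_cancel (k := n) (a := C.D (C.ξ i) A + 2 * C.β * A) hn
    (C.two_mul_cancel (by linear_combination h))
  linear_combination h2

/-- On horizontal fields the Bianchi identity reads n dA = dA. It is void for n = 1, which is why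
that case needs its own argument. -/
theorem D_proj_of_etaEinstein (hn : 2 ≤ n) (X : 𝔛) : C.D (C.proj X) A = 0 := by
  obtain ⟨k, rfl⟩ : ∃ k, n = k + 2 := ⟨n - 2, by omega⟩
  have h := C.two_n_mul_D_of_etaEinstein hA (C.proj X)
  rw [proj_proj, g_proj_ξs] at h
  refine C.natCast_mul_cancel (k := k + 1) (by omega) (C.two_mul_cancel ?_)
  push_cast at h ⊢
  linear_combination h

end EtaEinstein

variable {R 𝔛 ι : Type*} [CommRing R] [AddCommGroup 𝔛] [Module R 𝔛] [Fintype ι] [DecidableEq ι]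
  {n s : ℕ} (C : KenmotsuModule R 𝔛 ι n s)

/-! ### Solitons -/

theorem hess_g_ξ (V X Y : 𝔛) (i : Fin s) :
    C.D X (C.D Y (C.g V (C.ξ i))) - C.D (C.nabla X Y) (C.g V (C.ξ i))
      = C.g (C.nabla X (C.nabla Y V) - C.nabla (C.nabla X Y) V) (C.ξ i)
        + C.β * (C.g (C.proj X) (C.nabla Y V) + C.g (C.proj Y) (C.nabla X V))
        - C.β ^ 2 * (C.g (C.proj X) Y * C.g V C.ξs + C.g Y C.ξs * C.g (C.proj X) V) := by
  simp only [D_g_ξ, map_add, Derivation.leibniz, C.D_β, C.nabla_metric (_) (C.proj _), nabla_proj,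
    map_sub, map_smul, LinearMap.sub_apply, LinearMap.add_apply, LinearMap.smul_apply, smul_eq_mul,
    C.g_comm C.ξs V]
  ring

section Soliton

-- `κ` stands for λ + μ, and `hV` is the soliton equation with 𝓛_V g written through ∇V and Ric*
-- already evaluated.
variable {A lam κ : R} {V : 𝔛} (hA : ∀ X Y, C.ric X Y
  = A * C.g (C.proj X) Y - 2 * n * C.β ^ 2 * (s * C.g (C.proj X) Y + C.g X C.ξs * C.g Y C.ξs))
  (hlam : ∀ X, C.D X lam = 0) (hκ : ∀ X, C.D X κ = 0)
  (hV : ∀ X Y, C.g (C.nabla X V) Y + C.g X (C.nabla Y V)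
    = 2 * (lam * C.g (C.proj X) Y - (A - s * C.β ^ 2) * C.g (C.f X) (C.f Y)
      + κ * (C.g X C.ξs * C.g Y C.ξs)))

include hlam hκ in
-- The covariant derivative along `Z` of the right side of `hV`, in the shape that
-- `two_mul_g_nabla_nabla` requires.
theorem nabla_soliton_tensor (X Y Z : 𝔛) :
    C.D Z (2 * (lam * C.g (C.proj X) Y - (A - s * C.β ^ 2) * C.g (C.f X) (C.f Y)
      + κ * (C.g X C.ξs * C.g Y C.ξs)))
    - 2 * (lam * C.g (C.proj (C.nabla Z X)) Y
      - (A - s * C.β ^ 2) * C.g (C.f (C.nabla Z X)) (C.f Y)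
      + κ * (C.g (C.nabla Z X) C.ξs * C.g Y C.ξs))
    - 2 * (lam * C.g (C.proj X) (C.nabla Z Y)
      - (A - s * C.β ^ 2) * C.g (C.f X) (C.f (C.nabla Z Y))
      + κ * (C.g X C.ξs * C.g (C.nabla Z Y) C.ξs))
    = 2 * ((s * κ - lam) * C.β * (C.g (C.proj Z) X * C.g Y C.ξs + C.g X C.ξs * C.g (C.proj Z) Y)
      - C.D Z A * C.g (C.f X) (C.f Y) + (A - s * C.β ^ 2) * C.β *
      (C.g X C.ξs * C.g (C.f Z) (C.f Y) + C.g Y C.ξs * C.g (C.f Z) (C.f X))) := by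
  simp only [map_add, map_sub, Derivation.leibniz, Derivation.leibniz_pow, Derivation.map_natCast,
    C.D_two, C.D_β, D_g_proj, D_g_ξs, D_g_f_f, hlam, hκ, smul_eq_mul]
  ring

include hA hlam hκ hV

/-- The ξ_i-component of `two_mul_g_nabla_nabla` on horizontal fields. Because `f (ξ i) = 0`, the
derivative of `A` survives only along ξ_i, where it is -2βA; the curvature terms reduce to `curv_ξ`
by the symmetries of the curvature tensor. -/
theorem hess_soliton (hn : n ≠ 0) (X Y : 𝔛) (i : Fin s) :
    C.D (C.proj X) (C.D (C.proj Y) (C.g V (C.ξ i)))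
      - C.D (C.nabla (C.proj X) (C.proj Y)) (C.g V (C.ξ i))
      = 2 * C.β * (s * κ * C.g (C.proj X) Y - A * C.g (C.f X) (C.f Y)) := by
  have h := C.two_mul_g_nabla_nabla V (C.proj X) (C.proj Y) (C.ξ i) _ hV
  beta_reduce at h
  rw [C.nabla_soliton_tensor hlam hκ, C.nabla_soliton_tensor hlam hκ,
    C.nabla_soliton_tensor hlam hκ] at h
  simp only [f_proj, C.f_ξ, g_proj_ξs, g_proj_ξ,
    C.D_ξ_of_etaEinstein hA hn, proj_proj, proj_ξ, map_zero, LinearMap.zero_apply, g_ξ_ξs] at h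
  have h1 := C.g_curv_swap (C.proj X) (C.proj Y) V (C.ξ i)
  have h2 := C.pair_symm (fun _ ↦ C.two_mul_cancel) (C.proj X) (C.ξ i) V (C.proj Y)
  have h3 := C.pair_symm (fun _ ↦ C.two_mul_cancel) (C.proj Y) (C.ξ i) V (C.proj X)
  rw [C.g_curv_swap V] at h2 h3
  simp only [curv_ξ, g_proj_ξs, map_smul, map_sub, LinearMap.sub_apply, LinearMap.smul_apply,
    smul_eq_mul, proj_proj] at h1 h2 h3
  have h4 := hV (C.proj X) (C.proj Y)
  rw [hess_g_ξ, ← sub_eq_zero]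
  refine C.two_mul_cancel ?_
  simp only [proj_proj, g_proj_ξs, f_proj, C.g_proj_right] at h4 h2 h3 h ⊢
  rw [C.g_proj_comm Y X, C.g_comm (C.f Y)] at h
  rw [C.g_proj_comm Y X] at h2
  rw [C.g_proj_comm Y (C.nabla (C.proj X) V)]
  linear_combination h + h1 - h2 - h3 + C.β * 2 * h4

/-- The (ξ_i, ξ_i) component of the soliton equation gives κ = 0, and the Hessian identity for the
zero function then says A g(fX, fY) = 0. Orthogonality of `V` to a single ξ_i suffices. -/
theorem mul_sum_g_f_f_eq_zero_of_horizontal (hn : n ≠ 0) (i : Fin s)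
    (hVξ : C.g V (C.ξ i) = 0) : A * ∑ i, C.g (C.f (C.e i)) (C.f (C.e i)) = 0 := by
  have h1 := hV (C.ξ i) (C.ξ i)
  have h2 := C.D_g_ξ (C.ξ i) V i
  rw [hVξ, proj_ξ, map_zero, map_zero, LinearMap.zero_apply] at h2
  rw [C.g_comm (C.ξ i), proj_ξ, g_ξ_ξs, map_zero, C.f_ξ, map_zero] at h1
  simp only [LinearMap.zero_apply] at h1
  have h3 : κ = 0 := C.two_mul_cancel (by linear_combination -h1 - 2 * h2)
  have h4 (X Y : 𝔛) : A * C.g (C.f X) (C.f Y) = 0 := by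
    have h := C.hess_soliton hA hlam hκ hV hn X Y i
    simp only [hVξ, map_zero, sub_zero, h3] at h
    refine C.isUnit_β.mul_right_eq_zero.1 (C.two_mul_cancel ?_)
    linear_combination h
  rw [Finset.mul_sum]
  exact Finset.sum_eq_zero fun i _ ↦ h4 _ _

end Soliton

/-- The horizontal part of the gradient. -/
def hgrad (a : R) : 𝔛 := ∑ i, C.D (C.e i) a • C.proj (C.e i)

theorem g_hgrad (a : R) (X : 𝔛) : C.g (C.hgrad a) X = C.D (C.proj X) a := by
  rw [← C.sum_g_mul_D_frame]
  simp only [hgrad, map_sum, map_smul, LinearMap.sum_apply, LinearMap.smul_apply, smul_eq_mul,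
    C.g_proj_comm X, mul_comm]

theorem g_hgrad_ξs (a : R) : C.g (C.hgrad a) C.ξs = 0 := by
  rw [g_hgrad, proj_ξs, map_zero, Derivation.zero_apply]

theorem proj_hgrad (a : R) : C.proj (C.hgrad a) = C.hgrad a :=
  C.ext_g fun Z ↦ by rw [← g_proj_right, g_hgrad, g_hgrad, proj_proj]

/-! ### Solitons for a single characteristic field -/

section Single

variable (C : KenmotsuModule R 𝔛 ι n 1)

theorem ξs_eq : C.ξs = C.ξ 0 := by simp [ξs]

theorem eq_proj_add (X : 𝔛) : X = C.proj X + C.g X C.ξs • C.ξs := by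
  simp [proj_apply, ξs_eq]

variable {A lam κ : R} {V : 𝔛} (hA : ∀ X Y, C.ric X Y
  = A * C.g (C.proj X) Y - 2 * n * C.β ^ 2 * ((1 : ℕ) * C.g (C.proj X) Y
    + C.g X C.ξs * C.g Y C.ξs))
  (hlam : ∀ X, C.D X lam = 0) (hκ : ∀ X, C.D X κ = 0)
  (hV : ∀ X Y, C.g (C.nabla X V) Y + C.g X (C.nabla Y V)
    = 2 * (lam * C.g (C.proj X) Y - (A - (1 : ℕ) * C.β ^ 2) * C.g (C.f X) (C.f Y)
      + κ * (C.g X C.ξs * C.g Y C.ξs)))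

include hV in
theorem D_ξs_g_ξs : C.D C.ξs (C.g V C.ξs) = κ := by
  have h1 := hV C.ξs C.ξs
  have h2 := C.D_g_ξs C.ξs V
  rw [proj_ξs, map_zero, LinearMap.zero_apply] at h2
  rw [C.g_comm C.ξs, proj_ξs, f_ξs, g_ξs_ξs, map_zero, LinearMap.zero_apply] at h1
  rw [← sub_eq_zero]
  refine C.two_mul_cancel ?_
  simp only [map_zero, Nat.cast_one] at h1
  linear_combination h1 + 2 * h2

include hA hlam hκ hV

/-- Three blocks determine ∇w. Horizontal against horizontal is `hess_soliton`; the derivative along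
ξ comes from the bracket of ξ with a horizontal field, applied to v, since ξ(v) = κ is constant; the
ξ-component follows from w ⊥ ξ. -/
theorem nabla_hgrad (hn : n ≠ 0) (X : 𝔛) : C.nabla X (C.hgrad (C.g V C.ξs))
    = (C.β * κ) • C.proj X + (2 * C.β * A) • C.f (C.f X)
      - C.β • (C.g X C.ξs • C.hgrad (C.g V C.ξs) + C.g (C.hgrad (C.g V C.ξs)) X • C.ξs) := by
  have hb := C.D_ξs_g_ξs hV
  set v := C.g V C.ξs with hv
  set w := C.hgrad v with hw
  have hwξ : C.g w C.ξs = 0 := C.g_hgrad_ξs v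
  have hwp (Z : 𝔛) : C.g (C.proj Z) w = C.g w Z := by
    rw [g_proj_comm, hw, proj_hgrad]
  have h1 : C.g (C.nabla X w) C.ξs = -(C.β * C.g w X) := by
    have := C.D_g_ξs X w
    rw [hwξ, map_zero, hwp] at this
    push_cast at this
    linear_combination -this
  have hh (Y : 𝔛) : C.g (C.nabla (C.proj X) w) (C.proj Y)
      = C.β * κ * C.g (C.proj X) Y - 2 * C.β * A * C.g (C.f X) (C.f Y) := by
    have h := C.hess_soliton hA hlam hκ hV hn X Y 0
    rw [← ξs_eq, ← hv, C.eq_proj_add (C.nabla (C.proj X) (C.proj Y))] at h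
    have h2 := C.D_g_ξs (C.proj X) (C.proj Y)
    rw [g_proj_ξs, map_zero, proj_proj, C.g_proj_right, proj_proj] at h2
    have h3 := C.nabla_metric (C.proj X) w (C.proj Y)
    rw [hw, C.g_hgrad, C.g_hgrad, ← hw, proj_proj] at h3
    simp only [map_add, map_smul, Derivation.add_apply, Derivation.smul_apply, hb,
      smul_eq_mul] at h
    push_cast at h h2
    linear_combination h - h3 - κ * h2
  have hξ (Y : 𝔛) : C.g (C.nabla C.ξs w) (C.proj Y) = -(C.β * C.g w Y) := by
    have h := C.D_bracket C.ξs (C.proj Y) v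
    rw [hb, hκ, nabla_ξs, proj_proj] at h
    have h3 := C.nabla_metric C.ξs w (C.proj Y)
    have h2 := C.D_g_ξs C.ξs (C.proj Y)
    rw [g_proj_ξs, map_zero, proj_ξs, map_zero, LinearMap.zero_apply] at h2
    have h4 := congrArg (fun T ↦ C.D T v) (C.eq_proj_add (C.nabla C.ξs (C.proj Y)))
    simp only [map_add, map_smul, map_sub, Derivation.add_apply, Derivation.smul_apply, hb,
      smul_eq_mul, Derivation.sub_apply] at h h4
    rw [hw, C.g_hgrad, C.g_hgrad, ← hw, proj_proj] at h3
    rw [hw, g_hgrad]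
    push_cast at h h2
    linear_combination -h3 - h + h4 - κ * h2
  refine C.ext_g fun Y ↦ ?_
  have h2 : C.g (C.nabla X w) Y = C.g (C.nabla (C.proj X) w) (C.proj Y)
      + C.g X C.ξs * C.g (C.nabla C.ξs w) (C.proj Y) + C.g Y C.ξs * C.g (C.nabla X w) C.ξs := by
    conv_lhs => rw [C.eq_proj_add Y, map_add, map_smul]
    conv_lhs => enter [1]; rw [C.eq_proj_add X]
    simp
  rw [h2, hh, hξ, h1]
  simp only [map_add, map_smul, map_sub, LinearMap.add_apply, LinearMap.sub_apply,
    LinearMap.smul_apply, smul_eq_mul, C.g_comm C.ξs Y]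
  linear_combination -(2 * C.β * A) * C.f_skew (C.f X) Y

theorem curv_hgrad (hn : n ≠ 0) (X Y : 𝔛) : C.curv X Y (C.hgrad (C.g V C.ξs))
    = -(2 * C.β ^ 2 * κ) • (C.g Y C.ξs • C.proj X - C.g X C.ξs • C.proj Y)
      - (4 * C.β ^ 2 * A) • (C.g Y C.ξs • C.f (C.f X) - C.g X C.ξs • C.f (C.f Y))
      + (2 * C.β) • (C.D X A • C.f (C.f Y) - C.D Y A • C.f (C.f X))
      + C.β ^ 2 • ((C.g Y C.ξs * C.g (C.hgrad (C.g V C.ξs)) X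
        - C.g X C.ξs * C.g (C.hgrad (C.g V C.ξs)) Y) • C.ξs
        - (C.g (C.hgrad (C.g V C.ξs)) Y • C.proj X
          - C.g (C.hgrad (C.g V C.ξs)) X • C.proj Y)) := by
  have hw := C.nabla_hgrad hA hlam hκ hV hn
  have hwξ := C.g_hgrad_ξs (C.g V C.ξs)
  have hwp := C.proj_hgrad (C.g V C.ξs)
  set w := C.hgrad (C.g V C.ξs)
  have e1 := C.f_skew (C.f X) Y
  have e2 := C.f_skew (C.f Y) X
  have e3 := C.g_comm (C.f Y) (C.f X)
  rw [C.curv_apply]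
  simp only [hw, map_add, map_sub, map_smul, C.nabla_smul, nabla_proj, nabla_f', nabla_ξs,
    Derivation.leibniz, C.D_β, hκ, C.D_two, D_g_ξs, C.nabla_metric _ w, LinearMap.add_apply,
    LinearMap.sub_apply, LinearMap.smul_apply, AddMonoidHom.sub_apply, smul_eq_mul,
    g_f_ξs, C.g_comm C.ξs, f_ξs, e1, e2, e3, C.g_proj_comm Y X, Nat.cast_one]
  module

/-- The traced Ricci identity for the horizontal gradient. -/
theorem mul_g_hgrad (hn : n ≠ 0) (Y : 𝔛) : A * C.g (C.hgrad (C.g V C.ξs)) Y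
    = 4 * C.β ^ 2 * ((∑ i, C.g (C.f (C.e i)) (C.f (C.e i))) * A - n * κ) * C.g Y C.ξs
      + 2 * C.β * (C.D (C.f (C.f Y)) A
        + (∑ i, C.g (C.f (C.e i)) (C.f (C.e i))) * C.D Y A) := by
  have h := C.ric_apply Y (C.hgrad (C.g V C.ξs))
  have hwξ := C.g_hgrad_ξs (C.g V C.ξs)
  have hwp := C.proj_hgrad (C.g V C.ξs)
  have hc := C.curv_hgrad hA hlam hκ hV hn
  set w := C.hgrad (C.g V C.ξs)
  have e1 (i : ι) : C.g (C.curv (C.e i) Y w) (C.e i)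
      = -(2 * C.β ^ 2 * κ) * (C.g Y C.ξs * C.g (C.proj (C.e i)) (C.e i)
        - C.g C.ξs (C.e i) * C.g (C.proj Y) (C.e i))
      - (4 * C.β ^ 2 * A) * (-C.g Y C.ξs * C.g (C.f (C.e i)) (C.f (C.e i))
        - C.g C.ξs (C.e i) * C.g (C.f (C.f Y)) (C.e i))
      + (2 * C.β) * (C.g (C.f (C.f Y)) (C.e i) * C.D (C.e i) A
        + C.D Y A * C.g (C.f (C.e i)) (C.f (C.e i)))
      + C.β ^ 2 * (C.g Y C.ξs * (C.g w (C.e i) * C.g C.ξs (C.e i))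
        - C.g w Y * (C.g C.ξs (C.e i) * C.g C.ξs (C.e i))
        - (C.g w Y * C.g (C.proj (C.e i)) (C.e i)
          - C.g w (C.e i) * C.g (C.proj Y) (C.e i))) := by
    have := C.f_skew (C.f (C.e i)) (C.e i)
    rw [hc]
    simp only [map_add, map_smul, map_sub, LinearMap.add_apply, LinearMap.sub_apply,
      LinearMap.smul_apply, smul_eq_mul, C.g_comm (C.e i) C.ξs, this]
    ring
  simp only [e1, Finset.sum_add_distrib, Finset.sum_sub_distrib, ← Finset.mul_sum,
    C.sum_g_frame_mul, C.sum_g_mul_D_frame, sum_g_proj_frame, C.g_comm C.ξs (C.proj Y), g_proj_ξs,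
    C.g_comm C.ξs (C.f _), g_f_ξs, hwξ, g_ξs_ξs, hA, C.g_proj_right, hwp, C.g_proj_comm Y w] at h
  push_cast at h
  linear_combination h

end Single
end KenmotsuModule

/-! ### The case n = s = 1: an inconsistent system in dimension three. -/

/-- An overdetermined system of equations for two commuting derivations. -/
theorem false_of_commuting_derivations {R : Type*} [CommRing R] [Nontrivial R]
    (h2 : IsUnit (2 : R)) (w j : Derivation ℤ R R) (hcomm : ∀ a, w (j a) = j (w a))
    {A m v φ ψ β p τ c : R} (hτ : 2 * β * p * τ = 1) (hA : IsUnit A) (hm : IsUnit m)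
    (wβ : w β = 0) (jβ : j β = 0) (wp : w p = 0) (jp : j p = 0) (wc : w c = 0) (jc : j c = 0)
    (wA : w A = τ * A * m) (jA : j A = 0) (wv : w v = m) (jv : j v = 0)
    (wm : w m = -4 * β * A * p * m) (jm : j m = 0)
    (wφ : w φ = (c - p * A - β * v) * m - 2 * β * A * p * φ)
    (wψ : w ψ + j φ = -4 * β * A * p * ψ)
    (jψ : j ψ = p * ((c - p * A - β * v) * m + 2 * β * A * p * φ)) : False := by
  have hβu : IsUnit β := IsUnit.of_mul_eq_one (2 * p * τ) (by linear_combination hτ)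
  have hpu : IsUnit p := IsUnit.of_mul_eq_one (2 * β * τ) (by linear_combination hτ)
  have hτu : IsUnit τ := IsUnit.of_mul_eq_one (2 * β * p) (by linear_combination hτ)
  have w2 : w 2 = 0 := by exact_mod_cast w.map_natCast 2
  have j2 : j 2 = 0 := by exact_mod_cast j.map_natCast 2
  have w4 : w 4 = 0 := by exact_mod_cast w.map_natCast 4
  have j4 : j 4 = 0 := by exact_mod_cast j.map_natCast 4
  have wτ : w τ = 0 := by
    have h := congrArg w hτ
    simp only [Derivation.leibniz, wβ, wp, w2, smul_eq_mul, Derivation.map_one_eq_zero] at h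
    refine (hβu.mul (hpu.mul h2)).mul_right_eq_zero.1 ?_
    linear_combination h
  have jτ : j τ = 0 := by
    have h := congrArg j hτ
    simp only [Derivation.leibniz, jβ, jp, j2, smul_eq_mul, Derivation.map_one_eq_zero] at h
    refine (hβu.mul (hpu.mul h2)).mul_right_eq_zero.1 ?_
    linear_combination h
  -- Commutation on `φ`; the functions `A`, `v`, `m` are constant along `j`.
  have s1 : w (j φ) = -2 * β * A * p * j φ := by
    rw [hcomm, wφ]
    simp only [map_sub, Derivation.leibniz, jc, jp, jA, jβ, jv, jm, j2, smul_eq_mul]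
    ring
  have s2 : w ψ = -j φ - 4 * β * A * p * ψ := by linear_combination wψ
  -- Commutation on `ψ` eliminates `ψ` altogether and expresses `j (j φ)` through `φ`.
  have s3 : j (j φ) = p * (A * m ^ 2 * p * τ + β * m ^ 2
      - 2 * β * A * p * (c - p * A - β * v) * m - (A * m + 4 * β ^ 2 * A ^ 2 * p ^ 2) * φ) := by
    have h := hcomm ψ
    rw [jψ, s2] at h
    simp only [map_sub, map_add, map_neg, Derivation.leibniz, jp, jA, jβ, j4,
      wβ, wp, wc, wA, wv, wm, wφ, w2, jψ, smul_eq_mul] at h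
    linear_combination h - p * A * m * φ * hτ
  -- Commutation on `j φ`: no derivative of `φ` survives, so `φ` is determined algebraically.
  have s4 : p * (A * m ^ 2 * (φ * τ - (p * τ ^ 2 * m - 2 * A * p - 4 * β ^ 2 * p
      - 2 * (c - p * A - β * v)))) = 0 := by
    have h := hcomm (j φ)
    rw [s1, s3] at h
    simp only [map_sub, map_add, map_neg, Derivation.leibniz, Derivation.leibniz_pow, jp, jA, jβ,
      j2, wβ, wp, wc, wA, wv, wm, wφ, w2, w4, wτ, s3, smul_eq_mul, nsmul_eq_mul] at h
    push_cast at h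
    linear_combination -h - p * (4 * β * p * A ^ 2 * m * φ + 2 * p * A ^ 2 * m ^ 2
      + A * (c - p * A - β * v) * m ^ 2) * hτ
  have s5 : φ = p * τ * m - 4 * β * p * (2 * β ^ 2 * p + c - β * v) := by
    have h := (hA.mul (hm.pow 2)).mul_right_eq_zero.1 (hpu.mul_right_eq_zero.1 s4)
    linear_combination 2 * β * p * h - (φ - p * τ * m) * hτ
  -- The expression in `s5` contains only functions that are constant along `j`; hence the right
  -- side of `s3` vanishes too.
  have s6 : j φ = 0 := by
    rw [s5]
    simp only [map_sub, map_add, Derivation.leibniz, Derivation.leibniz_pow, jp, jβ,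
      j2, j4, jc, jv, jm, jτ, smul_eq_mul, nsmul_eq_mul]
    ring
  have s7 : A * m ^ 2 * p * τ + β * m ^ 2 - 2 * β * A * p * (c - p * A - β * v) * m
      - (A * m + 4 * β ^ 2 * A ^ 2 * p ^ 2) * φ = 0 := by
    refine hpu.mul_right_eq_zero.1 ?_
    rw [← s3, s6, map_zero]
  have s8 : -2 * A * p * m + 4 * β ^ 2 * p * m
      = (c - p * A - β * v) * m - 2 * β * A * p * φ := by
    rw [← wφ, s5]
    simp only [map_sub, map_add, Derivation.leibniz, Derivation.leibniz_pow, wp, wβ,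
      w2, w4, wc, wv, wm, wτ, smul_eq_mul, nsmul_eq_mul]
    linear_combination 2 * A * p * m * hτ
  -- By `s5`, `φ = p * τ * m + B`, with `B` affine in `v`; so `w B` is a constant multiple of `m`.
  obtain ⟨B, hB⟩ : ∃ B, B = -4 * β * p * (2 * β ^ 2 * p + c - β * v) := ⟨_, rfl⟩
  have s9 : A * (m + 8 * β ^ 2 * p ^ 2 * A) * B = β * m * (m - 8 * β ^ 2 * p ^ 2 * A) := by
    linear_combination -s7 + 2 * β * A * p * s8 - (A * m + 8 * β ^ 2 * A ^ 2 * p ^ 2) * (s5 - hB)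
      - 4 * β * A ^ 2 * p ^ 2 * m * hτ
  have wB : w B = 4 * β ^ 2 * p * m := by
    simp only [hB, map_sub, map_add, map_neg, Derivation.leibniz, Derivation.leibniz_pow, wp, wβ,
      w2, w4, wc, wv, smul_eq_mul, nsmul_eq_mul]
    ring
  have w8 : w 8 = 0 := by exact_mod_cast w.map_natCast 8
  -- The derivative of `s9` along `w`. By `hτ` the factor `m + 8β²p²A` is constant along `w`, so the
  -- differentiated equation is again linear in `B`, and comparison with `s9` eliminates `B`.
  have s10 : (m + 8 * β ^ 2 * p ^ 2 * A) * B = -32 * β ^ 3 * p ^ 2 * m := by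
    have h := congrArg w s9
    simp only [map_sub, map_add, Derivation.leibniz, Derivation.leibniz_pow, wp, wβ,
      w8, wA, wB, wm, smul_eq_mul, nsmul_eq_mul] at h
    push_cast at h
    have h' : A * m * τ * ((m + 8 * β ^ 2 * p ^ 2 * A) * B + 32 * β ^ 3 * p ^ 2 * m) = 0 := by
      linear_combination h + (12 * β ^ 2 * A * p * m ^ 2 - 4 * β * p * A ^ 2 * m * B) * hτ
    linear_combination ((hA.mul hm).mul hτu).mul_right_eq_zero.1 h'
  have s11 : m + 24 * β ^ 2 * p ^ 2 * A = 0 := by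
    refine (hβu.mul hm).mul_right_eq_zero.1 ?_
    linear_combination A * s10 - s9
  -- Differentiating `s11` gives -4 + 12 = 8 times the unit βpAm.
  have s12 : 2 * 2 * 2 * (β * p * A * m) = 0 := by
    have w24 : w 24 = 0 := by exact_mod_cast w.map_natCast 24
    have h := congrArg w s11
    simp only [map_add, Derivation.leibniz, Derivation.leibniz_pow, wp, wβ, w24, wA, wm,
      smul_eq_mul, nsmul_eq_mul, map_zero] at h
    linear_combination h - 12 * β * p * A * m * hτ
  exact (((h2.mul h2).mul h2).mul (((hβu.mul hpu).mul hA).mul hm)).ne_zero s12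

namespace KenmotsuModule

variable {R 𝔛 ι : Type*} [CommRing R] [AddCommGroup 𝔛] [Module R 𝔛] [Fintype ι] [DecidableEq ι]
  {n : ℕ}

section

variable (C : KenmotsuModule R 𝔛 ι n 1)
  {A lam κ : R} {V : 𝔛} (hA : ∀ X Y, C.ric X Y
  = A * C.g (C.proj X) Y - 2 * n * C.β ^ 2 * ((1 : ℕ) * C.g (C.proj X) Y
    + C.g X C.ξs * C.g Y C.ξs))
  (hlam : ∀ X, C.D X lam = 0) (hκ : ∀ X, C.D X κ = 0)
  (hV : ∀ X Y, C.g (C.nabla X V) Y + C.g X (C.nabla Y V)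
    = 2 * (lam * C.g (C.proj X) Y - (A - (1 : ℕ) * C.β ^ 2) * C.g (C.f X) (C.f Y)
      + κ * (C.g X C.ξs * C.g Y C.ξs)))

include hA

theorem D_ξs_of_etaEinstein (hn : n ≠ 0) : C.D C.ξs A = -(2 * C.β * A) := by
  rw [ξs_eq]
  exact C.D_ξ_of_etaEinstein hA hn 0

include hlam hκ hV

/-- In `mul_g_hgrad` at ξ the two terms containing |f|² A cancel, because ξ(A) = -2βA; only 4β²nκ =
0 is left. -/
theorem coeff_eq_zero (hn : n ≠ 0) : κ = 0 := by
  have h := C.mul_g_hgrad hA hlam hκ hV hn C.ξs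
  rw [g_hgrad_ξs, g_ξs_ξs, f_ξs, map_zero, map_zero, Derivation.zero_apply,
    C.D_ξs_of_etaEinstein hA hn] at h
  push_cast at h
  refine C.natCast_mul_cancel hn (C.isUnit_β.mul_right_eq_zero.1 (C.isUnit_β.mul_right_eq_zero.1
    (C.two_mul_cancel (C.two_mul_cancel ?_))))
  linear_combination h

/-- With w = 0 and κ = 0, `nabla_hgrad` reduces to 2βA f² = 0. -/
theorem mul_sum_g_f_f_eq_zero_of_hgrad (hn : n ≠ 0) (hw : C.hgrad (C.g V C.ξs) = 0) :
    A * ∑ i, C.g (C.f (C.e i)) (C.f (C.e i)) = 0 := by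
  rw [Finset.mul_sum]
  refine Finset.sum_eq_zero fun i _ ↦ ?_
  have h := congrArg (fun T ↦ C.g T (C.e i)) (C.nabla_hgrad hA hlam hκ hV hn (C.e i))
  simp only [C.coeff_eq_zero hA hlam hκ hV hn, hw, map_zero, map_smul, smul_zero,
    LinearMap.smul_apply, smul_eq_mul,
    LinearMap.zero_apply, mul_zero, zero_add, add_zero, sub_zero, zero_smul,
    C.f_skew (C.f _)] at h
  refine C.isUnit_β.mul_right_eq_zero.1 (C.two_mul_cancel ?_)
  linear_combination h

/-- In dimension at least five, the soliton function has vanishing horizontal gradient. -/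
theorem hgrad_eq_zero (hn : 2 ≤ n) (hAu : IsUnit A) : C.hgrad (C.g V C.ξs) = 0 := by
  have hn0 : n ≠ 0 := by omega
  refine C.ext_g fun Y ↦ ?_
  rw [map_zero, LinearMap.zero_apply]
  have h := C.mul_g_hgrad hA hlam hκ hV hn0 (C.proj Y)
  -- Rewriting `f (f Y)` as its own projection makes every remaining derivative of `A` horizontal,
  -- hence zero.
  rw [C.g_proj_right, C.proj_hgrad, C.g_proj_ξs, ← C.proj_f, C.D_proj_of_etaEinstein hA hn,
    C.D_proj_of_etaEinstein hA hn] at h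
  refine hAu.mul_right_eq_zero.1 ?_
  linear_combination h

end

section Surface

-- In dimension three `hp` holds with `p` equal to half of |f|² (`exists_f_f_eq`).
variable (C : KenmotsuModule R 𝔛 ι 1 1) {A lam κ p τ : R} {V : 𝔛} (hAu : IsUnit A)
  (hA : ∀ X Y, C.ric X Y
    = A * C.g (C.proj X) Y - 2 * (1 : ℕ) * C.β ^ 2 * ((1 : ℕ) * C.g (C.proj X) Y
    + C.g X C.ξs * C.g Y C.ξs))
  (hlam : ∀ X, C.D X lam = 0) (hκ : ∀ X, C.D X κ = 0)
  (hV : ∀ X Y, C.g (C.nabla X V) Y + C.g X (C.nabla Y V)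
    = 2 * (lam * C.g (C.proj X) Y - (A - (1 : ℕ) * C.β ^ 2) * C.g (C.f X) (C.f Y)
      + κ * (C.g X C.ξs * C.g Y C.ξs)))
  (hp : ∀ X, C.f (C.f X) = -p • C.proj X) (hτ : 2 * C.β * p * τ = 1)

include hp

theorem g_f_f_of_sq (X Y : 𝔛) : C.g (C.f X) (C.f Y) = p * C.g (C.proj X) Y := by
  have h := C.f_skew (C.f X) Y
  rw [hp] at h
  simp only [map_smul, LinearMap.smul_apply, smul_eq_mul] at h
  linear_combination h

theorem sum_g_f_f_of_sq : ∑ i, C.g (C.f (C.e i)) (C.f (C.e i)) = 2 * p := by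
  simp only [C.g_f_f_of_sq hp, ← Finset.mul_sum, sum_g_proj_frame]
  push_cast
  ring

/-- The trace of -f² is constant, and here it equals 2p. -/
theorem D_of_sq (X : 𝔛) : C.D X p = 0 := by
  have h := C.D_sum_g_f_f_frame X
  rw [C.sum_g_f_f_of_sq hp, Derivation.leibniz, C.D_two] at h
  refine C.two_mul_cancel ?_
  simpa using h

include hA hlam hκ hV hτ

/-- For n = 1 the trace identity `mul_g_hgrad` can be solved for the horizontal derivative of `A`,
about which the Bianchi identity says nothing. -/
theorem D_eq_mul_g_hgrad (Y : 𝔛) :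
    C.D Y A = τ * A * C.g (C.hgrad (C.g V C.ξs)) Y - 2 * C.β * A * C.g Y C.ξs := by
  have h := C.mul_g_hgrad hA hlam hκ hV one_ne_zero Y
  have h1 := congrArg (fun T ↦ C.D T A) (C.eq_proj_add Y)
  simp only [map_add, map_smul, Derivation.add_apply, Derivation.smul_apply, smul_eq_mul,
    C.D_ξs_of_etaEinstein hA one_ne_zero] at h1
  rw [C.sum_g_f_f_of_sq hp, hp, map_smul, Derivation.smul_apply, smul_eq_mul,
    C.coeff_eq_zero hA hlam hκ hV one_ne_zero] at h
  linear_combination -τ * h - (C.D Y A + 2 * C.β * A * C.g Y C.ξs) * hτ - 2 * C.β * p * τ * h1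

include hAu in
-- The system is satisfied with the derivations w, fw and m = |w|², φ = g(V, w), ψ = g(V, fw). The
-- equations for φ and ψ are the soliton equation on the plane spanned by w and fw.
theorem false_of_isUnit_g_hgrad [Nontrivial R]
    (hm : IsUnit (C.g (C.hgrad (C.g V C.ξs)) (C.hgrad (C.g V C.ξs)))) : False := by
  have hκ0 := C.coeff_eq_zero hA hlam hκ hV one_ne_zero
  have hDA := C.D_eq_mul_g_hgrad hA hlam hκ hV hp hτ
  have hDp := C.D_of_sq hp
  have hD := C.g_hgrad (C.g V C.ξs)
  have hw := C.nabla_hgrad hA hlam hκ hV one_ne_zero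
  have hwξ := C.g_hgrad_ξs (C.g V C.ξs)
  have hwp := C.proj_hgrad (C.g V C.ξs)
  have hbξ := C.D_ξs_g_ξs hV
  set v := C.g V C.ξs with hv
  set w := C.hgrad v
  have hww : C.g w (C.f w) = 0 := by rw [C.g_comm, g_f_self]
  have hff : C.g (C.f w) (C.f w) = p * C.g w w := by rw [C.g_f_f_of_sq hp, hwp]
  have n1 : C.nabla w w = (-(2 * C.β * A * p)) • w - (C.β * C.g w w) • C.ξs := by
    rw [hw, hp, hwp, hκ0, hwξ]
    module
  have n2 : C.nabla (C.f w) w = (-(2 * C.β * A * p)) • C.f w := by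
    rw [hw, hp, hκ0, g_f_ξs, hww, C.proj_f]
    module
  have n3 : C.nabla w (C.f w) = (-(2 * C.β * A * p)) • C.f w := by
    rw [nabla_f', n1, hwξ, g_f_self]
    simp only [map_sub, map_smul, C.f_ξs]
    module
  have n4 : C.nabla (C.f w) (C.f w) = (2 * C.β * A * p * p) • w
      - (C.β * p * C.g w w) • C.ξs := by
    rw [nabla_f', n2, hwξ, map_smul, hp, hwp, map_smul, LinearMap.smul_apply, smul_eq_mul]
    module
  -- ∇_w(fw) and ∇_{fw}w coincide, so [w, fw] = 0.
  have hc : ∀ a, C.D w (C.D (C.f w) a) = C.D (C.f w) (C.D w a) := by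
    intro a
    have := C.D_bracket w (C.f w) a
    rw [n2, n3, sub_self, map_zero, Derivation.zero_apply] at this
    linear_combination -this
  have e1 := hV w w
  have e2 := hV w (C.f w)
  have e3 := hV (C.f w) (C.f w)
  rw [g_f_f_of_sq C hp, hwξ, hwp] at e1
  rw [g_f_f_of_sq C hp, hwξ, hwp, hww] at e2
  rw [g_f_f_of_sq C hp, g_f_ξs, C.proj_f, hff] at e3
  have c1 := C.g_comm (C.nabla w V) w
  have c2 := C.g_comm (C.nabla (C.f w) V) (C.f w)
  have c3 := C.g_comm (C.nabla (C.f w) V) w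
  have hvw : C.D w v = C.g w w := by rw [hD, hwp]
  have hvf : C.D (C.f w) v = 0 := by
    have := hD (C.f w)
    rw [C.proj_f, hww] at this
    exact this.symm
  push_cast at e1 e2 e3
  -- The constant `c` is the part of λ - (A - β²)p that does not contain `A`.
  refine false_of_commuting_derivations (R := R) (by exact_mod_cast C.isUnit_natCast 2 two_ne_zero)
    (C.D w) (C.D (C.f w)) hc (A := A) (m := C.g w w) (v := v) (φ := C.g V w)
    (ψ := C.g V (C.f w)) (β := C.β) (p := p) (τ := τ) (c := lam + C.β ^ 2 * p) hτ hAu hm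
    (C.D_β _) (C.D_β _) (hDp _) (hDp _) ?_ ?_ ?_ ?_ hvw hvf ?_ ?_ ?_ ?_ ?_
  · simp [hlam, C.D_β, hDp]
  · simp [hlam, C.D_β, hDp]
  · rw [hDA, hwξ]; ring
  · rw [hDA, hww, g_f_ξs]; ring
  · rw [C.nabla_metric, n1]
    simp only [map_sub, map_smul, LinearMap.sub_apply, LinearMap.smul_apply, smul_eq_mul, hwξ,
      C.g_comm C.ξs w]
    ring
  · rw [C.nabla_metric, n2]
    simp only [map_smul, LinearMap.smul_apply, smul_eq_mul, hww, g_f_self]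
    ring
  · rw [C.nabla_metric, n1]
    simp only [map_sub, map_smul, smul_eq_mul, ← hv]
    refine sub_eq_zero.1 (C.two_mul_cancel ?_)
    linear_combination e1 + c1
  · rw [C.nabla_metric, C.nabla_metric (C.f w), n3, n2]
    simp only [map_smul, smul_eq_mul]
    linear_combination e2 + c3
  · rw [C.nabla_metric, n4]
    simp only [map_sub, map_smul, smul_eq_mul, ← hv]
    refine sub_eq_zero.1 (C.two_mul_cancel ?_)
    linear_combination e3 + c2

end Surface
end KenmotsuModule

/-! ### Smooth functions and vector fields on an open set as a Riemannian module. -/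

noncomputable section

variable {E : Type*} [NormedAddCommGroup E] [NormedSpace ℝ E] [FiniteDimensional ℝ E]
  [CompleteSpace E] {H : Type*} [TopologicalSpace H] {I : ModelWithCorners ℝ E H}
  {M : Type*} [TopologicalSpace M] [ChartedSpace H M] [IsManifold I ∞ M]
  [RiemannianBundle (fun x : M ↦ TangentSpace I x)]
  [IsContMDiffRiemannianBundle I ∞ E (fun x : M ↦ TangentSpace I x)]

/-! ### Smooth fields on open sets -/

scoped instance : IsManifold I (((⊤ : ℕ∞) : WithTop ℕ∞) + 1) M :=
  inferInstanceAs (IsManifold I ∞ M)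

scoped instance : IsManifold I (minSmoothness ℝ 3) M := by
  rw [minSmoothness_of_isRCLikeNormedField]
  infer_instance

variable {U : Set M} {X Y Z : Π x : M, TangentSpace I x}

theorem mdiffAt_of_contMDiffOn (hU : IsOpen U) (hX : ContMDiffOn I I.tangent ∞ (T% X) U) {x : M}
    (hx : x ∈ U) : MDiffAt (T% X) x :=
  (hX.contMDiffAt (hU.mem_nhds hx)).mdifferentiableAt (by simp)

theorem contMDiffOn_mlieBracket (hU : IsOpen U) (hX : ContMDiffOn I I.tangent ∞ (T% X) U)
    (hY : ContMDiffOn I I.tangent ∞ (T% Y) U) :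
    ContMDiffOn I I.tangent ∞ (T% (mlieBracket I X Y)) U := fun x hx ↦
  ((hX.contMDiffAt (hU.mem_nhds hx)).mlieBracket_vectorField (n := ⊤) (m := ⊤)
    (hY.contMDiffAt (hU.mem_nhds hx))
    (by rw [minSmoothness_of_isRCLikeNormedField]; exact le_rfl)).contMDiffWithinAt

/-- The Leibniz rule solved for the derivative: smoothness of X(a) can then be read off from that of
brackets. -/
theorem mlieBracket_smul_right_sub {a : M → ℝ} {x : M} (ha : MDiffAt a x)
    (hY : MDiffAt (T% Y) x) :
    mvfderiv I a x (X x) • Y x = mlieBracket I X (a • Y) x - a x • mlieBracket I X Y x := by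
  rw [mlieBracket_smul_right ha hY]
  abel

theorem contMDiffOn_inner (hX : ContMDiffOn I I.tangent ∞ (T% X) U)
    (hY : ContMDiffOn I I.tangent ∞ (T% Y) U) :
    ContMDiffOn I 𝓘(ℝ, ℝ) ∞ (fun x ↦ ⟪X x, Y x⟫) U :=
  ContMDiffOn.inner_bundle (IB := I) (F := E) (E := fun x : M ↦ TangentSpace I x)
    (b := fun y ↦ y) hX hY

/-- Directional derivatives of smooth functions are smooth. -/
theorem contMDiffOn_mvfderiv {a : M → ℝ} (hU : IsOpen U) (ha : ContMDiffOn I 𝓘(ℝ, ℝ) ∞ a U)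
    (hX : ContMDiffOn I I.tangent ∞ (T% X) U) (hZ : ContMDiffOn I I.tangent ∞ (T% Z) U)
    (hZ1 : ∀ x ∈ U, ⟪Z x, Z x⟫ = (1 : ℝ)) :
    ContMDiffOn I 𝓘(ℝ, ℝ) ∞ (fun x ↦ mvfderiv I a x (X x)) U := by
  have h1 := contMDiffOn_mlieBracket hU hX (ha.smul_section hZ)
  have h2 := ha.smul_section (contMDiffOn_mlieBracket hU hX hZ)
  refine (contMDiffOn_inner (h1.sub_section h2) hZ).congr fun x hx ↦ ?_
  have h := mlieBracket_smul_right_sub (X := X) (I := I)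
    ((ha.contMDiffAt (hU.mem_nhds hx)).mdifferentiableAt (by simp))
    (mdiffAt_of_contMDiffOn hU hZ hx)
  rw [Pi.sub_apply]
  change _ = ⟪mlieBracket I X (a • Z) x - a x • mlieBracket I X Z x, Z x⟫
  rw [← h, inner_smul_left, hZ1 x hx]
  simp

/-- The Lie bracket is the commutator of derivations. -/
theorem mvfderiv_mlieBracket {a : M → ℝ} (hU : IsOpen U) (ha : ContMDiffOn I 𝓘(ℝ, ℝ) ∞ a U)
    (hX : ContMDiffOn I I.tangent ∞ (T% X) U) (hY : ContMDiffOn I I.tangent ∞ (T% Y) U)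
    (hZ : ContMDiffOn I I.tangent ∞ (T% Z) U) (hZ1 : ∀ x ∈ U, ⟪Z x, Z x⟫ = (1 : ℝ))
    {x : M} (hx : x ∈ U) : mvfderiv I a x (mlieBracket I X Y x)
      = mvfderiv I (fun y ↦ mvfderiv I a y (Y y)) x (X x)
        - mvfderiv I (fun y ↦ mvfderiv I a y (X y)) x (Y x) := by
  have hd {b : M → ℝ} (hb : ContMDiffOn I 𝓘(ℝ, ℝ) ∞ b U) {y : M} (hy : y ∈ U) : MDiffAt b y :=
    (hb.contMDiffAt (hU.mem_nhds hy)).mdifferentiableAt (by simp)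
  have hv {W : Π x : M, TangentSpace I x} (hW : ContMDiffOn I I.tangent ∞ (T% W) U) {y : M}
      (hy : y ∈ U) := mdiffAt_of_contMDiffOn hU hW hy
  have hs {W : Π x : M, TangentSpace I x} (hW : ContMDiffOn I I.tangent ∞ (T% W) U) :
      ContMDiffAt I I.tangent (minSmoothness ℝ 2) (T% W) x := by
    rw [minSmoothness_of_isRCLikeNormedField]
    exact (hW.contMDiffAt (hU.mem_nhds hx)).of_le ENat.LEInfty.out
  have hnh := hU.mem_nhds hx
  have key (X Y : Π x : M, TangentSpace I x) (hX : ContMDiffOn I I.tangent ∞ (T% X) U)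
      (hY : ContMDiffOn I I.tangent ∞ (T% Y) U) :
      mlieBracket I X (mlieBracket I Y (a • Z)) x
        = mvfderiv I (fun y ↦ mvfderiv I a y (Y y)) x (X x) • Z x
          + mvfderiv I a x (Y x) • mlieBracket I X Z x
          + mvfderiv I a x (X x) • mlieBracket I Y Z x
          + a x • mlieBracket I X (mlieBracket I Y Z) x := by
    have e : mlieBracket I Y (a • Z) =ᶠ[nhds x]
        ((fun y ↦ mvfderiv I a y (Y y)) • Z + a • mlieBracket I Y Z) := by
      filter_upwards [hnh] with y hy
      exact mlieBracket_smul_right (hd ha hy) (hv hZ hy)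
    have hc := contMDiffOn_mvfderiv hU ha hY hZ hZ1
    have hb := contMDiffOn_mlieBracket hU hY hZ
    rw [Filter.EventuallyEq.mlieBracket_vectorField_eq (Filter.EventuallyEq.refl _ X) e,
      mlieBracket_add_right (hv (hc.smul_section hZ) hx) (hv (ha.smul_section hb) hx),
      mlieBracket_smul_right (hd hc hx) (hv hZ hx), mlieBracket_smul_right (hd ha hx) (hv hb hx)]
    module
  -- The Jacobi identity for aZ minus a times the one for Z leaves the claimed identity multiplied
  -- by Z, which is a unit vector.
  have j1 := leibniz_identity_mlieBracket_apply (hs hX) (hs hY) (hs (ha.smul_section hZ))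
  have j2 := leibniz_identity_mlieBracket_apply (hs hX) (hs hY) (hs hZ)
  rw [key X Y hX hY, key Y X hY hX, mlieBracket_smul_right (hd ha hx) (hv hZ hx), j2] at j1
  have h : (mvfderiv I a x (mlieBracket I X Y x)
      - (mvfderiv I (fun y ↦ mvfderiv I a y (Y y)) x (X x)
        - mvfderiv I (fun y ↦ mvfderiv I a y (X y)) x (Y x))) • Z x = 0 := by
    rw [← sub_eq_zero] at j1
    rw [← neg_eq_zero, ← j1]
    module
  rcases smul_eq_zero.1 h with h | h
  · exact sub_eq_zero.1 h
  · have := hZ1 x hx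
    rw [h, inner_zero_left] at this
    norm_num at this

theorem mvfderiv_congr {a b : M → ℝ} {x : M} (h : a =ᶠ[nhds x] b) :
    mvfderiv I a x = mvfderiv I b x := by
  ext u
  simp only [mvfderiv, h.mfderiv_eq]
  rfl

/-- Locality of the Koszul formula. It is needed because sections over `U` are extended by zero and
agree with the original fields only near points of `U`. -/
theorem leviCivita_congr {Y' : Π x : M, TangentSpace I x} {x : M} (hY : MDiffAt (T% Y) x)
    (h : Y =ᶠ[nhds x] Y') : leviCivita I M Y x = leviCivita I M Y' x := by
  have e1 (W : Π x : M, TangentSpace I x) :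
      (fun y ↦ ⟪W y, Y y⟫) =ᶠ[nhds x] (fun y ↦ (⟪W y, Y' y⟫ : ℝ)) := by
    filter_upwards [h] with y hy
    rw [hy]
  have e2 (W : Π x : M, TangentSpace I x) :
      (fun y ↦ ⟪Y y, W y⟫) =ᶠ[nhds x] (fun y ↦ (⟪Y' y, W y⟫ : ℝ)) := by
    filter_upwards [h] with y hy
    rw [hy]
  have hY' : MDiffAt (T% Y') x := hY.congr_of_eventuallyEq (by
    filter_upwards [h] with y hy
    rw [hy])
  refine eq_of_inner_leviCivita hY fun X Z hX hZ ↦ ?_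
  rw [inner_leviCivita hX hY' hZ, koszul, koszul, mvfderiv_congr (e1 X), mvfderiv_congr (e2 Z),
    Filter.EventuallyEq.mlieBracket_vectorField_eq (.refl _ X) h,
    Filter.EventuallyEq.mlieBracket_vectorField_eq h (.refl _ Z), h.eq_of_nhds]

/-! ### Orthonormal frames -/

/-- Smooth orthonormal frames on `U`. -/
structure IsOrthonormalFrameOn {ι : Type*} [Fintype ι] (e : ι → Π x : M, TangentSpace I x)
    (U : Set M) : Prop where
  contMDiffOn : ∀ i, ContMDiffOn I I.tangent ∞ (T% (e i)) U
  orthonormal : ∀ x ∈ U, Orthonormal ℝ (fun i ↦ e i x)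
  card_eq : Fintype.card ι = Module.finrank ℝ E

variable (I) in
-- Gram–Schmidt applied to a local frame. Smoothness is proved by induction on the index: the
-- projection coefficients are quotients of smooth inner products with nonvanishing denominators.
theorem exists_isOrthonormalFrameOn (x : M) : ∃ U : Set M, IsOpen U ∧ x ∈ U ∧
    ∃ e : Fin (Module.finrank ℝ E) → Π x : M, TangentSpace I x, IsOrthonormalFrameOn e U := by
  set t := trivializationAt E (TangentSpace I : M → Type _) x
  set b := Module.finBasis ℝ E
  have hf := t.isLocalFrameOn_localFrame_baseSet I ∞ b
  refine ⟨t.baseSet, t.open_baseSet, mem_baseSet_trivializationAt E _ x,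
    fun i y ↦ InnerProductSpace.gramSchmidtNormed ℝ (fun k ↦ t.localFrame b k y) i, fun i ↦ ?_,
    fun y hy ↦ InnerProductSpace.gramSchmidtNormed_orthonormal (hf.linearIndependent hy), by simp⟩
  have hne (i) (y : M) (hy : y ∈ t.baseSet) :
      InnerProductSpace.gramSchmidt ℝ (fun k ↦ t.localFrame b k y) i ≠ 0 :=
    InnerProductSpace.gramSchmidt_ne_zero _ (hf.linearIndependent hy)
  have hG (i) : ContMDiffOn I I.tangent ∞ (T% (fun y ↦
      InnerProductSpace.gramSchmidt ℝ (fun k ↦ t.localFrame b k y) i)) t.baseSet := by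
    induction i using WellFoundedLT.induction with
    | _ i ih =>
      have h (j : Fin (Module.finrank ℝ E)) : ContMDiffOn I I.tangent ∞ (T% (fun y ↦
          if j < i then (ℝ ∙ InnerProductSpace.gramSchmidt ℝ (fun k ↦ t.localFrame b k y)
            j).starProjection (t.localFrame b i y) else 0)) t.baseSet := by
        split_ifs with hj
        · simp only [Submodule.starProjection_singleton]
          refine ContMDiffOn.smul_section ?_ (ih j hj)
          have h1 := contMDiffOn_inner (ih j hj) (hf.contMDiffOn i)
          have h2 := contMDiffOn_inner (ih j hj) (ih j hj)
          refine (h1.div₀ h2 fun y hy ↦ ?_).congr fun y hy ↦ ?_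
          · exact inner_self_ne_zero.2 (hne j y hy)
          · simp
        · exact contMDiffOn_zeroSection ℝ (TangentSpace I : M → Type _)
      refine ((hf.contMDiffOn i).sub_section
        (ContMDiffOn.sum_section (s := Finset.univ) fun j _ ↦ h j)).congr fun y hy ↦ ?_
      rw [InnerProductSpace.gramSchmidt_def]
      simp [Finset.sum_ite, Finset.filter_gt_eq_Iio]
  refine ContMDiffOn.smul_section ?_ (hG i)
  have h2 := contMDiffOn_inner (hG i) (hG i)
  refine ContMDiffOn.inv₀ (fun y hy ↦ ?_) fun y hy ↦ ?_
  · have h3 := (Real.contDiffAt_sqrt (n := ∞)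
      (inner_self_ne_zero.2 (hne i y hy))).contMDiffAt.comp_contMDiffWithinAt y (h2 y hy)
    exact h3.congr (fun z _ ↦ norm_eq_sqrt_real_inner (F := TangentSpace I z) _)
      (norm_eq_sqrt_real_inner (F := TangentSpace I y) _)
  · exact norm_ne_zero_iff.2 (hne i y hy)

/-! ### The module of smooth vector fields on an open set -/

open scoped Classical in
/-- The extension by zero of a section over a set. -/
def zeroExt {F : M → Type*} [∀ x, Zero (F x)] {U : Set M} (X : Π x : U, F x) (x : M) : F x :=
  if h : x ∈ U then X ⟨x, h⟩ else 0

section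
variable {F : M → Type*} {U : Set M}

theorem zeroExt_coe [∀ x, Zero (F x)] (X : Π x : U, F x) (x : U) : zeroExt X (x : M) = X x :=
  dif_pos x.2

theorem zeroExt_of_mem [∀ x, Zero (F x)] (X : Π x : U, F x) {x : M} (hx : x ∈ U) :
    zeroExt X x = X ⟨x, hx⟩ := dif_pos hx

theorem zeroExt_add [∀ x, AddZeroClass (F x)] (X Y : Π x : U, F x) :
    zeroExt (X + Y) = zeroExt X + zeroExt Y := by
  ext x
  by_cases hx : x ∈ U <;> simp [zeroExt, hx]

theorem zeroExt_neg [∀ x, SubtractionMonoid (F x)] (X : Π x : U, F x) :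
    zeroExt (-X) = -zeroExt X := by
  ext x
  by_cases hx : x ∈ U <;> simp [zeroExt, hx]

theorem zeroExt_smul [∀ x, AddCommGroup (F x)] [∀ x, Module ℝ (F x)] (a : U → ℝ)
    (X : Π x : U, F x) : zeroExt (fun x ↦ a x • X x) = zeroExt (F := fun _ ↦ ℝ) a • zeroExt X := by
  ext x
  by_cases hx : x ∈ U <;> simp [zeroExt, hx]

end

variable (I) in
/-- The ring of smooth functions on `U`. -/
def smoothFunctions (U : Set M) : Subring (U → ℝ) where
  carrier := {a | ContMDiffOn I 𝓘(ℝ, ℝ) ∞ (zeroExt (F := fun _ ↦ ℝ) a) U}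
  mul_mem' {a b} ha hb := by
    have h := zeroExt_smul (F := fun _ : M ↦ ℝ) a b
    simp only [smul_eq_mul] at h
    change ContMDiffOn I 𝓘(ℝ, ℝ) ∞ (zeroExt (F := fun _ ↦ ℝ) fun x ↦ a x * b x) U
    rw [h]
    exact ContMDiffOn.mul ha hb
  add_mem' {a b} ha hb := by
    rw [Set.mem_ofPred, zeroExt_add]
    exact ContMDiffOn.add ha hb
  neg_mem' {a} ha := by
    rw [Set.mem_ofPred, zeroExt_neg]
    exact ContMDiffOn.neg ha
  zero_mem' := (contMDiffOn_const (c := (0 : ℝ))).congr fun x hx ↦ zeroExt_of_mem _ hx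
  one_mem' := (contMDiffOn_const (c := (1 : ℝ))).congr fun x hx ↦ zeroExt_of_mem _ hx

variable (I) in
/-- The module of smooth vector fields on `U`. -/
def smoothFields (U : Set M) :
    Submodule (smoothFunctions I U) (Π x : U, TangentSpace I (x : M)) where
  carrier := {X | ContMDiffOn I I.tangent ∞ (T% (zeroExt (F := fun x : M ↦ TangentSpace I x) X)) U}
  add_mem' {X Y} hX hY := by
    rw [Set.mem_ofPred, zeroExt_add]
    exact ContMDiffOn.add_section hX hY
  zero_mem' := (contMDiffOn_zeroSection ℝ (TangentSpace I : M → Type _)).congr fun x hx ↦ by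
    rw [zeroExt_of_mem _ hx]
    rfl
  smul_mem' a X hX := by
    have h := zeroExt_smul (F := fun x : M ↦ TangentSpace I x) a.1 X
    change ContMDiffOn I I.tangent ∞
      (T% (zeroExt (F := fun x : M ↦ TangentSpace I x) fun x ↦ a.1 x • X x)) U
    rw [h]
    exact ContMDiffOn.smul_section a.2 hX

variable (I) in
/-- Smooth functions on `U`. -/
abbrev SmoothFunction (U : Set M) : Type _ := smoothFunctions I U

variable (I) in
/-- Smooth vector fields on `U`. -/
abbrev SmoothField (U : Set M) : Type _ := smoothFields I U

variable {U : Set M}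

/-- The extension by zero of a smooth function. -/
def SmoothFunction.ext (a : SmoothFunction I U) : M → ℝ := zeroExt (F := fun _ ↦ ℝ) a.1

/-- The extension by zero of a smooth vector field. -/
def SmoothField.ext (X : SmoothField I U) : Π x : M, TangentSpace I x :=
  zeroExt (F := fun x : M ↦ TangentSpace I x) X.1

theorem SmoothFunction.contMDiffOn_ext (a : SmoothFunction I U) :
    ContMDiffOn I 𝓘(ℝ, ℝ) ∞ a.ext U := a.2

theorem SmoothField.contMDiffOn_ext (X : SmoothField I U) :
    ContMDiffOn I I.tangent ∞ (T% X.ext) U := X.2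

/-- The restriction of a function which is smooth on `U`. -/
def SmoothFunction.mk (a : M → ℝ) (ha : ContMDiffOn I 𝓘(ℝ, ℝ) ∞ a U) : SmoothFunction I U :=
  ⟨fun x ↦ a x, ha.congr fun _ hx ↦ zeroExt_of_mem _ hx⟩

/-- The restriction of a vector field which is smooth on `U`. -/
def SmoothField.mk (X : Π x : M, TangentSpace I x) (hX : ContMDiffOn I I.tangent ∞ (T% X) U) :
    SmoothField I U :=
  ⟨fun x ↦ X x, hX.congr fun x hx ↦ by
    rw [zeroExt_of_mem (F := fun x : M ↦ TangentSpace I x) _ hx]⟩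

namespace SmoothFunction

theorem ext_add (a b : SmoothFunction I U) : (a + b).ext = a.ext + b.ext := zeroExt_add _ _

theorem ext_zero : (0 : SmoothFunction I U).ext = fun _ ↦ 0 := by
  ext x
  simp [ext, zeroExt]

theorem ext_one {x : M} (hx : x ∈ U) : (1 : SmoothFunction I U).ext x = 1 := by
  simp [ext, zeroExt, hx]

theorem ext_sub (a b : SmoothFunction I U) : (a - b).ext = a.ext - b.ext := by
  rw [sub_eq_add_neg, sub_eq_add_neg, ext_add]
  exact congrArg _ (zeroExt_neg _)

theorem ext_mul (a b : SmoothFunction I U) : (a * b).ext = fun x ↦ a.ext x * b.ext x := by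
  have h := zeroExt_smul (F := fun _ : M ↦ ℝ) a.1 b.1
  simp only [smul_eq_mul] at h
  exact h

theorem ext_sum {ι : Type*} (s : Finset ι) (a : ι → SmoothFunction I U) (x : M) :
    (∑ i ∈ s, a i).ext x = ∑ i ∈ s, (a i).ext x := by
  classical
  induction s using Finset.induction_on with
  | empty => simp [ext_zero]
  | insert i s hi ih => rw [Finset.sum_insert hi, Finset.sum_insert hi, ext_add, ← ih, Pi.add_apply]

theorem ext_mk (hU : IsOpen U) {a : M → ℝ} (ha : ContMDiffOn I 𝓘(ℝ, ℝ) ∞ a U) {x : M}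
    (hx : x ∈ U) : (mk a ha).ext =ᶠ[nhds x] a := by
  filter_upwards [hU.mem_nhds hx] with y hy
  exact zeroExt_of_mem _ hy

theorem ext_coe (a : SmoothFunction I U) (x : U) : a.ext x = a.1 x := zeroExt_coe _ _

theorem mdiffAt (hU : IsOpen U) (a : SmoothFunction I U) {x : M} (hx : x ∈ U) :
    MDiffAt a.ext x :=
  (a.contMDiffOn_ext.contMDiffAt (hU.mem_nhds hx)).mdifferentiableAt (by simp)

theorem eq_iff {a b : SmoothFunction I U} : a = b ↔ ∀ x ∈ U, a.ext x = b.ext x := by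
  refine ⟨fun h ↦ by simp [h], fun h ↦ Subtype.ext (funext fun x ↦ ?_)⟩
  rw [← ext_coe, ← ext_coe, h x x.2]

theorem mk_ext {a : M → ℝ} (ha : ContMDiffOn I 𝓘(ℝ, ℝ) ∞ a U) {x : M} (hx : x ∈ U) :
    (mk a ha).ext x = a x := zeroExt_of_mem _ hx

end SmoothFunction

namespace SmoothField

theorem ext_add (X Y : SmoothField I U) : (X + Y).ext = X.ext + Y.ext := zeroExt_add _ _

theorem ext_zero : (0 : SmoothField I U).ext = 0 := by
  ext x
  by_cases hx : x ∈ U <;> simp [ext, zeroExt, hx]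

theorem ext_sub (X Y : SmoothField I U) : (X - Y).ext = X.ext - Y.ext := by
  rw [sub_eq_add_neg, sub_eq_add_neg, ext_add]
  exact congrArg _ (zeroExt_neg _)

theorem ext_smul (a : SmoothFunction I U) (X : SmoothField I U) :
    (a • X).ext = a.ext • X.ext :=
  zeroExt_smul (F := fun x : M ↦ TangentSpace I x) a.1 X.1

theorem ext_sum {ι : Type*} (s : Finset ι) (X : ι → SmoothField I U) (x : M) :
    (∑ i ∈ s, X i).ext x = ∑ i ∈ s, (X i).ext x := by
  classical
  induction s using Finset.induction_on with
  | empty => simp [ext, zeroExt]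
  | insert i s hi ih => rw [Finset.sum_insert hi, Finset.sum_insert hi, ext_add, ← ih, Pi.add_apply]

theorem ext_mk (hU : IsOpen U) {X : Π x : M, TangentSpace I x}
    (hX : ContMDiffOn I I.tangent ∞ (T% X) U) {x : M}
    (hx : x ∈ U) : (mk X hX).ext =ᶠ[nhds x] X := by
  filter_upwards [hU.mem_nhds hx] with y hy
  exact zeroExt_of_mem (F := fun x : M ↦ TangentSpace I x) _ hy

theorem mk_ext {X : Π x : M, TangentSpace I x} (hX : ContMDiffOn I I.tangent ∞ (T% X) U) {x : M}
    (hx : x ∈ U) : (mk X hX).ext x = X x := zeroExt_of_mem _ hx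

theorem ext_coe (X : SmoothField I U) (x : U) : X.ext x = X.1 x := zeroExt_coe _ _

theorem mdiffAt (hU : IsOpen U) (X : SmoothField I U) {x : M} (hx : x ∈ U) :
    MDiffAt (T% X.ext) x := mdiffAt_of_contMDiffOn hU X.contMDiffOn_ext hx

theorem eq_iff {X Y : SmoothField I U} : X = Y ↔ ∀ x ∈ U, X.ext x = Y.ext x := by
  refine ⟨fun h ↦ by simp [h], fun h ↦ Subtype.ext (funext fun x ↦ ?_)⟩
  rw [← ext_coe, ← ext_coe, h x x.2]

end SmoothField

theorem leviCivita_sub_leviCivita {X Y : Π x : M, TangentSpace I x} {x : M}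
    (hX : MDiffAt (T% X) x) (hY : MDiffAt (T% Y) x) :
    leviCivita I M Y x (X x) - leviCivita I M X x (Y x) = mlieBracket I X Y x :=
  (CovariantDerivative.torsion_eq_zero_iff _).1 leviCivita_torsion hX hY

/-- The orthonormal basis of the tangent space given by an orthonormal frame. -/
def IsOrthonormalFrameOn.basis {ι : Type*} [Fintype ι]
    {e : ι → Π x : M, TangentSpace I x} (he : IsOrthonormalFrameOn e U) {x : M} (hx : x ∈ U) :
    OrthonormalBasis ι ℝ (TangentSpace I x) :=
  OrthonormalBasis.mk (he.orthonormal x hx)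
    ((he.orthonormal x hx).linearIndependent.span_eq_top_of_card_eq_finrank' he.card_eq).ge

theorem IsOrthonormalFrameOn.basis_apply {ι : Type*} [Fintype ι]
    {e : ι → Π x : M, TangentSpace I x} (he : IsOrthonormalFrameOn e U) {x : M} (hx : x ∈ U)
    (i : ι) : he.basis hx i = e i x := by simp [basis]

theorem IsOrthonormalFrameOn.sum_inner_smul {ι : Type*} [Fintype ι]
    {e : ι → Π x : M, TangentSpace I x} (he : IsOrthonormalFrameOn e U) {x : M} (hx : x ∈ U)
    (u : TangentSpace I x) : ∑ i, (⟪u, e i x⟫ : ℝ) • e i x = u := by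
  have h := (he.basis hx).sum_repr' u
  simpa only [he.basis_apply hx, real_inner_comm] using h

theorem IsOrthonormalFrameOn.inner_eq {ι : Type*} [Fintype ι] [DecidableEq ι]
    {e : ι → Π x : M, TangentSpace I x} (he : IsOrthonormalFrameOn e U) {x : M} (hx : x ∈ U)
    (i j : ι) : (⟪e i x, e j x⟫ : ℝ) = if i = j then 1 else 0 :=
  orthonormal_iff_ite.1 (he.orthonormal x hx) i j

theorem IsOrthonormalFrameOn.contMDiffOn_mvfderiv {ι : Type*} [Fintype ι] [Nonempty ι]
    {e : ι → Π x : M, TangentSpace I x} (he : IsOrthonormalFrameOn e U) (hU : IsOpen U)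
    {a : M → ℝ} {X : Π x : M, TangentSpace I x} (ha : ContMDiffOn I 𝓘(ℝ, ℝ) ∞ a U)
    (hX : ContMDiffOn I I.tangent ∞ (T% X) U) :
    ContMDiffOn I 𝓘(ℝ, ℝ) ∞ (fun x ↦ mvfderiv I a x (X x)) U := by
  classical
  obtain ⟨j⟩ := ‹Nonempty ι›
  exact FKenmotsu.contMDiffOn_mvfderiv hU ha hX (he.contMDiffOn j) fun x hx ↦ by
    rw [he.inner_eq hx, if_pos rfl]

theorem IsOrthonormalFrameOn.mvfderiv_mlieBracket {ι : Type*} [Fintype ι] [Nonempty ι]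
    {e : ι → Π x : M, TangentSpace I x} (he : IsOrthonormalFrameOn e U) (hU : IsOpen U)
    {a : M → ℝ} {X Y : Π x : M, TangentSpace I x} (ha : ContMDiffOn I 𝓘(ℝ, ℝ) ∞ a U)
    (hX : ContMDiffOn I I.tangent ∞ (T% X) U) (hY : ContMDiffOn I I.tangent ∞ (T% Y) U)
    {x : M} (hx : x ∈ U) : mvfderiv I a x (mlieBracket I X Y x)
      = mvfderiv I (fun y ↦ mvfderiv I a y (Y y)) x (X x)
        - mvfderiv I (fun y ↦ mvfderiv I a y (X y)) x (Y x) := by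
  classical
  obtain ⟨j⟩ := ‹Nonempty ι›
  exact FKenmotsu.mvfderiv_mlieBracket hU ha hX hY (he.contMDiffOn j) (fun x hx ↦ by
    rw [he.inner_eq hx, if_pos rfl]) hx

/-- The coefficients of ∇_X Y in the orthonormal frame are Koszul expressions, built from smooth
brackets and directional derivatives. -/
theorem IsOrthonormalFrameOn.contMDiffOn_leviCivita {ι : Type*} [Fintype ι] [Nonempty ι]
    {e : ι → Π x : M, TangentSpace I x} (he : IsOrthonormalFrameOn e U) (hU : IsOpen U)
    {X Y : Π x : M, TangentSpace I x} (hX : ContMDiffOn I I.tangent ∞ (T% X) U)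
    (hY : ContMDiffOn I I.tangent ∞ (T% Y) U) :
    ContMDiffOn I I.tangent ∞ (T% (fun x ↦ leviCivita I M Y x (X x))) U := by
  classical
  have hd {a : M → ℝ} {X : Π x : M, TangentSpace I x} (ha : ContMDiffOn I 𝓘(ℝ, ℝ) ∞ a U)
    (hX : ContMDiffOn I I.tangent ∞ (T% X) U) := he.contMDiffOn_mvfderiv hU ha hX
  have hk (i) : ContMDiffOn I 𝓘(ℝ, ℝ) ∞ (koszul X Y (e i)) U := by
    have he := he.contMDiffOn i
    exact contMDiffOn_const.mul (((((hd (contMDiffOn_inner hY he) hX).add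
      (hd (contMDiffOn_inner he hX) hY)).sub (hd (contMDiffOn_inner hX hY) he)).add
      (contMDiffOn_inner (contMDiffOn_mlieBracket hU hX hY) he)).sub
      (contMDiffOn_inner (contMDiffOn_mlieBracket hU hX he) hY) |>.sub
      (contMDiffOn_inner (contMDiffOn_mlieBracket hU hY he) hX))
  refine (ContMDiffOn.sum_section (s := Finset.univ)
    fun i _ ↦ (hk i).smul_section (he.contMDiffOn i)).congr fun x hx ↦ ?_
  have h := he.sum_inner_smul hx (leviCivita I M Y x (X x))
  have h2 (i) := inner_leviCivita (mdiffAt_of_contMDiffOn hU hX hx)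
    (mdiffAt_of_contMDiffOn hU hY hx) (mdiffAt_of_contMDiffOn hU (he.contMDiffOn i) hx)
  simp only [h2] at h
  simp only [Pi.smul_apply', h]

/-- The metric on smooth vector fields. -/
def smoothMetric : SmoothField I U →ₗ[SmoothFunction I U] SmoothField I U →ₗ[SmoothFunction I U]
    SmoothFunction I U :=
  LinearMap.mk₂ _
    (fun X Y ↦ SmoothFunction.mk (fun x ↦ ⟪X.ext x, Y.ext x⟫)
      (contMDiffOn_inner X.contMDiffOn_ext Y.contMDiffOn_ext))
    (fun X X' Y ↦ SmoothFunction.eq_iff.2 fun x hx ↦ by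
      simp [SmoothFunction.ext_add, SmoothFunction.mk_ext _ hx, SmoothField.ext_add,
        inner_add_left])
    (fun a X Y ↦ SmoothFunction.eq_iff.2 fun x hx ↦ by
      simp [SmoothFunction.ext_mul, SmoothFunction.mk_ext _ hx, SmoothField.ext_smul,
        inner_smul_left])
    (fun X Y Y' ↦ SmoothFunction.eq_iff.2 fun x hx ↦ by
      simp [SmoothFunction.ext_add, SmoothFunction.mk_ext _ hx, SmoothField.ext_add,
        inner_add_right])
    (fun a X Y ↦ SmoothFunction.eq_iff.2 fun x hx ↦ by
      simp [SmoothFunction.ext_mul, SmoothFunction.mk_ext _ hx, SmoothField.ext_smul,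
        inner_smul_right])

theorem ext_smoothMetric {x : M} (hx : x ∈ U) (X Y : SmoothField I U) :
    (smoothMetric X Y).ext x = ⟪X.ext x, Y.ext x⟫ := SmoothFunction.mk_ext _ hx

theorem ext_smoothMetric_eventuallyEq (hU : IsOpen U) {x : M} (hx : x ∈ U)
    (X Y : SmoothField I U) : (smoothMetric X Y).ext =ᶠ[nhds x] fun y ↦ ⟪X.ext y, Y.ext y⟫ :=
  SmoothFunction.ext_mk hU _ hx

namespace IsOrthonormalFrameOn

variable {ι : Type*} [Fintype ι] [Nonempty ι] {e : ι → Π x : M, TangentSpace I x}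
  (he : IsOrthonormalFrameOn e U) (hU : IsOpen U)

/-- The action of smooth vector fields on smooth functions. -/
def smoothDeriv : SmoothField I U →ₗ[SmoothFunction I U]
    Derivation ℤ (SmoothFunction I U) (SmoothFunction I U) :=
    { toFun X := Derivation.mk'
        (AddMonoidHom.toIntLinearMap
          { toFun a := SmoothFunction.mk (fun x ↦ mvfderiv I a.ext x (X.ext x))
              (he.contMDiffOn_mvfderiv hU a.contMDiffOn_ext X.contMDiffOn_ext)
            map_zero' := SmoothFunction.eq_iff.2 fun x hx ↦ by
              have h : (0 : SmoothFunction I U).ext = fun _ ↦ 0 := by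
                ext y
                simp [SmoothFunction.ext, zeroExt]
              simp [SmoothFunction.mk_ext _ hx, h, mvfderiv_const]
            map_add' a b := SmoothFunction.eq_iff.2 fun x hx ↦ by
              simp [SmoothFunction.ext_add, SmoothFunction.mk_ext _ hx,
                mvfderiv_add (a.mdiffAt hU hx) (b.mdiffAt hU hx)] })
        fun a b ↦ SmoothFunction.eq_iff.2 fun x hx ↦ by
          simp [SmoothFunction.ext_add, SmoothFunction.ext_mul, SmoothFunction.mk_ext _ hx,
            mvfderiv_fun_mul (a.mdiffAt hU hx) (b.mdiffAt hU hx)]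
      map_add' X Y := Derivation.ext fun a ↦ SmoothFunction.eq_iff.2 fun x hx ↦ by
        simp [SmoothFunction.ext_add, SmoothFunction.mk_ext _ hx, SmoothField.ext_add]
      map_smul' a X := Derivation.ext fun b ↦ SmoothFunction.eq_iff.2 fun x hx ↦ by
        simp [SmoothFunction.ext_mul, SmoothFunction.mk_ext _ hx, SmoothField.ext_smul] }

/-- The Levi-Civita connection on smooth vector fields. -/
def smoothNabla : SmoothField I U →ₗ[SmoothFunction I U] SmoothField I U →+ SmoothField I U :=
    { toFun X :=
        { toFun Y := SmoothField.mk (fun x ↦ leviCivita I M Y.ext x (X.ext x))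
            (he.contMDiffOn_leviCivita hU X.contMDiffOn_ext Y.contMDiffOn_ext)
          map_zero' := SmoothField.eq_iff.2 fun x hx ↦ by
            have h : (0 : SmoothField I U).ext = 0 := SmoothField.ext_zero
            simp [SmoothField.mk_ext _ hx, h]
          map_add' Y Y' := SmoothField.eq_iff.2 fun x hx ↦ by
            have h := (leviCivita I M).isCovariantDerivativeOnUniv.add (Y.mdiffAt hU hx)
              (Y'.mdiffAt hU hx) (Set.mem_univ x)
            simp [SmoothField.mk_ext _ hx, SmoothField.ext_add, h] }
      map_add' X X' := AddMonoidHom.ext fun Y ↦ SmoothField.eq_iff.2 fun x hx ↦ by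
        simp [SmoothField.mk_ext _ hx, SmoothField.ext_add]
      map_smul' a X := AddMonoidHom.ext fun Y ↦ SmoothField.eq_iff.2 fun x hx ↦ by
        simp [SmoothField.mk_ext _ hx, SmoothField.ext_smul] }

theorem ext_smoothDeriv {x : M} (hx : x ∈ U) (X : SmoothField I U) (a : SmoothFunction I U) :
    (he.smoothDeriv hU X a).ext x = mvfderiv I a.ext x (X.ext x) := SmoothFunction.mk_ext _ hx

theorem ext_smoothDeriv_eventuallyEq {x : M} (hx : x ∈ U) (X : SmoothField I U)
    (a : SmoothFunction I U) :
    (he.smoothDeriv hU X a).ext =ᶠ[nhds x] fun y ↦ mvfderiv I a.ext y (X.ext y) :=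
  SmoothFunction.ext_mk hU _ hx

theorem ext_smoothNabla {x : M} (hx : x ∈ U) (X Y : SmoothField I U) :
    (he.smoothNabla hU X Y).ext x = leviCivita I M Y.ext x (X.ext x) := SmoothField.mk_ext _ hx

theorem smoothNabla_sub (X Y : SmoothField I U) :
    he.smoothNabla hU X Y - he.smoothNabla hU Y X = SmoothField.mk (mlieBracket I X.ext Y.ext)
      (contMDiffOn_mlieBracket hU X.contMDiffOn_ext Y.contMDiffOn_ext) :=
  SmoothField.eq_iff.2 fun x hx ↦ by
    rw [SmoothField.ext_sub, Pi.sub_apply, SmoothField.mk_ext _ hx, he.ext_smoothNabla hU hx,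
      he.ext_smoothNabla hU hx]
    exact leviCivita_sub_leviCivita (X.mdiffAt hU hx) (Y.mdiffAt hU hx)

/-- The Riemannian module of smooth vector fields on an open set with an orthonormal frame. -/
def riemannianModule [DecidableEq ι] :
    RiemannianModule (SmoothFunction I U) (SmoothField I U) ι where
  g := smoothMetric
  e i := SmoothField.mk (e i) (he.contMDiffOn i)
  D := he.smoothDeriv hU
  nabla := he.smoothNabla hU
  g_comm X Y := SmoothFunction.eq_iff.2 fun x hx ↦ by
    rw [ext_smoothMetric hx, ext_smoothMetric hx, real_inner_comm]
  g_frame i j := SmoothFunction.eq_iff.2 fun x hx ↦ by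
    rw [ext_smoothMetric hx, SmoothField.mk_ext _ hx, SmoothField.mk_ext _ hx, he.inner_eq hx]
    split_ifs
    · rw [SmoothFunction.ext_one hx]
    · rw [SmoothFunction.ext_zero]
  sum_frame X := SmoothField.eq_iff.2 fun x hx ↦ by
    rw [← he.sum_inner_smul hx (X.ext x), SmoothField.ext_sum]
    simp only [SmoothField.ext_smul, Pi.smul_apply', ext_smoothMetric hx, SmoothField.mk_ext _ hx]
  nabla_smul X a Y := SmoothField.eq_iff.2 fun x hx ↦ by
    have h := (leviCivita I M).isCovariantDerivativeOnUniv.leibniz (Y.mdiffAt hU hx)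
      (a.mdiffAt hU hx) (Set.mem_univ x)
    rw [he.ext_smoothNabla hU hx, SmoothField.ext_smul, h, SmoothField.ext_add,
      SmoothField.ext_smul, SmoothField.ext_smul, Pi.add_apply, Pi.smul_apply', Pi.smul_apply',
      he.ext_smoothNabla hU hx, he.ext_smoothDeriv hU hx]
    rfl
  nabla_metric X Y Z := SmoothFunction.eq_iff.2 fun x hx ↦ by
    rw [he.ext_smoothDeriv hU hx, mvfderiv_congr (ext_smoothMetric_eventuallyEq hU hx Y Z),
      leviCivita_metric (X.mdiffAt hU hx) (Y.mdiffAt hU hx) (Z.mdiffAt hU hx),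
      SmoothFunction.ext_add, Pi.add_apply, ext_smoothMetric hx, ext_smoothMetric hx,
      he.ext_smoothNabla hU hx, he.ext_smoothNabla hU hx]
  D_bracket X Y a := SmoothFunction.eq_iff.2 fun x hx ↦ by
    rw [he.smoothNabla_sub hU, SmoothFunction.ext_sub, Pi.sub_apply, he.ext_smoothDeriv hU hx,
      he.ext_smoothDeriv hU hx, he.ext_smoothDeriv hU hx,
      mvfderiv_congr (he.ext_smoothDeriv_eventuallyEq hU hx X a),
      mvfderiv_congr (he.ext_smoothDeriv_eventuallyEq hU hx Y a), SmoothField.mk_ext _ hx]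
    exact he.mvfderiv_mlieBracket hU a.contMDiffOn_ext X.contMDiffOn_ext Y.contMDiffOn_ext hx
  jacobi X Y Z := SmoothField.eq_iff.2 fun x hx ↦ by
    have hs (W : SmoothField I U) :
        ContMDiffAt I I.tangent (minSmoothness ℝ 2) (T% W.ext) x := by
      rw [minSmoothness_of_isRCLikeNormedField]
      exact (W.contMDiffOn_ext.contMDiffAt (hU.mem_nhds hx)).of_le ENat.LEInfty.out
    have e (X Y : SmoothField I U) := SmoothField.ext_mk hU
      (contMDiffOn_mlieBracket hU X.contMDiffOn_ext Y.contMDiffOn_ext) hx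
    simp only [he.smoothNabla_sub hU]
    rw [SmoothField.ext_add, Pi.add_apply, SmoothField.mk_ext _ hx, SmoothField.mk_ext _ hx,
      SmoothField.mk_ext _ hx,
      Filter.EventuallyEq.mlieBracket_vectorField_eq (.refl _ X.ext) (e Y Z),
      Filter.EventuallyEq.mlieBracket_vectorField_eq (e X Y) (.refl _ Z.ext),
      Filter.EventuallyEq.mlieBracket_vectorField_eq (.refl _ Y.ext) (e X Z)]
    exact leibniz_identity_mlieBracket_apply (hs X) (hs Y) (hs Z)

end IsOrthonormalFrameOn

end

/-! ### Pointwise curvature and traces compared with those of the module. -/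

noncomputable section

variable {E : Type*} [NormedAddCommGroup E] [NormedSpace ℝ E] [FiniteDimensional ℝ E]
  [CompleteSpace E] {H : Type*} [TopologicalSpace H] {I : ModelWithCorners ℝ E H}
  {M : Type*} [TopologicalSpace M] [ChartedSpace H M] [IsManifold I ∞ M]
  [RiemannianBundle (fun x : M ↦ TangentSpace I x)]
  [IsContMDiffRiemannianBundle I ∞ E (fun x : M ↦ TangentSpace I x)]
  {U U' : Set M}

theorem SmoothField.ext_zero_smul {a : SmoothFunction I U} {x : M} (h : a.ext x = 0)
    (X : SmoothField I U) : (a • X).ext x = 0 := by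
  rw [SmoothField.ext_smul, Pi.smul_apply', h, zero_smul]

namespace IsOrthonormalFrameOn

variable {ι : Type*} [Fintype ι] [Nonempty ι] {e : ι → Π x : M, TangentSpace I x}

theorem mono (he : IsOrthonormalFrameOn e U) (h : U' ⊆ U) : IsOrthonormalFrameOn e U' where
  contMDiffOn i := (he.contMDiffOn i).mono h
  orthonormal x hx := he.orthonormal x (h hx)
  card_eq := he.card_eq

variable [DecidableEq ι] (he : IsOrthonormalFrameOn e U) (hU : IsOpen U)

theorem ext_frame {x : M} (hx : x ∈ U) (i : ι) : ((he.riemannianModule hU).e i).ext x = e i x :=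
  SmoothField.mk_ext (he.contMDiffOn i) hx

theorem ext_g {x : M} (hx : x ∈ U) (X Y : SmoothField I U) :
    ((he.riemannianModule hU).g X Y).ext x = ⟪X.ext x, Y.ext x⟫ := ext_smoothMetric hx X Y

include he hU in
/-- A linear operation on fields is determined pointwise. -/
theorem map_ext_eq_zero (T : SmoothField I U →ₗ[SmoothFunction I U] SmoothField I U)
    {X : SmoothField I U} {x : M} (hx : x ∈ U) (h : X.ext x = 0) : (T X).ext x = 0 := by
  rw [← (he.riemannianModule hU).sum_frame X, map_sum, SmoothField.ext_sum]
  refine Finset.sum_eq_zero fun i _ ↦ ?_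
  rw [map_smul]
  refine SmoothField.ext_zero_smul ?_ _
  rw [he.ext_g hU hx, h, inner_zero_left]

include he hU in
theorem map_ext_congr (T : SmoothField I U →ₗ[SmoothFunction I U] SmoothField I U)
    {X X' : SmoothField I U} {x : M} (hx : x ∈ U) (h : X.ext x = X'.ext x) :
    (T X).ext x = (T X').ext x := by
  have := he.map_ext_eq_zero hU T (X := X - X') hx (by
    rw [SmoothField.ext_sub, Pi.sub_apply, h, sub_self])
  rw [map_sub, SmoothField.ext_sub, Pi.sub_apply] at this
  exact sub_eq_zero.1 this

theorem curv_ext_congr {X X' Y Y' Z Z' : SmoothField I U} {x : M} (hx : x ∈ U)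
    (hX : X.ext x = X'.ext x) (hY : Y.ext x = Y'.ext x) (hZ : Z.ext x = Z'.ext x) :
    ((he.riemannianModule hU).curv X Y Z).ext x
      = ((he.riemannianModule hU).curv X' Y' Z').ext x := by
  set C := he.riemannianModule hU
  rw [he.map_ext_congr hU (C.curv X Y) hx hZ]
  refine (he.map_ext_congr hU ((C.curv X).flip Z') hx hY).trans ?_
  exact he.map_ext_congr hU ((C.curv.flip Y').flip Z') hx hX

theorem curvatureField_eq {X Y Z : Π x : M, TangentSpace I x}
    (hX : ContMDiffOn I I.tangent ∞ (T% X) U) (hY : ContMDiffOn I I.tangent ∞ (T% Y) U)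
    (hZ : ContMDiffOn I I.tangent ∞ (T% Z) U) {x : M} (hx : x ∈ U) :
    curvatureField X Y Z x = ((he.riemannianModule hU).curv (SmoothField.mk X hX)
      (SmoothField.mk Y hY) (SmoothField.mk Z hZ)).ext x := by
  have key {X Y Z : Π x : M, TangentSpace I x}
      (hX : ContMDiffOn I I.tangent ∞ (T% X) U) (hY : ContMDiffOn I I.tangent ∞ (T% Y) U)
      (hZ : ContMDiffOn I I.tangent ∞ (T% Z) U) :
      (he.smoothNabla hU (SmoothField.mk X hX) (he.smoothNabla hU (SmoothField.mk Y hY)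
        (SmoothField.mk Z hZ))).ext x
        = leviCivita I M (fun y ↦ leviCivita I M Z y (Y y)) x (X x) := by
    rw [he.ext_smoothNabla hU hx, SmoothField.mk_ext _ hx,
      leviCivita_congr (SmoothField.mdiffAt hU _ hx)]
    filter_upwards [hU.mem_nhds hx] with y hy
    rw [he.ext_smoothNabla hU hy, SmoothField.mk_ext _ hy,
      leviCivita_congr (SmoothField.mdiffAt hU _ hy) (SmoothField.ext_mk hU _ hy)]
  have h := (he.riemannianModule hU).curv_apply (SmoothField.mk X hX)
      (SmoothField.mk Y hY) (SmoothField.mk Z hZ)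
  rw [h]
  change _ = (he.smoothNabla hU _ (he.smoothNabla hU _ _)
    - he.smoothNabla hU _ (he.smoothNabla hU _ _)
    - he.smoothNabla hU (he.smoothNabla hU _ _ - he.smoothNabla hU _ _) _).ext x
  rw [SmoothField.ext_sub, SmoothField.ext_sub, Pi.sub_apply, Pi.sub_apply, key, key,
    he.smoothNabla_sub hU, he.ext_smoothNabla hU hx, SmoothField.mk_ext _ hx,
    leviCivita_congr (SmoothField.mdiffAt hU _ hx) (SmoothField.ext_mk hU _ hx),
    Filter.EventuallyEq.mlieBracket_vectorField_eq (SmoothField.ext_mk hU hX hx)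
      (SmoothField.ext_mk hU hY hx)]
  rfl

/-- The extensions defining `curvature` are smooth only near `x`. On a common neighbourhood inside
`U` both sides are curvatures in one module, where tensoriality leaves only the values at `x`. -/
theorem curvature_eq (X Y Z : SmoothField I U) {x : M} (hx : x ∈ U) :
    curvature x (X.ext x) (Y.ext x) (Z.ext x) = ((he.riemannianModule hU).curv X Y Z).ext x := by
  obtain ⟨s₁, hs₁, h₁⟩ := exists_contMDiffOn_extend (k := ∞) I E (X.ext x)
  obtain ⟨s₂, hs₂, h₂⟩ := exists_contMDiffOn_extend (k := ∞) I E (Y.ext x)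
  obtain ⟨s₃, hs₃, h₃⟩ := exists_contMDiffOn_extend (k := ∞) I E (Z.ext x)
  obtain ⟨V, hV, hVo, hxV⟩ := mem_nhds_iff.1
    (Filter.inter_mem (Filter.inter_mem hs₁ hs₂) (Filter.inter_mem hs₃ (hU.mem_nhds hx)))
  have hVU : V ⊆ U := fun y hy ↦ (hV hy).2.2
  have h1 := h₁.mono fun y hy ↦ (hV hy).1.1
  have h2 := h₂.mono fun y hy ↦ (hV hy).1.2
  have h3 := h₃.mono fun y hy ↦ (hV hy).2.1
  have e1 := (he.mono hVU).curvatureField_eq hVo h1 h2 h3 hxV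
  have e2 := (he.mono hVU).curvatureField_eq hVo (X.contMDiffOn_ext.mono hVU)
    (Y.contMDiffOn_ext.mono hVU) (Z.contMDiffOn_ext.mono hVU) hxV
  have e3 := he.curvatureField_eq hU X.contMDiffOn_ext Y.contMDiffOn_ext Z.contMDiffOn_ext hx
  have e4 (X : SmoothField I U) : SmoothField.mk X.ext X.contMDiffOn_ext = X :=
    SmoothField.eq_iff.2 fun y hy ↦ SmoothField.mk_ext _ hy
  rw [e4, e4, e4] at e3
  rw [curvature, ← e3, e2, e1]
  refine (he.mono hVU).curv_ext_congr hVo hxV ?_ ?_ ?_ <;>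
  rw [SmoothField.mk_ext _ hxV, SmoothField.mk_ext _ hxV, extend_apply_self]

/-- The field with constant coefficients with a given value at a point. -/
def constField (he : IsOrthonormalFrameOn e U) {x : M} (u : TangentSpace I x) : SmoothField I U :=
  SmoothField.mk (fun y ↦ ∑ i, (⟪u, e i x⟫ : ℝ) • e i y)
    (ContMDiffOn.sum_section fun i _ ↦ ContMDiffOn.const_smul_section (he.contMDiffOn i))

theorem ext_constField {x : M} (hx : x ∈ U) (u : TangentSpace I x) :
    (he.constField u).ext x = u := by
  rw [constField, SmoothField.mk_ext _ hx, he.sum_inner_smul hx]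

/-- The endomorphism of a tangent space induced by a linear operation on fields. -/
def endAt (he : IsOrthonormalFrameOn e U) (T : SmoothField I U →ₗ[SmoothFunction I U]
    SmoothField I U) (x : M) : TangentSpace I x →ₗ[ℝ] TangentSpace I x where
  toFun u := ∑ i, (⟪u, e i x⟫ : ℝ) • (T (SmoothField.mk (e i) (he.contMDiffOn i))).ext x
  map_add' u v := by simp [inner_add_left, add_smul, Finset.sum_add_distrib]
  map_smul' a u := by simp [inner_smul_left, mul_smul, Finset.smul_sum]

include hU in
theorem endAt_apply (T : SmoothField I U →ₗ[SmoothFunction I U] SmoothField I U) {x : M}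
    (hx : x ∈ U) (X : SmoothField I U) : he.endAt T x (X.ext x) = (T X).ext x := by
  conv_rhs => rw [← (he.riemannianModule hU).sum_frame X, map_sum, SmoothField.ext_sum]
  refine Finset.sum_congr rfl fun i _ ↦ ?_
  rw [map_smul, SmoothField.ext_smul, Pi.smul_apply', he.ext_g hU hx, he.ext_frame hU hx]
  rfl

/-- Traces on a tangent space are traces with respect to the frame. -/
theorem sum_inner_eq (T : SmoothField I U →ₗ[SmoothFunction I U] SmoothField I U) {x : M}
    (hx : x ∈ U) {κ : Type*} [Fintype κ] (b : OrthonormalBasis κ ℝ (TangentSpace I x)) :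
    ∑ j, (⟪(T (he.constField (b j))).ext x, b j⟫ : ℝ)
      = (∑ i, (he.riemannianModule hU).g (T ((he.riemannianModule hU).e i))
        ((he.riemannianModule hU).e i)).ext x := by
  have h1 := LinearMap.trace_eq_sum_inner (he.endAt T x) b
  have h2 := LinearMap.trace_eq_sum_inner (he.endAt T x) (he.basis hx)
  rw [h2] at h1
  rw [SmoothFunction.ext_sum]
  convert h1.symm using 2 with i _ i _
  · rw [real_inner_comm, ← he.endAt_apply hU T hx, he.ext_constField hx]
  · rw [he.ext_g hU hx, ← he.endAt_apply hU T hx, real_inner_comm, he.basis_apply,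
      he.ext_frame hU hx]

theorem ricci_eq (X Y : SmoothField I U) {x : M} (hx : x ∈ U) :
    ricci x (X.ext x) (Y.ext x) = ((he.riemannianModule hU).ric X Y).ext x := by
  have h := he.sum_inner_eq hU (((he.riemannianModule hU).curv.flip X).flip Y) hx
    (stdOrthonormalBasis ℝ (TangentSpace I x))
  simp only [LinearMap.flip_apply, ← he.curvature_eq hU _ _ _ hx, he.ext_constField hx] at h
  rw [RiemannianModule.ric_apply, ← h, ricci]

end IsOrthonormalFrameOn

end

/-! ### Weak metric f-structures and solitons in terms of Kenmotsu modules. -/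

noncomputable section

variable {E : Type*} [NormedAddCommGroup E] [NormedSpace ℝ E] [FiniteDimensional ℝ E]
  [CompleteSpace E] {H : Type*} [TopologicalSpace H] {I : ModelWithCorners ℝ E H}
  {M : Type*} [TopologicalSpace M] [ChartedSpace H M] [IsManifold I ∞ M]
  [RiemannianBundle (fun x : M ↦ TangentSpace I x)]
  [IsContMDiffRiemannianBundle I ∞ E (fun x : M ↦ TangentSpace I x)]
  {U : Set M}

namespace WeakMetricFStructure

variable {n s : ℕ} (S : WeakMetricFStructure I M n s)

theorem inner_ξ_ξ (x : M) (i j : Fin s) :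
    (⟪S.ξ i x, S.ξ j x⟫ : ℝ) = if i = j then 1 else 0 :=
  orthonormal_iff_ite.1 (S.ξ_orthonormal x) i j

/-- Compatibility of g with f gives ‖f ξ_i‖² = 1 - 1. -/
theorem f_ξ (x : M) (i : Fin s) : S.f x (S.ξ i x) = 0 := by
  have h := S.inner_f_f x (S.ξ i x) (S.ξ i x)
  rw [S.Q_ξ, S.inner_ξ_ξ] at h
  simp only [S.η_ξ] at h
  rw [← inner_self_eq_zero (𝕜 := ℝ), h]
  simp

theorem η_eq (x : M) (i : Fin s) (u : TangentSpace I x) : S.η i x u = ⟪u, S.ξ i x⟫ := by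
  have h := S.inner_f_f x u (S.ξ i x)
  rw [S.Q_ξ, S.f_ξ, inner_zero_right] at h
  simp only [S.η_ξ] at h
  simp only [mul_ite, mul_one, mul_zero, Finset.sum_ite_eq', Finset.mem_univ, if_true] at h
  linarith

theorem ηbar_eq (x : M) (u : TangentSpace I x) : S.ηbar x u = ⟪u, S.ξbar x⟫ := by
  simp [ηbar, ξbar, η_eq, inner_sum]

/-- If fu = 0, the formula for f² reads Qu = ∑ η^i(u) ξ_i, which is Q of the same sum; Q is
injective. -/
theorem eq_of_f_eq_zero {x : M} {u : TangentSpace I x} (h : S.f x u = 0) :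
    u = ∑ i, (⟪u, S.ξ i x⟫ : ℝ) • S.ξ i x := by
  have h1 := S.f_sq x u
  rw [h, map_zero] at h1
  refine (S.Q_nonsingular x).1 ?_
  simp only [map_sum, map_smul, S.Q_ξ, ← S.η_eq]
  rw [eq_comm, neg_add_eq_zero] at h1
  exact h1

theorem inner_f_ξ (x : M) (u : TangentSpace I x) (i : Fin s) : (⟪S.f x u, S.ξ i x⟫ : ℝ) = 0 := by
  rw [S.f_skew, S.f_ξ, inner_zero_right, neg_zero]

theorem contMDiffOn_f {X : Π x : M, TangentSpace I x} (hX : ContMDiffOn I I.tangent ∞ (T% X) U) :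
    ContMDiffOn I I.tangent ∞ (T% (fun x ↦ S.f x (X x))) U := fun x hx ↦
  ContMDiffWithinAt.clm_bundle_apply (IB := I) (F₁ := E) (F₂ := E)
    (E₁ := fun x : M ↦ TangentSpace I x) (E₂ := fun x : M ↦ TangentSpace I x) (b := fun y ↦ y)
    (S.smooth_f x).contMDiffWithinAt (hX x hx)

/-- The ξ_j-component of normality for the pair (ξ_k, Y). As f ξ_k = 0, the Nijenhuis torsion lies
in the range of f, which is orthogonal to ξ_j, and only dη^j remains. -/
theorem IsNormal.mvfderiv_sub_inner_mlieBracket {S : WeakMetricFStructure I M n s}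
    (hS : S.IsNormal) {Y : Π x : M, TangentSpace I x} {x : M}
    (hY : ContMDiffAt I I.tangent ∞ (T% Y) x) (j k : Fin s) :
    mvfderiv I (fun y ↦ ⟪Y y, S.ξ j y⟫) x (S.ξ k x) - ⟪mlieBracket I (S.ξ k) Y x, S.ξ j x⟫ = 0 := by
  have h := congrArg (fun u ↦ (⟪u, S.ξ j x⟫ : ℝ)) (hS x (S.ξ k) Y (S.smooth_ξ k x) hY)
  have h0 : (fun y ↦ S.f y (S.ξ k y)) = 0 := funext fun y ↦ S.f_ξ y k
  have h1 : mvfderiv I (fun y ↦ S.η j y (S.ξ k y)) x = 0 := by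
    simp only [S.η_ξ]
    exact mvfderiv_const _
  simp only [nijenhuis, h0, mlieBracket_zero_left, extDeriv₁, inner_add_left, inner_sub_left,
    S.inner_f_ξ, sum_inner, inner_smul_left, S.inner_ξ_ξ, inner_zero_left, Pi.zero_apply,
    mul_ite, mul_one, mul_zero, Finset.sum_ite_eq', Finset.mem_univ, if_true, h1] at h
  simp only [S.η_eq] at h
  simp at h
  linarith

end WeakMetricFStructure

/-- The constant smooth functions. -/
def SmoothFunction.const (I : ModelWithCorners ℝ E H) (U : Set M) (c : ℝ) : SmoothFunction I U :=
  SmoothFunction.mk (fun _ ↦ c) contMDiffOn_const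

theorem SmoothFunction.ext_const (c : ℝ) {x : M} (hx : x ∈ U) :
    (SmoothFunction.const I U c).ext x = c := SmoothFunction.mk_ext _ hx

theorem SmoothFunction.ext_natCast (k : ℕ) {x : M} (hx : x ∈ U) :
    ((k : SmoothFunction I U)).ext x = k := zeroExt_of_mem _ hx

theorem SmoothFunction.ext_two {x : M} (hx : x ∈ U) :
    (2 : SmoothFunction I U).ext x = 2 := by
  exact_mod_cast SmoothFunction.ext_natCast (I := I) 2 hx

theorem SmoothFunction.ext_add_apply (a b : SmoothFunction I U) (x : M) :
    (a + b).ext x = a.ext x + b.ext x := by rw [ext_add, Pi.add_apply]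

theorem SmoothFunction.ext_sub_apply (a b : SmoothFunction I U) (x : M) :
    (a - b).ext x = a.ext x - b.ext x := by rw [ext_sub, Pi.sub_apply]

theorem SmoothFunction.ext_neg_apply (a : SmoothFunction I U) (x : M) :
    (-a).ext x = -a.ext x := by
  rw [← zero_sub, ext_sub_apply, ext_zero, zero_sub]

theorem SmoothFunction.ext_mul_apply (a b : SmoothFunction I U) (x : M) :
    (a * b).ext x = a.ext x * b.ext x := by rw [ext_mul]

theorem SmoothFunction.ext_sq_apply (a : SmoothFunction I U) (x : M) :
    (a ^ 2).ext x = a.ext x ^ 2 := by rw [sq, ext_mul, sq]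

theorem SmoothField.ext_add_apply (X Y : SmoothField I U) (x : M) :
    (X + Y).ext x = X.ext x + Y.ext x := by rw [ext_add, Pi.add_apply]

theorem SmoothField.ext_sub_apply (X Y : SmoothField I U) (x : M) :
    (X - Y).ext x = X.ext x - Y.ext x := by rw [ext_sub, Pi.sub_apply]

theorem SmoothField.ext_smul_apply (a : SmoothFunction I U) (X : SmoothField I U) (x : M) :
    (a • X).ext x = a.ext x • X.ext x := by rw [ext_smul, Pi.smul_apply']

theorem SmoothFunction.isUnit {a : SmoothFunction I U} (h : ∀ x ∈ U, a.ext x ≠ 0) : IsUnit a := by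
  refine IsUnit.of_mul_eq_one (SmoothFunction.mk _ (a.contMDiffOn_ext.inv₀ h))
    (SmoothFunction.eq_iff.2 fun x hx ↦ ?_)
  rw [ext_mul_apply, mk_ext _ hx, ext_one hx]
  exact mul_inv_cancel₀ (h x hx)

namespace IsOrthonormalFrameOn

variable {ι : Type*} [Fintype ι] [Nonempty ι] {e : ι → Π x : M, TangentSpace I x}
  [DecidableEq ι] (he : IsOrthonormalFrameOn e U) (hU : IsOpen U)

theorem smoothDeriv_const (X : SmoothField I U) (c : ℝ) :
    he.smoothDeriv hU X (SmoothFunction.const I U c) = 0 :=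
  SmoothFunction.eq_iff.2 fun x hx ↦ by
    rw [he.ext_smoothDeriv hU hx, SmoothFunction.const,
      mvfderiv_congr (SmoothFunction.ext_mk hU _ hx), mvfderiv_const, SmoothFunction.ext_zero]
    rfl

variable {n s : ℕ} (S : WeakMetricFStructure I M n s)

/-- The action of `f` on smooth vector fields. -/
def smoothEnd (U : Set M) : SmoothField I U →ₗ[SmoothFunction I U] SmoothField I U where
  toFun X := SmoothField.mk (fun x ↦ S.f x (X.ext x)) (S.contMDiffOn_f X.contMDiffOn_ext)
  map_add' X Y := SmoothField.eq_iff.2 fun x hx ↦ by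
    simp [SmoothField.mk_ext _ hx, SmoothField.ext_add]
  map_smul' a X := SmoothField.eq_iff.2 fun x hx ↦ by
    simp [SmoothField.mk_ext _ hx, SmoothField.ext_smul]

theorem ext_smoothEnd {x : M} (hx : x ∈ U) (X : SmoothField I U) :
    (smoothEnd S U X).ext x = S.f x (X.ext x) := SmoothField.mk_ext _ hx

theorem ext_smoothEnd_eventuallyEq (hU : IsOpen U) {x : M} (hx : x ∈ U) (X : SmoothField I U) :
    (smoothEnd S U X).ext =ᶠ[nhds x] fun y ↦ S.f y (X.ext y) := SmoothField.ext_mk hU _ hx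

/-- The characteristic fields on an open set. -/
def smoothξ (U : Set M) (i : Fin s) : SmoothField I U :=
  SmoothField.mk (S.ξ i) (S.smooth_ξ i).contMDiffOn

theorem ext_smoothξ {x : M} (hx : x ∈ U) (i : Fin s) :
    (smoothξ S U i).ext x = S.ξ i x := SmoothField.mk_ext (S.smooth_ξ i).contMDiffOn hx

theorem ext_smoothξ_eventuallyEq (hU : IsOpen U) {x : M} (hx : x ∈ U) (i : Fin s) :
    (smoothξ S U i).ext =ᶠ[nhds x] S.ξ i := SmoothField.ext_mk hU (S.smooth_ξ i).contMDiffOn hx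

/-- The algebraic data of a weak `βf`-Kenmotsu manifold on an open set. -/
def kenmotsuModule (hd : Module.finrank ℝ E = 2 * n + s) (hnormal : 1 < s → S.IsNormal)
    {β : ℝ} (hβ : β ≠ 0) (hK : S.IsWeakKenmotsu fun _ ↦ β) :
    KenmotsuModule (SmoothFunction I U) (SmoothField I U) ι n s where
  toRiemannianModule := he.riemannianModule hU
  isUnit_natCast k hk := SmoothFunction.isUnit fun x hx ↦ by
    rw [SmoothFunction.ext_natCast k hx]
    exact_mod_cast hk
  card_eq := he.card_eq.trans hd
  f := smoothEnd S U
  ξ := smoothξ S U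
  β := SmoothFunction.const I U β
  D_β X := he.smoothDeriv_const hU X β
  isUnit_β := SmoothFunction.isUnit fun x hx ↦ by rwa [SmoothFunction.ext_const β hx]
  f_skew X Y := SmoothFunction.eq_iff.2 fun x hx ↦ by
    rw [SmoothFunction.ext_neg_apply, he.ext_g hU hx, he.ext_g hU hx,
      ext_smoothEnd S hx, ext_smoothEnd S hx, S.f_skew]
  g_ξ i j := SmoothFunction.eq_iff.2 fun x hx ↦ by
    rw [he.ext_g hU hx, ext_smoothξ S hx, ext_smoothξ S hx, S.inner_ξ_ξ]
    split_ifs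
    · rw [SmoothFunction.ext_one hx]
    · rw [SmoothFunction.ext_zero]
  f_ξ i := SmoothField.eq_iff.2 fun x hx ↦ by
    rw [ext_smoothEnd S hx, ext_smoothξ S hx, S.f_ξ, SmoothField.ext_zero]
    rfl
  eq_of_f_eq_zero X h := SmoothField.eq_iff.2 fun x hx ↦ by
    have h1 := SmoothField.eq_iff.1 h x hx
    rw [ext_smoothEnd S hx, SmoothField.ext_zero] at h1
    rw [SmoothField.ext_sum]
    refine (S.eq_of_f_eq_zero h1).trans (Finset.sum_congr rfl fun i _ ↦ ?_)
    rw [SmoothField.ext_smul_apply, he.ext_g hU hx, ext_smoothξ S hx]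
  nabla_f X Y := SmoothField.eq_iff.2 fun x hx ↦ by
    have h := hK.2 x (X.ext x) Y.ext (Y.contMDiffOn_ext.contMDiffAt (hU.mem_nhds hx))
    change (he.smoothNabla hU X _).ext x = (smoothEnd S U (he.smoothNabla hU X Y) + _).ext x
    have hξ : (∑ i, smoothξ S U i).ext x = S.ξbar x := by
      rw [SmoothField.ext_sum, WeakMetricFStructure.ξbar]
      simp only [ext_smoothξ S hx]
    rw [he.ext_smoothNabla hU hx, leviCivita_congr (SmoothField.mdiffAt hU _ hx)
      (ext_smoothEnd_eventuallyEq S hU hx Y), SmoothField.ext_add_apply,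
      ext_smoothEnd S hx, he.ext_smoothNabla hU hx, SmoothField.ext_smul_apply,
      SmoothField.ext_sub_apply, SmoothField.ext_smul_apply, SmoothField.ext_smul_apply,
      he.ext_g hU hx, he.ext_g hU hx, hξ, ext_smoothEnd S hx, SmoothFunction.ext_const β hx,
      ← S.ηbar_eq, ← h]
    abel
  normal hs j k Y := SmoothFunction.eq_iff.2 fun x hx ↦ by
    have h := (hnormal hs).mvfderiv_sub_inner_mlieBracket
      (Y.contMDiffOn_ext.contMDiffAt (hU.mem_nhds hx)) j k
    change (he.smoothDeriv hU (smoothξ S U k) _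
      - smoothMetric (he.smoothNabla hU _ Y - he.smoothNabla hU Y _) _).ext x = _
    rw [he.smoothNabla_sub hU, SmoothFunction.ext_sub_apply, he.ext_smoothDeriv hU hx,
      ext_smoothMetric hx, SmoothField.mk_ext _ hx, ext_smoothξ S hx, ext_smoothξ S hx,
      Filter.EventuallyEq.mlieBracket_vectorField_eq
        (ext_smoothξ_eventuallyEq S hU hx k) (.refl _ Y.ext),
      SmoothFunction.ext_zero, ← h]
    congr 2
    refine mvfderiv_congr ?_
    filter_upwards [hU.mem_nhds hx] with y hy
    rw [he.ext_g hU hy, ext_smoothξ S hy]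

end IsOrthonormalFrameOn

/-- The cube of a skew-symmetric endomorphism of a three-dimensional space. -/
theorem cube_of_skew {V : Type*} [NormedAddCommGroup V] [InnerProductSpace ℝ V]
    (b : OrthonormalBasis (Fin 3) ℝ V) (f : V →ₗ[ℝ] V) (hf : ∀ u v, ⟪f u, v⟫ = -⟪u, f v⟫) (u : V) :
    f (f (f u)) = -((1 / 2 : ℝ) * ∑ i, ⟪f (b i), f (b i)⟫) • f u := by
  have hs (i j) : ⟪f (b i), b j⟫ = -⟪f (b j), b i⟫ := by rw [hf, real_inner_comm]
  have h0 : ∀ i, ⟪f (b i), b i⟫ = 0 := fun i ↦ by linarith [hs i i]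
  have hr (v : V) : v = ⟪v, b 0⟫ • b 0 + ⟪v, b 1⟫ • b 1 + ⟪v, b 2⟫ • b 2 := by
    conv_lhs => rw [← b.sum_repr' v, Fin.sum_univ_three]
    simp only [real_inner_comm]
  -- A skew map in dimension three is the cross product with a vector whose coordinates are, up to
  -- sign, `p`, `q`, `r`; its cube is minus the squared length of that vector times the map.
  obtain ⟨p, hp⟩ : ∃ p, p = ⟪f (b 0), b 1⟫ := ⟨_, rfl⟩
  obtain ⟨q, hq⟩ : ∃ q, q = ⟪f (b 0), b 2⟫ := ⟨_, rfl⟩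
  obtain ⟨r, hr'⟩ : ∃ r, r = ⟪f (b 1), b 2⟫ := ⟨_, rfl⟩
  have e0 : f (b 0) = p • b 1 + q • b 2 := by
    conv_lhs => rw [hr (f (b 0)), h0, ← hp, ← hq]
    module
  have e1 : f (b 1) = -p • b 0 + r • b 2 := by
    conv_lhs => rw [hr (f (b 1)), h0, hs 1 0, ← hp, ← hr']
    module
  have e2 : f (b 2) = -q • b 0 - r • b 1 := by
    conv_lhs => rw [hr (f (b 2)), h0, hs 2 0, hs 2 1, ← hq, ← hr']
    module
  have hn : (1 / 2 : ℝ) * ∑ i, ⟪f (b i), f (b i)⟫ = p ^ 2 + q ^ 2 + r ^ 2 := by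
    have hb := orthonormal_iff_ite.1 b.orthonormal
    rw [Fin.sum_univ_three, e0, e1, e2]
    simp only [inner_add_left, inner_add_right, inner_sub_left, inner_sub_right, inner_smul_left,
      inner_smul_right, hb]
    simp
    ring
  rw [hn, hr u]
  simp only [map_add, map_smul, map_sub, e0, e1, e2]
  module

namespace IsOrthonormalFrameOn

variable {ι : Type*} [Fintype ι] [Nonempty ι] {e : ι → Π x : M, TangentSpace I x}
  [DecidableEq ι] (he : IsOrthonormalFrameOn e U) (hU : IsOpen U)
  {n s : ℕ} (S : WeakMetricFStructure I M n s)
  (hd : Module.finrank ℝ E = 2 * n + s) (hnormal : 1 < s → S.IsNormal)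
  {β : ℝ} (hβ : β ≠ 0) (hK : S.IsWeakKenmotsu fun _ ↦ β)

theorem ext_ξs {x : M} (hx : x ∈ U) :
    (he.kenmotsuModule hU S hd hnormal hβ hK).ξs.ext x = S.ξbar x := by
  rw [KenmotsuModule.ξs, SmoothField.ext_sum, WeakMetricFStructure.ξbar]
  exact Finset.sum_congr rfl fun i _ ↦ ext_smoothξ S hx i

theorem ext_g_proj {x : M} (hx : x ∈ U) (X Y : SmoothField I U) :
    ((he.kenmotsuModule hU S hd hnormal hβ hK).g
      ((he.kenmotsuModule hU S hd hnormal hβ hK).proj X) Y).ext x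
      = ⟪X.ext x, Y.ext x⟫ - ∑ i, ⟪X.ext x, S.ξ i x⟫ * ⟪Y.ext x, S.ξ i x⟫ := by
  rw [KenmotsuModule.g_proj, SmoothFunction.ext_sub_apply, SmoothFunction.ext_sum]
  refine congrArg₂ _ (he.ext_g hU hx X Y) (Finset.sum_congr rfl fun i _ ↦ ?_)
  rw [SmoothFunction.ext_mul_apply]
  refine congrArg₂ _ ((he.ext_g hU hx X _).trans ?_) ((he.ext_g hU hx Y _).trans ?_) <;>
  exact congrArg _ (ext_smoothξ S hx i)

include he hU hd hnormal hβ hK in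
theorem ricci_ξ_ξ {x : M} (hx : x ∈ U) (i : Fin s) :
    ricci x (S.ξ i x) (S.ξ i x) = -(2 * n * β ^ 2) := by
  set C := he.kenmotsuModule hU S hd hnormal hβ hK with hC
  have h := he.ricci_eq hU (smoothξ S U i) (smoothξ S U i) hx
  rw [ext_smoothξ S hx] at h
  rw [h]
  change (C.ric (C.ξ i) (C.ξ i)).ext x = _
  rw [C.ric_ξ, C.g_ξ_ξs, SmoothFunction.ext_neg_apply, SmoothFunction.ext_mul_apply,
    SmoothFunction.ext_mul_apply, SmoothFunction.ext_mul_apply, SmoothFunction.ext_sq_apply,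
    SmoothFunction.ext_two hx, SmoothFunction.ext_natCast _ hx, SmoothFunction.ext_one hx, mul_one]
  congr 3
  exact SmoothFunction.ext_const β hx

/-- The function `a + 2nsβ²`, which vanishes for solitons. -/
def coeff (U : Set M) (n s : ℕ) (β : ℝ) {a : M → ℝ} (ha : ContMDiff I 𝓘(ℝ, ℝ) ∞ a) :
    SmoothFunction I U :=
  SmoothFunction.mk (fun x ↦ a x + 2 * n * s * β ^ 2) (ha.add contMDiff_const).contMDiffOn

theorem ext_coeff {a : M → ℝ} (ha : ContMDiff I 𝓘(ℝ, ℝ) ∞ a) {x : M} (hx : x ∈ U) :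
    (coeff U n s β ha).ext x = a x + 2 * n * s * β ^ 2 := SmoothFunction.mk_ext _ hx

theorem ric_eq {a b : M → ℝ} (hE : S.IsEtaEinstein a b) (hab : ∀ x, a x + b x = -(2 * n * β ^ 2))
    (X Y : SmoothField I U) :
    (he.kenmotsuModule hU S hd hnormal hβ hK).ric X Y
      = coeff U n s β hE.1 * (he.kenmotsuModule hU S hd hnormal hβ hK).g
        ((he.kenmotsuModule hU S hd hnormal hβ hK).proj X) Y
        - 2 * n * (he.kenmotsuModule hU S hd hnormal hβ hK).β ^ 2 *
          (s * (he.kenmotsuModule hU S hd hnormal hβ hK).g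
            ((he.kenmotsuModule hU S hd hnormal hβ hK).proj X) Y
          + (he.kenmotsuModule hU S hd hnormal hβ hK).g X
              (he.kenmotsuModule hU S hd hnormal hβ hK).ξs
            * (he.kenmotsuModule hU S hd hnormal hβ hK).g Y
              (he.kenmotsuModule hU S hd hnormal hβ hK).ξs) :=
  SmoothFunction.eq_iff.2 fun x hx ↦ by
    have h := hE.2.2 x (X.ext x) (Y.ext x)
    rw [he.ricci_eq hU X Y hx, hab] at h
    have hg (X Y : SmoothField I U) :
        ((he.kenmotsuModule hU S hd hnormal hβ hK).g X Y).ext x = ⟪X.ext x, Y.ext x⟫ :=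
      he.ext_g hU hx X Y
    have hb : (he.kenmotsuModule hU S hd hnormal hβ hK).β.ext x = β := SmoothFunction.ext_const β hx
    refine h.trans ?_
    rw [SmoothFunction.ext_sub_apply, SmoothFunction.ext_mul_apply, SmoothFunction.ext_mul_apply,
      SmoothFunction.ext_add_apply, SmoothFunction.ext_mul_apply, SmoothFunction.ext_mul_apply,
      SmoothFunction.ext_mul_apply, SmoothFunction.ext_mul_apply, SmoothFunction.ext_sq_apply,
      he.ext_g_proj hU S hd hnormal hβ hK hx, ext_coeff hE.1 hx, hg X, hg Y,
      ext_ξs _ _ _ _ _ _ _ hx, hb, SmoothFunction.ext_two hx, SmoothFunction.ext_natCast _ hx,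
      SmoothFunction.ext_natCast _ hx]
    simp only [S.η_eq, S.ηbar_eq]
    ring

theorem soliton_eq {a b : M → ℝ} (hE : S.IsEtaEinstein a b)
    (hab : ∀ x, a x + b x = -(2 * n * β ^ 2)) {V : Π x : M, TangentSpace I x} {lam mu : ℝ}
    (hV : S.IsStarEtaRicciSoliton V lam mu) (X Y : SmoothField I U) :
    (he.kenmotsuModule hU S hd hnormal hβ hK).g
        ((he.kenmotsuModule hU S hd hnormal hβ hK).nabla X (SmoothField.mk V hV.1.contMDiffOn)) Y
      + (he.kenmotsuModule hU S hd hnormal hβ hK).g X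
        ((he.kenmotsuModule hU S hd hnormal hβ hK).nabla Y (SmoothField.mk V hV.1.contMDiffOn))
      = 2 * (SmoothFunction.const I U lam * (he.kenmotsuModule hU S hd hnormal hβ hK).g
          ((he.kenmotsuModule hU S hd hnormal hβ hK).proj X) Y
        - (coeff U n s β hE.1 - s * (he.kenmotsuModule hU S hd hnormal hβ hK).β ^ 2)
          * (he.kenmotsuModule hU S hd hnormal hβ hK).g
            ((he.kenmotsuModule hU S hd hnormal hβ hK).f X)
            ((he.kenmotsuModule hU S hd hnormal hβ hK).f Y)
        + SmoothFunction.const I U (lam + mu)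
          * ((he.kenmotsuModule hU S hd hnormal hβ hK).g X
              (he.kenmotsuModule hU S hd hnormal hβ hK).ξs
            * (he.kenmotsuModule hU S hd hnormal hβ hK).g Y
              (he.kenmotsuModule hU S hd hnormal hβ hK).ξs)) :=
  SmoothFunction.eq_iff.2 fun x hx ↦ by
    have h := hV.2 x X.ext Y.ext (X.contMDiffOn_ext.contMDiffAt (hU.mem_nhds hx))
      (Y.contMDiffOn_ext.contMDiffAt (hU.mem_nhds hx))
    have hs := congrArg (fun a ↦ a.ext x)
      ((he.kenmotsuModule hU S hd hnormal hβ hK).sum_g_f_curv_of_etaEinstein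
      (he.ric_eq hU S hd hnormal hβ hK hE hab) X Y)
    have hg (X Y : SmoothField I U) :
        ((he.kenmotsuModule hU S hd hnormal hβ hK).g X Y).ext x = ⟪X.ext x, Y.ext x⟫ :=
      he.ext_g hU hx X Y
    have hb : (he.kenmotsuModule hU S hd hnormal hβ hK).β.ext x = β := SmoothFunction.ext_const β hx
    -- The trace in Ric* is moved from the standard basis at `x` to the frame, where `hs` evaluates
    -- it.
    have ht := he.sum_inner_eq hU
      (smoothEnd S U ∘ₗ (he.riemannianModule hU).curv X (smoothEnd S U Y))
      hx (stdOrthonormalBasis ℝ (TangentSpace I x))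
    simp only [LinearMap.comp_apply, ext_smoothEnd S hx, ← he.curvature_eq hU _ _ _ hx,
      he.ext_constField hx] at ht
    have hr : S.starRicci x (X.ext x) (Y.ext x) = _ :=
      congrArg (fun c ↦ (1 / 2 : ℝ) * c) (ht.trans hs)
    have hVX := hV.1.contMDiffAt (x := x) |>.mdifferentiableAt (by simp)
    -- Metricity and vanishing torsion turn the Lie derivative into the symmetrised ∇V.
    have hl : lieDerivMetric V X.ext Y.ext x
        = ⟪leviCivita I M V x (X.ext x), Y.ext x⟫ + ⟪X.ext x, leviCivita I M V x (Y.ext x)⟫ := by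
      rw [lieDerivMetric, leviCivita_metric hVX (X.mdiffAt hU hx) (Y.mdiffAt hU hx),
        ← leviCivita_sub_leviCivita hVX (X.mdiffAt hU hx),
        ← leviCivita_sub_leviCivita hVX (Y.mdiffAt hU hx), inner_sub_left, inner_sub_right]
      ring
    have hn (X : SmoothField I U) : ((he.kenmotsuModule hU S hd hnormal hβ hK).nabla X
        (SmoothField.mk V hV.1.contMDiffOn)).ext x = leviCivita I M V x (X.ext x) := by
      refine (he.ext_smoothNabla hU hx X _).trans ?_
      rw [leviCivita_congr (SmoothField.mdiffAt hU _ hx)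
        (SmoothField.ext_mk hU hV.1.contMDiffOn hx)]
    rw [hr, hl] at h
    simp only [SmoothFunction.ext_add_apply, SmoothFunction.ext_sub_apply,
      SmoothFunction.ext_mul_apply, SmoothFunction.ext_sq_apply, hb, SmoothFunction.ext_two hx,
      SmoothFunction.ext_natCast _ hx, ext_coeff hE.1 hx, he.ext_g_proj hU S hd hnormal hβ hK hx,
      hg, ext_ξs _ _ _ _ _ _ _ hx, SmoothFunction.ext_const _ hx, hn, S.η_eq, S.ηbar_eq] at h ⊢
    linear_combination 2 * h

/-- The sum is |f|² at `x`; were it zero, f would vanish there, against rank 2n > 0. This is what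
allows |f|² to be cancelled from A |f|² = 0. -/
theorem ext_sum_g_f_f_ne_zero (hn : n ≠ 0) {x : M} (hx : x ∈ U) :
    (∑ i, (he.kenmotsuModule hU S hd hnormal hβ hK).g
      ((he.kenmotsuModule hU S hd hnormal hβ hK).f ((he.kenmotsuModule hU S hd hnormal hβ hK).e i))
      ((he.kenmotsuModule hU S hd hnormal hβ hK).f
        ((he.kenmotsuModule hU S hd hnormal hβ hK).e i))).ext x ≠ 0 := by
  have h (i) : ((he.kenmotsuModule hU S hd hnormal hβ hK).g
      ((he.kenmotsuModule hU S hd hnormal hβ hK).f ((he.kenmotsuModule hU S hd hnormal hβ hK).e i))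
      ((he.kenmotsuModule hU S hd hnormal hβ hK).f
        ((he.kenmotsuModule hU S hd hnormal hβ hK).e i))).ext x
      = ⟪S.f x (e i x), S.f x (e i x)⟫ := by
    refine (he.ext_g hU hx _ _).trans ?_
    have : ((he.kenmotsuModule hU S hd hnormal hβ hK).f
        ((he.kenmotsuModule hU S hd hnormal hβ hK).e i)).ext x = S.f x (e i x) :=
      (ext_smoothEnd S hx _).trans (congrArg _ (he.ext_frame hU hx i))
    rw [this]
  rw [SmoothFunction.ext_sum]
  simp only [h]
  intro h0
  have h1 := (Finset.sum_eq_zero_iff_of_nonneg fun i _ ↦ real_inner_self_nonneg).1 h0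
  have h2 : (S.f x).toLinearMap = 0 := by
    refine (he.basis hx).toBasis.ext fun i ↦ ?_
    have := inner_self_eq_zero.1 (h1 i (Finset.mem_univ i))
    simpa [he.basis_apply hx] using this
  have h3 := S.f_rank x
  rw [h2, LinearMap.range_zero, finrank_bot] at h3
  omega

end IsOrthonormalFrameOn

namespace IsOrthonormalFrameOn

section Horizontal

variable {ι : Type*} [Fintype ι] [Nonempty ι] {e : ι → Π x : M, TangentSpace I x}
  (he : IsOrthonormalFrameOn e U) (hU : IsOpen U)
  {n s : ℕ} (S : WeakMetricFStructure I M n s)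
  (hd : Module.finrank ℝ E = 2 * n + s) (hnormal : 1 < s → S.IsNormal)
  {β : ℝ} (hβ : β ≠ 0) (hK : S.IsWeakKenmotsu fun _ ↦ β)
  {a b : M → ℝ} (hE : S.IsEtaEinstein a b)
  (hab : ∀ x, a x + b x = -(2 * n * β ^ 2)) {V : Π x : M, TangentSpace I x} {lam mu : ℝ}
  (hV : S.IsStarEtaRicciSoliton V lam mu)

include he hU hd hnormal hβ hK hE hab hV

theorem add_eq_zero_of_horizontal (hn : n ≠ 0) (i : Fin s) (hVD : ∀ x, S.η i x (V x) = 0) {x : M}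
    (hx : x ∈ U) : a x + 2 * n * s * β ^ 2 = 0 := by
  classical
  have hVξ : (he.kenmotsuModule hU S hd hnormal hβ hK).g (SmoothField.mk V hV.1.contMDiffOn)
      ((he.kenmotsuModule hU S hd hnormal hβ hK).ξ i) = 0 := SmoothFunction.eq_iff.2 fun y hy ↦ by
    refine (he.ext_g hU hy _ _).trans ?_
    rw [SmoothField.mk_ext _ hy, SmoothFunction.ext_zero, ← hVD y, S.η_eq]
    exact congrArg _ (ext_smoothξ S hy i)
  have h := (he.kenmotsuModule hU S hd hnormal hβ hK).mul_sum_g_f_f_eq_zero_of_horizontal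
    (he.ric_eq hU S hd hnormal hβ hK hE hab) (fun X ↦ he.smoothDeriv_const hU X lam)
    (fun X ↦ he.smoothDeriv_const hU X (lam + mu))
    (he.soliton_eq hU S hd hnormal hβ hK hE hab hV) hn i hVξ
  have h2 := congrArg (fun c ↦ c.ext x) h
  simp only [SmoothFunction.ext_mul_apply, SmoothFunction.ext_zero] at h2
  rw [← ext_coeff hE.1 hx]
  exact (mul_eq_zero.1 h2).resolve_right (he.ext_sum_g_f_f_ne_zero hU S hd hnormal hβ hK hn hx)

end Horizontal

section Single

variable {ι : Type*} [Fintype ι] [Nonempty ι] [DecidableEq ι] {e : ι → Π x : M, TangentSpace I x}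
  (he : IsOrthonormalFrameOn e U) (hU : IsOpen U)
  {n : ℕ} (S : WeakMetricFStructure I M n 1)
  (hd : Module.finrank ℝ E = 2 * n + 1) (hnormal : 1 < 1 → S.IsNormal)
  {β : ℝ} (hβ : β ≠ 0) (hK : S.IsWeakKenmotsu fun _ ↦ β)
  {a b : M → ℝ} (hE : S.IsEtaEinstein a b)
  (hab : ∀ x, a x + b x = -(2 * n * β ^ 2)) {V : Π x : M, TangentSpace I x} {lam mu : ℝ}
  (hV : S.IsStarEtaRicciSoliton V lam mu) (hA : ∀ x ∈ U, a x + 2 * n * (1 : ℕ) * β ^ 2 ≠ 0)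

/-- The horizontal gradient of `g(V, ξ)`. -/
def solitonGrad (he : IsOrthonormalFrameOn e U) (hU : IsOpen U)
    {n : ℕ} (S : WeakMetricFStructure I M n 1)
    (hd : Module.finrank ℝ E = 2 * n + 1) (hnormal : 1 < 1 → S.IsNormal)
    {β : ℝ} (hβ : β ≠ 0) (hK : S.IsWeakKenmotsu fun _ ↦ β) {V : Π x : M, TangentSpace I x}
    (hV : ContMDiff I I.tangent ∞ (T% V)) : SmoothField I U :=
  (he.kenmotsuModule hU S hd hnormal hβ hK).hgrad ((he.kenmotsuModule hU S hd hnormal hβ hK).g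
    (SmoothField.mk V hV.contMDiffOn) (he.kenmotsuModule hU S hd hnormal hβ hK).ξs)

/-- The value of the horizontal gradient depends only on the germ of the data. -/
theorem inner_ext_solitonGrad (hV : ContMDiff I I.tangent ∞ (T% V)) {x : M} (hx : x ∈ U)
    (u : TangentSpace I x) :
    ⟪(he.solitonGrad hU S hd hnormal hβ hK hV).ext x, u⟫
      = mvfderiv I (fun y ↦ ⟪V y, S.ξbar y⟫) x (u - ∑ i, (⟪u, S.ξ i x⟫ : ℝ) • S.ξ i x) := by
  have h := congrArg (fun c ↦ c.ext x) ((he.kenmotsuModule hU S hd hnormal hβ hK).g_hgrad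
    ((he.kenmotsuModule hU S hd hnormal hβ hK).g
    (SmoothField.mk V hV.contMDiffOn) (he.kenmotsuModule hU S hd hnormal hβ hK).ξs)
    (he.constField u))
  have h1 :=
    (he.ext_g hU hx (he.solitonGrad hU S hd hnormal hβ hK hV) (he.constField u)).symm.trans h
  rw [he.ext_constField hx] at h1
  rw [h1]
  refine (he.ext_smoothDeriv hU hx _ _).trans ?_
  rw [KenmotsuModule.proj_apply, SmoothField.ext_sub_apply, SmoothField.ext_sum,
    he.ext_constField hx]
  refine congr (congrArg DFunLike.coe (mvfderiv_congr (M := M) (I := I) (E := E) ?_))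
    (congrArg _ ?_)
  · filter_upwards [hU.mem_nhds hx] with y hy
    refine (he.ext_g hU hy _ _).trans ?_
    rw [SmoothField.mk_ext _ hy]
    exact congrArg _ (he.ext_ξs hU S hd hnormal hβ hK hy)
  · refine Finset.sum_congr rfl fun i _ ↦ ?_
    rw [SmoothField.ext_smul_apply]
    refine congrArg₂ _ ((he.ext_g hU hx _ _).trans ?_) (ext_smoothξ S hx i)
    rw [he.ext_constField hx]
    exact congrArg _ (ext_smoothξ S hx i)

include hE hab hV hA

theorem solitonGrad_ne_zero (hn : n ≠ 0) (hne : U.Nonempty) :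
    he.solitonGrad hU S hd hnormal hβ hK hV.1 ≠ 0 := by
  intro h0
  obtain ⟨x, hx⟩ := hne
  have h := (he.kenmotsuModule hU S hd hnormal hβ hK).mul_sum_g_f_f_eq_zero_of_hgrad
    (he.ric_eq hU S hd hnormal hβ hK hE hab) (fun X ↦ he.smoothDeriv_const hU X lam)
    (fun X ↦ he.smoothDeriv_const hU X (lam + mu))
    (he.soliton_eq hU S hd hnormal hβ hK hE hab hV) hn h0
  have h2 := congrArg (fun c ↦ c.ext x) h
  simp only [SmoothFunction.ext_mul_apply, SmoothFunction.ext_zero] at h2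
  refine mul_ne_zero ?_ (he.ext_sum_g_f_f_ne_zero hU S hd hnormal hβ hK hn hx) h2
  rw [ext_coeff hE.1 hx]
  exact hA x hx

theorem solitonGrad_eq_zero (hn : 2 ≤ n) : he.solitonGrad hU S hd hnormal hβ hK hV.1 = 0 :=
  (he.kenmotsuModule hU S hd hnormal hβ hK).hgrad_eq_zero
    (he.ric_eq hU S hd hnormal hβ hK hE hab) (fun X ↦ he.smoothDeriv_const hU X lam)
    (fun X ↦ he.smoothDeriv_const hU X (lam + mu))
    (he.soliton_eq hU S hd hnormal hβ hK hE hab hV) hn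
    (SmoothFunction.isUnit fun x hx ↦ by rw [ext_coeff hE.1 hx]; exact hA x hx)

end Single

section Surface

variable {ι : Type*} [Fintype ι] [Nonempty ι] [DecidableEq ι] {e : ι → Π x : M, TangentSpace I x}
  (he : IsOrthonormalFrameOn e U) (hU : IsOpen U) (S : WeakMetricFStructure I M 1 1)
  (hd : Module.finrank ℝ E = 2 * 1 + 1) (hnormal : 1 < 1 → S.IsNormal)
  {β : ℝ} (hβ : β ≠ 0) (hK : S.IsWeakKenmotsu fun _ ↦ β)

/-- With p = |f|²/2, `cube_of_skew` gives f³ = -p f, so (f² + pP)X lies in the kernel of f. It is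
also orthogonal to ξ, which spans that kernel, and so vanishes. -/
theorem exists_f_f_eq : ∃ p : SmoothFunction I U, IsUnit p ∧
    ∀ X, (he.kenmotsuModule hU S hd hnormal hβ hK).f
      ((he.kenmotsuModule hU S hd hnormal hβ hK).f X)
      = -p • (he.kenmotsuModule hU S hd hnormal hβ hK).proj X := by
  set C := he.kenmotsuModule hU S hd hnormal hβ hK with hC
  set p : SmoothFunction I U := SmoothFunction.const I U (1 / 2) *
    ∑ i, C.g (C.f (C.e i)) (C.f (C.e i)) with hp
  have hp1 {x : M} (hx : x ∈ U) : p.ext x = (1 / 2 : ℝ) * ∑ i, ⟪S.f x (e i x), S.f x (e i x)⟫ := by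
    rw [hp, SmoothFunction.ext_mul_apply, SmoothFunction.ext_const _ hx, SmoothFunction.ext_sum]
    refine congrArg _ (Finset.sum_congr rfl fun i _ ↦ ?_)
    have hfe : (C.f (C.e i)).ext x = S.f x (e i x) :=
      (ext_smoothEnd S hx _).trans (congrArg _ (he.ext_frame hU hx i))
    refine (he.ext_g hU hx _ _).trans ?_
    rw [hfe]
  have h3 : ∀ X, C.f (C.f (C.f X)) = -p • C.f X := fun X ↦ SmoothField.eq_iff.2 fun x hx ↦ by
    have hcard : Fintype.card ι = 3 := he.card_eq.trans hd
    have h := cube_of_skew ((he.basis hx).reindex (Fintype.equivFinOfCardEq hcard))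
      (S.f x).toLinearMap (S.f_skew x) (X.ext x)
    have hsum := ((Fintype.equivFinOfCardEq hcard).symm.sum_comp
      fun i ↦ (⟪S.f x (e i x), S.f x (e i x)⟫ : ℝ))
    simp only [OrthonormalBasis.reindex_apply, he.basis_apply hx, ContinuousLinearMap.coe_coe] at h
    rw [hsum, ← hp1 hx] at h
    have hf (X) : (C.f X).ext x = S.f x (X.ext x) := ext_smoothEnd S hx X
    rw [SmoothField.ext_smul_apply, SmoothFunction.ext_neg_apply, hf, hf, hf]
    exact h
  refine ⟨p, SmoothFunction.isUnit fun x hx ↦ ?_, fun X ↦ ?_⟩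
  · rw [hp, SmoothFunction.ext_mul_apply, SmoothFunction.ext_const _ hx]
    exact mul_ne_zero (by norm_num)
      (he.ext_sum_g_f_f_ne_zero hU S hd hnormal hβ hK one_ne_zero hx)
  · have h4 := C.eq_of_f_eq_zero (C.f (C.f X) + p • C.proj X) (by
      rw [map_add, map_smul, C.f_proj, h3]
      exact (congrArg (· + p • C.f X) (neg_smul p (C.f X))).trans (neg_add_cancel _))
    simp only [map_add, map_smul, LinearMap.add_apply, LinearMap.smul_apply, C.g_f_ξ, C.g_proj_ξ,
      smul_zero, add_zero, zero_smul, Finset.sum_const_zero] at h4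
    exact (eq_neg_of_add_eq_zero_left h4).trans (neg_smul p (C.proj X)).symm

theorem false_of_solitonGrad_ne_zero {a b : M → ℝ} (hE : S.IsEtaEinstein a b)
    (hab : ∀ x, a x + b x = -(2 * (1 : ℕ) * β ^ 2)) {V : Π x : M, TangentSpace I x} {lam mu : ℝ}
    (hV : S.IsStarEtaRicciSoliton V lam mu)
    (hA : ∀ x ∈ U, a x + 2 * (1 : ℕ) * (1 : ℕ) * β ^ 2 ≠ 0) (hne : U.Nonempty)
    (hw : ∀ x ∈ U, (he.solitonGrad hU S hd hnormal hβ hK hV.1).ext x ≠ 0) : False := by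
  obtain ⟨p, hp, hf⟩ := he.exists_f_f_eq hU S hd hnormal hβ hK
  set C := he.kenmotsuModule hU S hd hnormal hβ hK with hC
  obtain ⟨x, hx⟩ := hne
  have : Nontrivial (SmoothFunction I U) := ⟨0, 1, fun h ↦ by
    have := congrArg (fun c ↦ c.ext x) h
    simp only [SmoothFunction.ext_zero, SmoothFunction.ext_one hx] at this
    exact zero_ne_one this⟩
  have h2 : IsUnit (2 : SmoothFunction I U) := by exact_mod_cast C.isUnit_natCast 2 two_ne_zero
  obtain ⟨τ, hτ⟩ := ((h2.mul C.isUnit_β).mul hp).exists_right_inv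
  refine C.false_of_isUnit_g_hgrad (SmoothFunction.isUnit fun x hx ↦ ?_)
    (he.ric_eq hU S hd hnormal hβ hK hE hab) (fun X ↦ he.smoothDeriv_const hU X lam)
    (fun X ↦ he.smoothDeriv_const hU X (lam + mu))
    (he.soliton_eq hU S hd hnormal hβ hK hE hab hV) hf hτ (SmoothFunction.isUnit fun x hx ↦ ?_)
  · rw [ext_coeff hE.1 hx]
    exact hA x hx
  · intro h
    exact hw x hx (inner_self_eq_zero.1 ((he.ext_g hU hx _ _).symm.trans h))

end Surface

end IsOrthonormalFrameOn

end

/-! ### Passage from open sets to the manifold. -/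

noncomputable section

variable {E : Type*} [NormedAddCommGroup E] [NormedSpace ℝ E] [FiniteDimensional ℝ E]
  [CompleteSpace E] {H : Type*} [TopologicalSpace H] {I : ModelWithCorners ℝ E H}
  {M : Type*} [TopologicalSpace M] [ChartedSpace H M] [IsManifold I ∞ M]
  [RiemannianBundle (fun x : M ↦ TangentSpace I x)]
  [IsContMDiffRiemannianBundle I ∞ E (fun x : M ↦ TangentSpace I x)]

namespace WeakMetricFStructure

section

variable {n s : ℕ} {S : WeakMetricFStructure I M n s} {β : ℝ} {a b : M → ℝ}

theorem inner_ξbar_ξbar (S : WeakMetricFStructure I M n s) (x : M) :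
    (⟪S.ξbar x, S.ξbar x⟫ : ℝ) = s := by
  simp only [ξbar, sum_inner, inner_sum]
  simp [S.inner_ξ_ξ]

theorem IsEtaEinstein.ricci_ξ_ξ (hE : S.IsEtaEinstein a b) (x : M) (i : Fin s) :
    ricci x (S.ξ i x) (S.ξ i x) = a x + b x := by
  have h : S.ηbar x (S.ξ i x) = 1 := by simp [ηbar, S.η_ξ]
  rw [hE.2.2, h, S.inner_ξ_ξ]
  simp [S.η_ξ]

theorem IsEtaEinstein.add_eq (hE : S.IsEtaEinstein a b)
    (hd : Module.finrank ℝ E = 2 * n + s) (hs : 0 < s) (hnormal : 1 < s → S.IsNormal)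
    (hβ : β ≠ 0) (hK : S.IsWeakKenmotsu fun _ ↦ β) (x : M) : a x + b x = -(2 * n * β ^ 2) := by
  obtain ⟨U, hU, hx, e, he⟩ := exists_isOrthonormalFrameOn I x
  have : Nonempty (Fin (Module.finrank ℝ E)) := ⟨⟨0, by omega⟩⟩
  rw [← hE.ricci_ξ_ξ x ⟨0, hs⟩, he.ricci_ξ_ξ hU S hd hnormal hβ hK hx]

theorem IsEtaEinstein.scalarCurvature_eq (hE : S.IsEtaEinstein a b)
    (hd : Module.finrank ℝ E = 2 * n + s) (x : M) :
    scalarCurvature I x = 2 * n * a x + s * (a x + b x) := by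
  have hp (w : TangentSpace I x) : ∑ i, (⟪stdOrthonormalBasis ℝ (TangentSpace I x) i, w⟫ : ℝ)
      * ⟪stdOrthonormalBasis ℝ (TangentSpace I x) i, w⟫ = ⟪w, w⟫ := by
    rw [← (stdOrthonormalBasis ℝ (TangentSpace I x)).sum_inner_mul_inner w w]
    simp only [real_inner_comm]
  have h1 (i) : (⟪stdOrthonormalBasis ℝ (TangentSpace I x) i,
      stdOrthonormalBasis ℝ (TangentSpace I x) i⟫ : ℝ) = 1 := by simp
  have hd' : Module.finrank ℝ (TangentSpace I x) = 2 * n + s := hd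
  simp only [scalarCurvature, hE.2.2, S.η_eq, S.ηbar_eq, Finset.sum_add_distrib,
    Finset.sum_sub_distrib, ← Finset.mul_sum, h1]
  rw [Finset.sum_comm]
  simp only [hp, S.inner_ξbar_ξbar, S.inner_ξ_ξ]
  simp [hd']
  ring

theorem IsStarEtaRicciSoliton.add_eq_zero_of_horizontal {V : Π x : M, TangentSpace I x}
    {lam mu : ℝ} (hV : S.IsStarEtaRicciSoliton V lam mu) (hE : S.IsEtaEinstein a b)
    (hd : Module.finrank ℝ E = 2 * n + s) (hn : n ≠ 0) (hs : 0 < s)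
    (hnormal : 1 < s → S.IsNormal) (hβ : β ≠ 0) (hK : S.IsWeakKenmotsu fun _ ↦ β)
    (hVD : ∀ (x : M) (i : Fin s), S.η i x (V x) = 0) (x : M) : a x + 2 * n * s * β ^ 2 = 0 := by
  obtain ⟨U, hU, hx, e, he⟩ := exists_isOrthonormalFrameOn I x
  have : Nonempty (Fin (Module.finrank ℝ E)) := ⟨⟨0, by omega⟩⟩
  exact he.add_eq_zero_of_horizontal hU S hd hnormal hβ hK hE
    (hE.add_eq hd hs hnormal hβ hK) hV hn ⟨0, hs⟩ (fun x ↦ hVD x _) hx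

end

section

variable {n : ℕ} {S : WeakMetricFStructure I M n 1} {β : ℝ} {a b : M → ℝ}
  {V : Π x : M, TangentSpace I x} {lam mu : ℝ}

/-- If A(x) ≠ 0, one works on a frame domain on which A has no zero. There w is not identically
zero, which contradicts `solitonGrad_eq_zero` for n ≥ 2. For n = 1 one shrinks further to the set
where w ≠ 0 and applies the inconsistent system. -/
theorem IsStarEtaRicciSoliton.add_eq_zero (hV : S.IsStarEtaRicciSoliton V lam mu)
    (hE : S.IsEtaEinstein a b) (hd : Module.finrank ℝ E = 2 * n + 1) (hn : n ≠ 0)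
    (hβ : β ≠ 0) (hK : S.IsWeakKenmotsu fun _ ↦ β) (x : M) :
    a x + 2 * n * (1 : ℕ) * β ^ 2 = 0 := by
  have hnormal : 1 < 1 → S.IsNormal := fun h ↦ absurd h (lt_irrefl 1)
  have hab := hE.add_eq hd one_pos hnormal hβ hK
  by_contra hx0
  obtain ⟨U₀, hU₀, hxU₀, e, he₀⟩ := exists_isOrthonormalFrameOn I x
  have : Nonempty (Fin (Module.finrank ℝ E)) := ⟨⟨0, by omega⟩⟩
  have hc : Continuous fun y ↦ a y + 2 * n * (1 : ℕ) * β ^ 2 := hE.1.continuous.add continuous_const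
  set U : Set M := U₀ ∩ {y | a y + 2 * n * (1 : ℕ) * β ^ 2 ≠ 0} with hUdef
  have hU : IsOpen U := hU₀.inter (isOpen_ne_fun hc continuous_const)
  have he : IsOrthonormalFrameOn e U := he₀.mono Set.inter_subset_left
  have hA : ∀ y ∈ U, a y + 2 * n * (1 : ℕ) * β ^ 2 ≠ 0 := fun y hy ↦ hy.2
  have hw0 := he.solitonGrad_ne_zero hU S hd hnormal hβ hK hE hab hV hA hn ⟨x, hxU₀, hx0⟩
  obtain rfl | hn2 : n = 1 ∨ 2 ≤ n := by omega
  · set w := he.solitonGrad hU S hd hnormal hβ hK hV.1 with hw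
    obtain ⟨y, hy, hwy⟩ : ∃ y ∈ U, w.ext y ≠ 0 := by
      by_contra! h
      exact hw0 (SmoothField.eq_iff.2 fun y hy ↦ by rw [h y hy, SmoothField.ext_zero]; rfl)
    set U₁ : Set M := U ∩ (fun z ↦ (⟪w.ext z, w.ext z⟫ : ℝ)) ⁻¹' {0}ᶜ with hU₁def
    have hU₁ : IsOpen U₁ := (contMDiffOn_inner w.contMDiffOn_ext
      w.contMDiffOn_ext).continuousOn.isOpen_inter_preimage hU isOpen_compl_singleton
    have he₁ : IsOrthonormalFrameOn e U₁ := he.mono Set.inter_subset_left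
    refine he₁.false_of_solitonGrad_ne_zero hU₁ S hd hnormal hβ hK hE hab hV
      (fun z hz ↦ hA z hz.1) ⟨y, hy, fun h ↦ hwy (inner_self_eq_zero.1 h)⟩ fun z hz h ↦ hz.2 ?_
    -- The gradients built on `U` and on `U₁` are different terms; the frame-free formula for them
    -- shows that they agree at `z`.
    have : w.ext z = 0 := ext_inner_right ℝ fun u ↦ by
      rw [hw, he.inner_ext_solitonGrad hU S hd hnormal hβ hK hV.1 hz.1 u,
        ← he₁.inner_ext_solitonGrad hU₁ S hd hnormal hβ hK hV.1 hz u, h]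
    change (⟪w.ext z, w.ext z⟫ : ℝ) = 0
    rw [this, inner_zero_left]
  · exact hw0 (he.solitonGrad_eq_zero hU S hd hnormal hβ hK hE hab hV hA hn2)

end

end WeakMetricFStructure

end

end FKenmotsu

/-! ### The main theorem. -/

theorem theorem5 (n s : ℕ) (hn : 0 < n) (hs : 0 < s)
    {M : Type*} [TopologicalSpace M] [ChartedSpace (EuclideanSpace ℝ (Fin (2 * n + s))) M]
    [IsManifold (𝓡 (2 * n + s)) ∞ M]
    [RiemannianBundle (fun x : M ↦ TangentSpace (𝓡 (2 * n + s)) x)]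
    [IsContMDiffRiemannianBundle (𝓡 (2 * n + s)) ∞ (EuclideanSpace ℝ (Fin (2 * n + s)))
      (fun x : M ↦ TangentSpace (𝓡 (2 * n + s)) x)]
    (S : FKenmotsu.WeakMetricFStructure (𝓡 (2 * n + s)) M n s)
    (hnormal : 1 < s → S.IsNormal)
    (β : ℝ) (hβ : β ≠ 0) (hK : S.IsWeakKenmotsu (fun _ ↦ β))
    (a b : M → ℝ) (hE : S.IsEtaEinstein a b)
    (V : Π x : M, TangentSpace (𝓡 (2 * n + s)) x) (lam mu : ℝ)
    (hV : S.IsStarEtaRicciSoliton V lam mu)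
    (hVD : 1 < s → ∀ (x : M) (i : Fin s), S.η i x (V x) = 0) :
    (∀ x : M, a x = -2 * s * n * β ^ 2) ∧
    (∀ x : M, b x = 2 * ((s : ℝ) - 1) * n * β ^ 2) ∧
    (∀ x : M, FKenmotsu.scalarCurvature (𝓡 (2 * n + s)) x = -2 * s * n * (2 * n + 1) * β ^ 2) ∧
    (s = 1 → FKenmotsu.IsEinstein (𝓡 (2 * n + s)) M) := by
  have hd : Module.finrank ℝ (EuclideanSpace ℝ (Fin (2 * n + s))) = 2 * n + s :=
    finrank_euclideanSpace_fin
  have hab := hE.add_eq hd hs hnormal hβ hK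
  have ha : ∀ x, a x + 2 * n * s * β ^ 2 = 0 := by
    obtain rfl | h : s = 1 ∨ 1 < s := by omega
    · exact hV.add_eq_zero hE hd hn.ne' hβ hK
    · exact hV.add_eq_zero_of_horizontal hE hd hn.ne' hs hnormal hβ hK (hVD h)
  refine ⟨fun x ↦ by linear_combination ha x, fun x ↦ by linear_combination hab x - ha x,
    fun x ↦ ?_, ?_⟩
  · rw [hE.scalarCurvature_eq hd]
    linear_combination 2 * (n : ℝ) * ha x + s * hab x
  · rintro rfl
    -- For s = 1 both a and a + b equal -2nβ², so the η-terms of the Ricci tensor cancel.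
    refine ⟨-(2 * n * β ^ 2), fun x u v ↦ ?_⟩
    have hx := ha x
    rw [hE.2.2, hab, FKenmotsu.WeakMetricFStructure.ηbar, FKenmotsu.WeakMetricFStructure.ηbar]
    simp only [Fin.sum_univ_one]
    push_cast at hx
    linear_combination (⟪u, v⟫ - S.η 0 x u * S.η 0 x v : ℝ) * hx
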